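/- **Theorem 4.1.** *Setting.* A class of counting queries is given by a universe $\mathcal U$, a finite set $\mathcal Q$ of query descriptions with $|\mathcal Q|\ge 2$, and a predicate $P:\mathcal Q\times\mathcal U\to\{0,1\}$. For a database $D\in\mathcal U^n$ put $f^D(q)=\frac1n\sum_{i=1}^n P(q,D_i)$, and for $u\in\mathcal U$ put $p_u=P(\cdot,u)$. Let $\mathcal G$ be a set of probability distributions on $\mathcal Q$. For $\mu\ge1$ the $\mu$-smooth extension of $\mathcal G$ is the set of all distributions $G'$ on $\mathcal Q$ such that $G'[q]\le\mu\,G[q]$ for all $q$, for some $G\in\mathcal G$. *Algorithms* are programs of a probabilistic random access machine with unit-cost instructions. Its cells hold real numbers, queries or items; it has registers and arrays (fresh zeroed work space can be allocated in one step), performs $+,-,\times,\div,\exp,\log$, comparisons and equality tests, evaluates $P$, tosses coins of a given bias, asks for a random example, and may have any further fixed family of basic operations on cells. Constants in programs are natural numbers. Running times are worst-case numbers of steps. An algorithm that outputs a function on $\mathcal Q$ outputs a finite description of it, together with a fixed deterministic program that evaluates a described function at a given query; "runs in time $T$" means that it always halts within $T$ steps with a valid description, which can be evaluated at any query within $T$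 steps. *Learning.* For a set $\mathcal F$ of predicates on $\mathcal Q$, the $n$-thresholds over $\mathcal F$ with threshold $\theta\in[0,1]$ are the functions $\mathbb I\{\frac1n\sum_{i=1}^n f_i\ge \theta\}$ with $f_1,\dots,f_n\in\mathcal F$. An algorithm $L$ learns thresholds over $(\mathcal Q,\mathcal G',\mathcal F)$ using $b(n,\gamma,\beta)$ random examples and running in time $t(n,\gamma,\beta)$ if for all $n\ge1$, $\gamma,\beta\in(0,1)$, $\theta\in[0,1]$, every $n$-threshold $f$ over $\mathcal F$ with threshold $\theta$ and every $G\in\mathcal G'$ the following holds: given $n,\theta,\gamma,\beta$ and sampling access to labeled examples $(q,f(q))$, $q\sim G$, it always draws at most $b(n,\gamma,\beta)$ examples, runs in time $t(n,\gamma,\beta)$, and outputs a hypothesis $h:\mathcal Q\to\{0,1\}$ with $$\Pr_h\big[\Pr_{q\sim G}[h(q)\ne f(q)]>\gamma\big]<\beta .$$ *Data release.* A data release algorithm $A$ has only sampling access to a distribution $G\in\mathcal G$; it takes a database $D\in\mathcal U^n$ and numerical parameters and outputs a synopsis $S:\mathcal Q\to[0,1]$. For databases of size $n$, it is $(\alpha,\beta,\gamma)$-accurate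 if for all $D\in\mathcal U^n$ and $G\in\mathcal G$ $$\Pr_S\big[\Pr_{q\sim G}[|S(q)-f^D(q)|>\alpha]>\gamma\big]<\beta ,$$ and $\varepsilon$-differentially private if for all $G\in\mathcal G$, all $D,D'\in\mathcal U^n$ differing in at most one position and every set $R$ of outputs, $\Pr[A(D)\in R]\le e^{\varepsilon}\Pr[A(D')\in R]$. (The output here is the description of $S$.) *Statement.* There are absolute constants $C,c_1,c_2,c_3>0$ and $K\in\mathbb N$ such that every program $L$ can be converted into a program $A$ with the following property. Let $\mathcal U,\mathcal Q,P,\mathcal G$ be as above, let $\varepsilon>0$ and $\alpha,\beta,\gamma\in(0,1)$, and put $$n'=\lceil c_1\log|\mathcal Q|/\alpha^2\rceil,\qquad \beta'=c_2\,\beta\alpha,\qquad \gamma'=c_3\,\gamma\alpha .$$ Suppose that $L$ learns thresholds over $(\mathcal Q,\mathcal G',\{p_u:u\in\mathcal U\})$ using $b(\cdot)$ random examples and running in time $t(\cdot)$, where $\mathcal G'$ is the $(2/\gamma)$-smooth extension of $\mathcal G$; that $b(n',\gamma',\beta')\ge1$; and that $$n\ \ge\ \frac{C\cdot b(n',\gamma',\beta')\cdot\log\!\Big(\frac{b(n',\gamma',\beta')}{\alpha\gamma\beta}\Big)\cdot\log(1/\beta')}{\varepsilon\,\alpha\,\gamma}.$$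 Then $A$, given the numbers $n,\varepsilon,\alpha,\beta,\gamma,n',b(n',\gamma',\beta'),t(n',\gamma',\beta')$, is an $\varepsilon$-differentially private $(\alpha,\beta,\gamma)$-accurate data release algorithm for databases of size $n$. It accesses the query distribution only by sampling, and it runs in time at most $$K\big(1+t(n',\gamma',\beta')+n+\tfrac1\alpha+\log\tfrac1\beta+\tfrac1\gamma\big)^K .$$ -/

import Mathlib

open scoped ENNReal NNReal

noncomputable section

namespace DataRelease

/-! ### Counting queries, thresholds, distributions -/

section Basic

variable {U : Type*} {Q : Type*}

/-- The fraction of the items of the database `D` that satisfy the query `q`. -/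
def countingAnswer (P : Q → U → Bool) {n : ℕ} (D : Fin n → U) (q : Q) : ℝ :=
  (∑ i, if P q (D i) then (1 : ℝ) else 0) / n

/-- The `n`-thresholds over a set `F` of predicates on `Q`: the functions
`𝕀{(f₁ + ⋯ + fₙ) / n ≥ θ}` with all `fᵢ` in `F`. -/
def nThresholds (F : Set (Q → Bool)) (n : ℕ) (θ : ℝ) : Set (Q → Bool) :=
  {f | ∃ g : Fin n → Q → Bool, (∀ i, g i ∈ F) ∧
    ∀ q, (f q = true ↔ θ ≤ (∑ i, if g i q then (1 : ℝ) else 0) / n)}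

/-- The predicates `p_u = P(·, u)`, for `u` in the data universe. -/
def itemPredicates (P : Q → U → Bool) : Set (Q → Bool) :=
  Set.range fun (u : U) (q : Q) => P q u

/-- The `μ`-smooth extension of a set `𝒢` of distributions. -/
def smoothExtension (μ : ℝ) (𝒢 : Set (PMF Q)) : Set (PMF Q) :=
  {G' | ∃ G ∈ 𝒢, ∀ q, G' q ≤ ENNReal.ofReal μ * G q}

/-- The probability of an event under a discrete distribution. -/
def prob {R : Type*} (p : PMF R) (S : Set R) : ℝ≥0∞ := p.toOuterMeasure S

/-- Two databases of the same size are adjacent if they differ in at most one position. -/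
def Adjacent {n : ℕ} (D D' : Fin n → U) : Prop := {i | D i ≠ D' i}.ncard ≤ 1

/-- `ε`-differential privacy of a randomized map `M` on databases of size `n`. -/
def DifferentiallyPrivate {R : Type*} {n : ℕ} (ε : ℝ) (M : (Fin n → U) → PMF R) : Prop :=
  ∀ D D' : Fin n → U, Adjacent D D' → ∀ S : Set R,
    prob (M D) S ≤ ENNReal.ofReal (Real.exp ε) * prob (M D') S

end Basic

/-! ### The machine model

A probabilistic random access machine at unit cost. A memory cell holds a real number, a query
or an item. The machine computes with real numbers, evaluates the predicate `P` on a query and an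
item, tosses coins of a given bias, asks for a random example and, so that learners may look into
the queries, has any further family of basic operations, indexed by `Op`. A program is a finite
text whose only constants are natural numbers. Its running time is the number of steps. -/

/-- The content of a memory cell. -/
inductive Word (U : Type*) (Q : Type*)
  | num (x : ℝ)
  | qry (q : Q)
  | itm (u : U)

namespace Word

variable {U : Type*} {Q : Type*}

/-- The number in a cell (`0` if the cell holds no number). -/
def val : Word U Q → ℝ
  | num x => x
  | _ => 0

/-- A truth value as a number `0` or `1`. -/
def bit (b : Bool) : Word U Q := num (if b then 1 else 0)

/-- The address denoted by a cell. -/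
def addr (w : Word U Q) : ℕ := ⌊w.val⌋₊

end Word

/-- Basic operations; `exp` and `log` ignore the second argument. -/
inductive BasicOp (Op : Type*)
  | add | sub | mul | div | exp | log | le | eq | pred
  | ext (o : Op)

/-- Instructions. Registers and arrays are named by natural numbers in the program text. -/
inductive Instr (Op : Type*)
  /-- `x := c` -/
  | const (x c : ℕ)
  /-- `x := y` -/
  | move (x y : ℕ)
  /-- `x := o(y, z)` -/
  | op (o : BasicOp Op) (x y z : ℕ)
  /-- `x := a[i]`, where the register `i` holds the address -/
  | load (x a i : ℕ)
  /-- `a[i] := x`, where the register `i` holds the address -/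
  | store (a i x : ℕ)
  /-- allocate fresh work space: all registers and arrays numbered `m` or higher become zero -/
  | reset (m : ℕ)
  /-- `x := 1` with the probability in register `p`, and `x := 0` otherwise -/
  | toss (x p : ℕ)
  /-- ask for a fresh random example `(q, l)`, and set `x := q` and `y := l` -/
  | draw (x y : ℕ)
  /-- append the content of `x` to the output -/
  | emit (x : ℕ)

/-- Programs. A test on the register `x` succeeds if it does not hold the number `0`. -/
inductive Program (Op : Type*)
  | instr (i : Instr Op)
  | seq (c d : Program Op)
  | cond (x : ℕ) (c d : Program Op)
  | loop (x : ℕ) (c : Program Op)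

/-- The memory: registers and arrays. -/
structure Memory (U : Type*) (Q : Type*) where
  reg : ℕ → Word U Q
  arr : ℕ → ℕ → Word U Q

/-- `x := w` -/
def Memory.set {U Q : Type*} (m : Memory U Q) (x : ℕ) (w : Word U Q) : Memory U Q :=
  { m with reg := Function.update m.reg x w }

/-- A configuration: the programs still to be executed, the memory, the output written so far and
the number of examples drawn so far. The machine has halted when `code` is empty. -/
structure Config (U : Type*) (Q : Type*) (Op : Type*) where
  code : List (Program Op)
  mem : Memory U Q
  out : List (Word U Q)
  draws : ℕ

/-- The interpretation of the basic operations that are not arithmetic. -/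
structure Primitives (U : Type*) (Q : Type*) (Op : Type*) where
  pred : Q → U → Bool
  ext : Op → Word U Q → Word U Q → Word U Q

/-- The sources of randomness: the example oracle and the coins. -/
structure Env (U : Type*) (Q : Type*) where
  examples : PMF (Word U Q × Word U Q)
  coin : ℝ → PMF Bool

/-- The coin that shows `true` with probability `p` (with `p` clipped to `[0, 1]`). -/
def biasedCoin (p : ℝ) : PMF Bool :=
  PMF.ofFintype (fun b => if b then min (ENNReal.ofReal p) 1 else 1 - min (ENNReal.ofReal p) 1)
    (by simp)

section Semantics

variable {U : Type*} {Q : Type*} {Op : Type*}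

open Classical in
/-- The value of a basic operation. -/
def BasicOp.apply (prim : Primitives U Q Op) : BasicOp Op → Word U Q → Word U Q → Word U Q
  | .add, v, w => .num (v.val + w.val)
  | .sub, v, w => .num (v.val - w.val)
  | .mul, v, w => .num (v.val * w.val)
  | .div, v, w => .num (v.val / w.val)
  | .exp, v, _ => .num (Real.exp v.val)
  | .log, v, _ => .num (Real.log v.val)
  | .le, v, w => .bit (decide (v.val ≤ w.val))
  | .eq, v, w => .bit (decide (v = w))
  | .pred, .qry q, .itm u => .bit (prim.pred q u)
  | .pred, _, _ => .num 0
  | .ext o, v, w => prim.ext o v w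

/-- Execution of one instruction. -/
def Instr.exec (prim : Primitives U Q Op) (env : Env U Q) (c : Config U Q Op) :
    Instr Op → PMF (Config U Q Op)
  | .const x k => .pure { c with mem := c.mem.set x (.num k) }
  | .move x y => .pure { c with mem := c.mem.set x (c.mem.reg y) }
  | .op o x y z => .pure { c with mem := c.mem.set x (o.apply prim (c.mem.reg y) (c.mem.reg z)) }
  | .load x a i => .pure { c with mem := c.mem.set x (c.mem.arr a (c.mem.reg i).addr) }
  | .store a i x => .pure { c with mem := { c.mem with
      arr := Function.update c.mem.arr a
        (Function.update (c.mem.arr a) (c.mem.reg i).addr (c.mem.reg x)) } }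
  | .reset m => .pure { c with mem := {
      reg := fun x => if x < m then c.mem.reg x else .num 0
      arr := fun a => if a < m then c.mem.arr a else fun _ => .num 0 } }
  | .toss x p => (env.coin (c.mem.reg p).val).map fun b =>
      { c with mem := c.mem.set x (.bit b) }
  | .draw x y => env.examples.map fun e =>
      { c with mem := (c.mem.set x e.1).set y e.2, draws := c.draws + 1 }
  | .emit x => .pure { c with out := c.out ++ [c.mem.reg x] }

open Classical in
/-- One step of the machine; a halted machine does not change. -/
def step (prim : Primitives U Q Op) (env : Env U Q) (c : Config U Q Op) : PMF (Config U Q Op) :=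
  match c.code with
  | [] => .pure c
  | .instr i :: k => i.exec prim env { c with code := k }
  | .seq p r :: k => .pure { c with code := p :: r :: k }
  | .cond x p r :: k =>
      .pure { c with code := (if c.mem.reg x = .num 0 then r else p) :: k }
  | .loop x p :: k =>
      .pure { c with code := if c.mem.reg x = .num 0 then k else p :: .loop x p :: k }

/-- The distribution of the configuration after `T` steps. -/
def run (prim : Primitives U Q Op) (env : Env U Q) : ℕ → Config U Q Op → PMF (Config U Q Op)
  | 0, c => .pure c
  | T + 1, c => (step prim env c).bind (run prim env T)

/-- A list as the content of an array, with zeros behind it. -/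
def listCells (l : List (Word U Q)) (i : ℕ) : Word U Q := l.getD i (.num 0)

/-- The initial configuration of the program `p`: the words `args` in the registers `0, 1, …`, the
words `data` in the cells `0, 1, …` of array `0`, and zeros elsewhere. -/
def start (p : Program Op) (args data : List (Word U Q)) : Config U Q Op where
  code := [p]
  mem := { reg := listCells args, arr := fun a => if a = 0 then listCells data else fun _ => .num 0 }
  out := []
  draws := 0

end Semantics

/-! ### Algorithms that output a function -/

/-- An algorithm whose output is a function on queries: the program `main` writes a description of
the function, and the program `eval` evaluates a described function at a query. -/
structure FunAlg (Op : Type*) where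
  main : Program Op
  eval : Program Op

section Algorithms

variable {U : Type*} {Q : Type*} {Op : Type*}

/-- Sampling access to a distribution on the queries. -/
def Env.sampling (G : PMF Q) : Env U Q where
  examples := G.map fun q => (.qry q, .num 0)
  coin := biasedCoin

/-- Sampling access to examples drawn from `G` and labeled by `f`. -/
def Env.labeled (G : PMF Q) (f : Q → Bool) : Env U Q where
  examples := G.map fun q => (.qry q, .bit (f q))
  coin := biasedCoin

/-- No randomness (descriptions are evaluated deterministically): coins and the example oracle
always return zeros. -/
def Env.deterministic : Env U Q where
  examples := .pure (.num 0, .num 0)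
  coin := fun _ => .pure false

/-- The description `d` represents the function `h`: at each query `q` the program `e`, started on
`q`, the length of `d` and `d`, halts within `T` steps with output `h q`. -/
def Represents (prim : Primitives U Q Op) (e : Program Op) (T : ℕ) (d : List (Word U Q))
    (h : Q → Word U Q) : Prop :=
  ∀ q, ∀ c ∈ (run prim .deterministic T (start e [.qry q, .num d.length] d)).support,
    c.code = [] ∧ c.out = [h q]

/-- The initial configuration of a learner: it is given `n`, the threshold `θ`, `γ` and `β`. -/
def learnerStart (L : FunAlg Op) (n : ℕ) (θ γ β : ℝ) : Config U Q Op :=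
  start L.main [.num n, .num θ, .num γ, .num β] []

/-- `L` is a `(γ, β)`-learning algorithm for thresholds over `(Q, 𝒢, F)` from random labeled
examples, using at most `b n γ β` examples and running in time `t n γ β`. In particular its
hypotheses can be evaluated in time `t n γ β`. -/
def LearnsThresholds (prim : Primitives U Q Op) (L : FunAlg Op) (𝒢 : Set (PMF Q))
    (F : Set (Q → Bool)) (b t : ℕ → ℝ → ℝ → ℕ) : Prop :=
  ∀ n : ℕ, 0 < n → ∀ γ ∈ Set.Ioo (0 : ℝ) 1, ∀ β ∈ Set.Ioo (0 : ℝ) 1, ∀ θ ∈ Set.Icc (0 : ℝ) 1,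
  ∀ f ∈ nThresholds F n θ, ∀ G ∈ 𝒢,
    (∀ c ∈ (run prim (.labeled G f) (t n γ β) (learnerStart L n θ γ β)).support,
      c.code = [] ∧ c.draws ≤ b n γ β ∧
      ∃ h : Q → Bool, Represents prim L.eval (t n γ β) c.out fun q => .bit (h q)) ∧
    prob ((run prim (.labeled G f) (t n γ β) (learnerStart L n θ γ β)).map Config.out)
      {d | ∃ h : Q → Bool, Represents prim L.eval (t n γ β) d (fun q => .bit (h q)) ∧
        ENNReal.ofReal γ < prob G {q | h q ≠ f q}} < ENNReal.ofReal β

/-- The initial configuration of a release algorithm: it is given numerical parameters and the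
database. -/
def releaseStart (A : FunAlg Op) (params : List ℝ) {n : ℕ} (D : Fin n → U) : Config U Q Op :=
  start A.main (params.map .num) ((List.ofFn D).map .itm)

/-- The distribution of the synopsis (as a description) released from the database `D` after `T`
steps, with sampling access to `G`. -/
def synopsis (prim : Primitives U Q Op) (A : FunAlg Op) (params : List ℝ) (T : ℕ) (G : PMF Q)
    {n : ℕ} (D : Fin n → U) : PMF (List (Word U Q)) :=
  (run prim (.sampling G) T (releaseStart A params D)).map Config.out

/-- `A` runs in time `T` on databases of size `n`: with sampling access to any `G` in `𝒢` it always
halts within `T` steps with (a description of) a synopsis `S : Q → [0, 1]`, which can be evaluated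
in time `T`. -/
def ReleasesInTime (prim : Primitives U Q Op) (A : FunAlg Op) (params : List ℝ)
    (𝒢 : Set (PMF Q)) (n T : ℕ) : Prop :=
  ∀ G ∈ 𝒢, ∀ D : Fin n → U,
    ∀ c ∈ (run prim (.sampling G) T (releaseStart A params D)).support,
      c.code = [] ∧ ∃ S : Q → ℝ, (∀ q, S q ∈ Set.Icc (0 : ℝ) 1) ∧
        Represents prim A.eval T c.out fun q => .num (S q)

/-- `A` is `(α, β, γ)`-accurate for databases of size `n` and query distributions in `𝒢`. -/
def AccurateRelease (prim : Primitives U Q Op) (A : FunAlg Op) (params : List ℝ)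
    (𝒢 : Set (PMF Q)) (n T : ℕ) (α β γ : ℝ) : Prop :=
  ∀ G ∈ 𝒢, ∀ D : Fin n → U,
    prob (synopsis prim A params T G D)
      {d | ∃ S : Q → ℝ, Represents prim A.eval T d (fun q => .num (S q)) ∧
        ENNReal.ofReal γ < prob G {q | α < |S q - countingAnswer prim.pred D q|}}
      < ENNReal.ofReal β

end Algorithms

end DataRelease

end

open scoped ENNReal NNReal

noncomputable section

namespace DataRelease

/-! ### A program logic -/

section Logic

variable {U : Type*} {Q : Type*} {Op : Type*}

@[simp] lemma Memory.set_reg (m : Memory U Q) (x y : ℕ) (w : Word U Q) :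
    (m.set x w).reg y = if y = x then w else m.reg y := by
  simp [Memory.set, Function.update_apply]

@[simp] lemma Memory.set_arr (m : Memory U Q) (x : ℕ) (w : Word U Q) :
    (m.set x w).arr = m.arr := rfl

lemma run_halted (prim : Primitives U Q Op) (env : Env U Q) (T : ℕ) (c : Config U Q Op)
    (h : c.code = []) : run prim env T c = .pure c := by
  induction T with
  | zero => rfl
  | succ T ih => simp [run, step, h, PMF.pure_bind, ih]

/-- From the configuration `c` the machine reaches, within `B` steps on every path, configurations
that satisfy `Post a`, where the ghost value `a` has the distribution `κ`. -/
inductive Reaches (prim : Primitives U Q Op) (env : Env U Q) {R : Type*}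
    (Post : R → Config U Q Op → Prop) : Config U Q Op → ℕ → PMF R → Prop
  | done {c : Config U Q Op} {a : R} (B : ℕ) (h : Post a c) : Reaches prim env Post c B (.pure a)
  | step {c : Config U Q Op} (B : ℕ) (κ : Config U Q Op → PMF R)
      (h : ∀ c' ∈ (step prim env c).support, Reaches prim env Post c' B (κ c')) :
      Reaches prim env Post c (B + 1) ((step prim env c).bind κ)

variable {prim : Primitives U Q Op} {env : Env U Q}

lemma PMF.bind_congr_support {X Y : Type*} (p : PMF X) {f g : X → PMF Y}
    (h : ∀ x ∈ p.support, f x = g x) : p.bind f = p.bind g := by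
  ext y
  simp only [PMF.bind_apply]
  refine tsum_congr fun x => ?_
  by_cases hx : x ∈ p.support
  · rw [h x hx]
  · rw [PMF.mem_support_iff, not_not] at hx
    simp [hx]

lemma Reaches.mono {R : Type*} {Post : R → Config U Q Op → Prop} {c : Config U Q Op} {B B' : ℕ}
    {κ : PMF R} (h : Reaches prim env Post c B κ) (hB : B ≤ B') : Reaches prim env Post c B' κ := by
  induction h generalizing B' with
  | done B h => exact .done _ h
  | step B κ h ih =>
    obtain ⟨B'', rfl⟩ : ∃ B'', B' = B'' + 1 := ⟨B' - 1, by omega⟩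
    exact .step _ _ fun c' hc' => ih c' hc' (by omega)

lemma Reaches.bind {R S : Type*} {Post : R → Config U Q Op → Prop}
    {Post' : S → Config U Q Op → Prop} {c : Config U Q Op} {B B' : ℕ}
    {κ : PMF R} {κ' : R → PMF S} (h : Reaches prim env Post c B κ)
    (h' : ∀ a ∈ κ.support, ∀ c', Post a c' → Reaches prim env Post' c' B' (κ' a)) :
    Reaches prim env Post' c (B + B') (κ.bind κ') := by
  induction h with
  | done B h =>
    rw [PMF.pure_bind]
    exact (h' _ (by simp) _ h).mono (by omega)
  | step B κ h ih =>
    rw [PMF.bind_bind, Nat.add_right_comm]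
    refine .step _ _ fun c' hc' => ih c' hc' fun a ha c'' hc'' => h' a ?_ c'' hc''
    rw [PMF.mem_support_bind_iff]
    exact ⟨c', hc', ha⟩

lemma Reaches.conseq {R : Type*} {Post Post' : R → Config U Q Op → Prop} {c : Config U Q Op}
    {B : ℕ} {κ : PMF R} (h : Reaches prim env Post c B κ)
    (hP : ∀ a ∈ κ.support, ∀ c', Post a c' → Post' a c') : Reaches prim env Post' c B κ := by
  have := h.bind (B' := 0) (κ' := PMF.pure) fun a ha c' hc' => .done 0 (hP a ha c' hc')
  simpa using this

lemma Reaches.map {R S : Type*} {Post : R → Config U Q Op → Prop}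
    {Post' : S → Config U Q Op → Prop} {c : Config U Q Op}
    {B : ℕ} {κ : PMF R} (f : R → S) (h : Reaches prim env Post c B κ)
    (hP : ∀ a ∈ κ.support, ∀ c', Post a c' → Post' (f a) c') :
    Reaches prim env Post' c B (κ.map f) :=
  h.bind (B' := 0) fun a ha c' hc' => .done 0 (hP a ha c' hc')

lemma Reaches.det_step {R : Type*} {Post : R → Config U Q Op → Prop} {c c' : Config U Q Op} {B : ℕ}
    {κ : PMF R} (hs : DataRelease.step prim env c = .pure c') (h : Reaches prim env Post c' B κ) :
    Reaches prim env Post c (B + 1) κ := by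
  have := Reaches.step (prim := prim) (env := env) (Post := Post) (c := c) B (fun _ => κ) (by
    rw [hs]; intro c'' hc''
    rw [PMF.support_pure, Set.mem_singleton_iff] at hc''
    subst hc''; exact h)
  rwa [PMF.bind_const] at this

/-- If the reached configurations have halted, they are the ones seen at any later time. -/
lemma Reaches.run_map {R : Type*} {Post : R → Config U Q Op → Prop} {c : Config U Q Op}
    {B T : ℕ} {κ : PMF R} (h : Reaches prim env Post c B κ)
    (hhalt : ∀ a ∈ κ.support, ∀ c', Post a c' → c'.code = []) {S : Type*} (f : R → S)
    (g : Config U Q Op → S) (hfg : ∀ a c', Post a c' → g c' = f a) (hT : B ≤ T) :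
    (run prim env T c).map g = κ.map f := by
  induction h generalizing T with
  | done B h =>
    rw [run_halted _ _ _ _ (hhalt _ (by simp) _ h), PMF.pure_map, PMF.pure_map, hfg _ _ h]
  | step B κ h ih =>
    obtain ⟨T, rfl⟩ : ∃ T', T = T' + 1 := ⟨T - 1, by omega⟩
    rw [run, PMF.map_bind, PMF.map_bind]
    refine PMF.bind_congr_support _ fun c' hc' => ih c' hc' (fun a ha => hhalt a ?_) (by omega)
    rw [PMF.mem_support_bind_iff]
    exact ⟨c', hc', ha⟩

lemma Reaches.run_support {R : Type*} {Post : R → Config U Q Op → Prop} {c : Config U Q Op}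
    {B T : ℕ} {κ : PMF R} (h : Reaches prim env Post c B κ)
    (hhalt : ∀ a ∈ κ.support, ∀ c', Post a c' → c'.code = []) (hT : B ≤ T) :
    ∀ c' ∈ (run prim env T c).support, ∃ a ∈ κ.support, Post a c' := by
  induction h generalizing T with
  | done B h =>
    rw [run_halted _ _ _ _ (hhalt _ (by simp) _ h)]
    intro c' hc'
    rw [PMF.support_pure, Set.mem_singleton_iff] at hc'
    exact ⟨_, by simp, hc' ▸ h⟩
  | step B κ h ih =>
    obtain ⟨T, rfl⟩ : ∃ T', T = T' + 1 := ⟨T - 1, by omega⟩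
    intro c'' hc''
    rw [run, PMF.mem_support_bind_iff] at hc''
    obtain ⟨c', hc', hc''⟩ := hc''
    have key : ∀ a ∈ (κ c').support, a ∈ ((DataRelease.step prim env _).bind κ).support :=
      fun a ha => by rw [PMF.mem_support_bind_iff]; exact ⟨c', hc', ha⟩
    obtain ⟨a, ha, hp⟩ := ih c' hc' (T := T) (fun a ha => hhalt a (key a ha)) (by omega) c'' hc''
    exact ⟨a, key a ha, hp⟩

variable (prim env) in
/-- A triple: started in the memory `m` with the output `o`, the program `p` runs for at most `B`
steps; the final memory and output satisfy `Post a` for a ghost value `a` with distribution `κ`. -/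
def Triple {R : Type*} (p : Program Op) (m : Memory U Q) (o : List (Word U Q)) (B : ℕ) (κ : PMF R)
    (Post : R → Memory U Q → List (Word U Q) → Prop) : Prop :=
  ∀ k d, Reaches prim env (fun a c => c.code = k ∧ Post a c.mem c.out) ⟨p :: k, m, o, d⟩ B κ

section Triple

variable {R S : Type*} {p r : Program Op} {m : Memory U Q} {o : List (Word U Q)} {B B' : ℕ}
  {κ : PMF R} {Post : R → Memory U Q → List (Word U Q) → Prop}

lemma Triple.mono (h : Triple prim env p m o B κ Post) (hB : B ≤ B') :
    Triple prim env p m o B' κ Post := fun k d => (h k d).mono hB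

lemma Triple.conseq {Post' : R → Memory U Q → List (Word U Q) → Prop}
    (h : Triple prim env p m o B κ Post)
    (hP : ∀ a ∈ κ.support, ∀ m o, Post a m o → Post' a m o) : Triple prim env p m o B κ Post' :=
  fun k d => (h k d).conseq fun a ha _ hc => ⟨hc.1, hP a ha _ _ hc.2⟩

lemma Triple.map {Post' : S → Memory U Q → List (Word U Q) → Prop} (f : R → S)
    (h : Triple prim env p m o B κ Post)
    (hP : ∀ a ∈ κ.support, ∀ m o, Post a m o → Post' (f a) m o) :
    Triple prim env p m o B (κ.map f) Post' :=
  fun k d => (h k d).map f fun a ha _ hc => ⟨hc.1, hP a ha _ _ hc.2⟩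

lemma Triple.seq {κ' : R → PMF S} {Post' : S → Memory U Q → List (Word U Q) → Prop}
    (h : Triple prim env p m o B κ Post)
    (h' : ∀ a ∈ κ.support, ∀ m o, Post a m o → Triple prim env r m o B' (κ' a) Post')
    {C : ℕ} (hC : B + B' + 1 ≤ C) :
    Triple prim env (.seq p r) m o C (κ.bind κ') Post' := by
  refine Triple.mono ?_ hC
  intro k d
  refine .det_step rfl ((h (r :: k) d).bind fun a ha c hc => ?_)
  obtain ⟨code, m', o', d'⟩ := c
  obtain ⟨rfl, hp⟩ := hc
  exact h' a ha m' o' hp k d'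

/-- Sequential composition after a program without a ghost value. -/
lemma Triple.seq_unit {Post' : S → Memory U Q → List (Word U Q) → Prop} {κ' : PMF S}
    {Pu : Memory U Q → List (Word U Q) → Prop}
    (h : Triple prim env p m o B (.pure ()) fun _ => Pu)
    (h' : ∀ m o, Pu m o → Triple prim env r m o B' κ' Post') {C : ℕ} (hC : B + B' + 1 ≤ C) :
    Triple prim env (.seq p r) m o C κ' Post' := by
  have := Triple.seq (κ' := fun _ => κ') h (fun _ _ m o hp => h' m o hp) hC
  rwa [PMF.pure_bind] at this

/-- Sequential composition before a program without a ghost value. -/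
lemma Triple.seq_then {Post' : R → Memory U Q → List (Word U Q) → Prop}
    (h : Triple prim env p m o B κ Post)
    (h' : ∀ a ∈ κ.support, ∀ m o, Post a m o →
      Triple prim env r m o B' (.pure ()) fun _ => Post' a) {C : ℕ} (hC : B + B' + 1 ≤ C) :
    Triple prim env (.seq p r) m o C κ Post' := by
  have := Triple.seq (κ' := PMF.pure) (Post' := Post') (B' := B') (r := r) h
    (fun a ha m o hp => by
      have := (h' a ha m o hp).map (Post' := Post') (fun _ => a) fun _ _ _ _ h => h
      rwa [PMF.pure_map] at this) hC
  rwa [PMF.bind_pure] at this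

lemma Triple.cond_pos {x : ℕ} (hx : m.reg x ≠ .num 0) (h : Triple prim env p m o B κ Post) :
    Triple prim env (.cond x p r) m o (B + 1) κ Post := fun k d =>
  .det_step (by simp [step, hx]) (h k d)

lemma Triple.cond_neg {x : ℕ} (hx : m.reg x = .num 0) (h : Triple prim env r m o B κ Post) :
    Triple prim env (.cond x p r) m o (B + 1) κ Post := fun k d =>
  .det_step (by simp [step, hx]) (h k d)

lemma Triple.instr {i : Instr Op} {f : Memory U Q → Memory U Q}
    {g : List (Word U Q) → List (Word U Q)}
    (hi : ∀ c : Config U Q Op, i.exec prim env c = .pure { c with mem := f c.mem, out := g c.out })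
    {a : R} (h : Post a (f m) (g o)) : Triple prim env (.instr i) m o 1 (.pure a) Post := fun _ _ =>
  .det_step (hi _) (.done 0 ⟨rfl, h⟩)

lemma Triple.emit {x : ℕ} {a : R} (h : Post a m (o ++ [m.reg x])) :
    Triple prim env (.instr (.emit x)) m o 1 (.pure a) Post := fun _ _ =>
  .det_step rfl (.done 0 ⟨rfl, h⟩)

lemma Triple.toss {x y : ℕ} {f : Bool → R} (h : ∀ b, Post (f b) (m.set x (.bit b)) o) :
    Triple prim env (.instr (.toss x y)) m o 1 ((env.coin (m.reg y).val).map f) Post := by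
  classical
  intro k d
  have := Reaches.step (prim := prim) (env := env)
    (Post := fun a c => c.code = k ∧ Post (f a) c.mem c.out)
    (c := ⟨.instr (.toss x y) :: k, m, o, d⟩) 0 (fun c => .pure (decide (c.mem.reg x = .bit true)))
    (by
      intro c' hc'
      simp only [DataRelease.step, Instr.exec, PMF.mem_support_map_iff] at hc'
      obtain ⟨b, -, rfl⟩ := hc'
      refine .done 0 ⟨rfl, ?_⟩
      convert h b using 2
      cases b <;> simp [Word.bit])
  simp only [DataRelease.step, Instr.exec, PMF.bind_map] at this
  have h := this.map (Post' := fun a c => c.code = k ∧ Post a c.mem c.out) f fun _ _ _ h => h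
  convert h using 1
  rw [PMF.map_bind, PMF.map]
  congr 1
  ext1 b
  simp only [Function.comp, PMF.pure_map]
  cases b <;> simp [Word.bit]

lemma Triple.draw {x y : ℕ} {f : Word U Q × Word U Q → R}
    (h : ∀ e ∈ env.examples.support, Post (f e) ((m.set x e.1).set y e.2) o) (hxy : x ≠ y) :
    Triple prim env (.instr (.draw x y)) m o 1 (env.examples.map f) Post := by
  intro k d
  have := Reaches.step (prim := prim) (env := env)
    (Post := fun a c => c.code = k ∧ Post (f a) c.mem c.out)
    (c := ⟨.instr (.draw x y) :: k, m, o, d⟩) 0 (fun c => .pure (c.mem.reg x, c.mem.reg y))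
    (by
      intro c' hc'
      simp only [DataRelease.step, Instr.exec, PMF.mem_support_map_iff] at hc'
      obtain ⟨e, he, rfl⟩ := hc'
      refine .done 0 ⟨rfl, ?_⟩
      simpa [hxy] using h e he)
  simp only [DataRelease.step, Instr.exec, PMF.bind_map] at this
  have h := this.map (Post' := fun a c => c.code = k ∧ Post a c.mem c.out) f fun _ _ _ h => h
  convert h using 1
  rw [PMF.map_bind, PMF.map]
  congr 1
  ext1 e
  simp [Function.comp, PMF.pure_map, hxy]

end Triple

/-- The effect on the memory of an instruction that uses neither randomness nor output. -/
def Instr.effect (prim : Primitives U Q Op) : Instr Op → Memory U Q → Memory U Q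
  | .const x k, m => m.set x (.num k)
  | .move x y, m => m.set x (m.reg y)
  | .op o x y z, m => m.set x (o.apply prim (m.reg y) (m.reg z))
  | .load x a i, m => m.set x (m.arr a (m.reg i).addr)
  | .store a i x, m => { m with
      arr := Function.update m.arr a (Function.update (m.arr a) (m.reg i).addr (m.reg x)) }
  | .reset j, m => {
      reg := fun x => if x < j then m.reg x else .num 0
      arr := fun a => if a < j then m.arr a else fun _ => .num 0 }
  | _, m => m

/-- Instructions that use neither randomness nor output. -/
def Instr.Plain : Instr Op → Prop
  | .toss _ _ | .draw _ _ | .emit _ => False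
  | _ => True

lemma Instr.exec_plain {i : Instr Op} (hi : i.Plain) (c : Config U Q Op) :
    i.exec prim env c = .pure { c with mem := i.effect prim c.mem } := by
  cases i <;> first | rfl | exact hi.elim

/-- Straight-line code. -/
def block : List (Instr Op) → Program Op
  | [] => .instr (.move 0 0)
  | i :: l => .seq (.instr i) (block l)

/-- The effect of straight-line code. -/
def effects (prim : Primitives U Q Op) (l : List (Instr Op)) (m : Memory U Q) : Memory U Q :=
  l.foldl (fun m i => i.effect prim m) m

lemma Triple.block {R : Type*} {l : List (Instr Op)} (hl : ∀ i ∈ l, i.Plain) {m : Memory U Q}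
    {o : List (Word U Q)} {a : R} {Post : R → Memory U Q → List (Word U Q) → Prop}
    (h : Post a (effects prim l m) o) :
    Triple prim env (block l) m o (2 * l.length + 1) (.pure a) Post := by
  induction l generalizing m with
  | nil =>
    refine Triple.instr (f := id) (g := id) (fun c => ?_) h
    have : c.mem.set 0 (c.mem.reg 0) = c.mem := by simp [Memory.set]
    simp [Instr.exec, this]
  | cons i l ih =>
    have := Triple.seq_unit (prim := prim) (env := env) (p := .instr i) (m := m) (o := o) (B := 1)
      (r := DataRelease.block l) (B' := 2 * l.length + 1) (κ' := .pure a) (Post' := Post)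
      (Pu := fun m' o' => m' = i.effect prim m ∧ o' = o)
      (Triple.instr (f := i.effect prim) (g := id)
        (fun c => Instr.exec_plain (hl i (by simp)) c) ⟨rfl, rfl⟩)
      (by
        rintro _ _ ⟨rfl, rfl⟩
        exact ih (fun j hj => hl j (by simp [hj])) h) le_rfl
    exact this.mono (by simp; omega)

/-- The `M`-fold iteration of a randomized step. -/
def iterate {R : Type*} (κ : ℕ → R → PMF R) : ℕ → R → PMF R
  | 0, a => .pure a
  | M + 1, a => (iterate κ M a).bind (κ M)

/-- `for i from (the content of register `i`) while i < lim do body`; the register `8` holds `1`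
and `g` is a scratch register. -/
def forLoop (i lim g : ℕ) (body : Program Op) : Program Op :=
  .seq (block [.op .le g lim i, .op .sub g 8 g])
    (.loop g (.seq body (block [.op .add i i 8, .op .le g lim i, .op .sub g 8 g])))

lemma Triple.forLoop {R : Type*} {i lim g : ℕ} {body : Program Op} {x : ℝ}
    {Inv : ℕ → R → Memory U Q → List (Word U Q) → Prop} {κ : ℕ → R → PMF R} {B : ℕ}
    {m : Memory U Q} {o : List (Word U Q)} {a : R}
    (h8 : g ≠ 8)
    (hInv : ∀ j a m o, j ≤ ⌈x⌉₊ → Inv j a m o →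
      m.reg i = .num j ∧ m.reg lim = .num x ∧ m.reg 8 = .num 1)
    (hg : ∀ j a m o w, j ≤ ⌈x⌉₊ → Inv j a m o → Inv j a (m.set g w) o)
    (h0 : Inv 0 a m o)
    (hbody : ∀ j a m o, j < ⌈x⌉₊ → Inv j a m o → Triple prim env body m o B (κ j a)
      fun a m o => m.reg i = .num j ∧ m.reg 8 = .num 1 ∧ Inv (j + 1) a (m.set i (.num (j + 1))) o) :
    Triple prim env (forLoop i lim g body) m o (⌈x⌉₊ * (B + 10) + 10) (iterate κ ⌈x⌉₊ a) (Inv ⌈x⌉₊) := by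
  intro k d
  set L : Program Op :=
    .loop g (.seq body (DataRelease.block [.op .add i i 8, .op .le g lim i, .op .sub g 8 g])) with hL
  set M := ⌈x⌉₊
  -- the state at the head of the loop
  let Head : ℕ → R → Config U Q Op → Prop := fun j a c => c.code = L :: k ∧
    c.mem.reg g = .num (if x ≤ j then 0 else 1) ∧ Inv j a c.mem c.out
  have hcmp : ∀ (m : Memory U Q) (j : ℕ), m.reg i = .num j → m.reg lim = .num x → m.reg 8 = .num 1 →
      effects prim [.op .le g lim i, .op .sub g 8 g] m
        = (m.set g (.bit (decide (x ≤ j)))).set g (.num (if x ≤ j then 0 else 1)) := by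
    intro m j h1 h2 h3
    simp only [effects, List.foldl, Instr.effect, BasicOp.apply, h1, h2, Memory.set_reg, if_true,
      if_neg h8.symm, h3]
    congr 2
    split_ifs with h <;> simp [Word.bit, Word.val, h]
  have start : Reaches prim env (Head 0) ⟨.seq (DataRelease.block [.op .le g lim i, .op .sub g 8 g]) L :: k,
      m, o, d⟩ 6 (.pure a) := by
    refine .det_step rfl ?_
    have := Triple.block (prim := prim) (env := env) (l := [.op .le g lim i, .op .sub g 8 g])
      (by simp [Instr.Plain]) (m := m) (o := o) (a := a)
      (Post := fun a m o => m.reg g = .num (if x ≤ (0 : ℕ) then 0 else 1) ∧ Inv 0 a m o) (by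
        obtain ⟨h1, h2, h3⟩ := hInv 0 a m o (Nat.zero_le _) h0
        rw [hcmp m 0 h1 h2 h3]
        exact ⟨by simp, hg _ _ _ _ _ (Nat.zero_le _) (hg _ _ _ _ _ (Nat.zero_le _) h0)⟩)
    exact this _ d
  have main : ∀ j ≤ M, Reaches prim env (Head j) ⟨.seq (DataRelease.block [.op .le g lim i, .op .sub g 8 g]) L :: k,
      m, o, d⟩ (6 + j * (B + 10)) (iterate κ j a) := by
    intro j
    induction j with
    | zero => intro _; simpa [iterate] using start
    | succ j ih =>
      intro hj
      have hjx : ¬ x ≤ j := by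
        rw [not_le]; exact Nat.lt_ceil.mp (by omega)
      have := (ih (by omega)).bind (B' := B + 10) (κ' := κ j) (Post' := Head (j + 1)) ?_
      · refine (this.mono ?_)
        ring_nf; omega
      rintro a' - ⟨code, m', o', d'⟩ ⟨rfl, hc2, hc3⟩
      simp only [hjx, if_false] at hc2 hc3
      refine Reaches.mono (B := B + 9 + 1) (.det_step (c' := ⟨.seq body (DataRelease.block [.op .add i i 8, .op .le g lim i, .op .sub g 8 g]) :: L :: k, m', o', d'⟩) (by simp [step, hc2, hL]) ?_) (by omega)
      have := Triple.seq_then (prim := prim) (env := env) (p := body)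
        (r := DataRelease.block [.op .add i i 8, .op .le g lim i, .op .sub g 8 g])
        (B' := 7) (Post' := fun a m o => m.reg g = .num (if x ≤ (j + 1 : ℕ) then 0 else 1) ∧ Inv (j + 1) a m o)
        (hbody j a' m' o' (by omega) hc3) (by
          rintro a'' - m'' o'' ⟨h1, h3, h4⟩
          refine Triple.block (by simp [Instr.Plain]) ?_
          have e : effects prim [.op .add i i 8, .op .le g lim i, .op .sub g 8 g] m''
              = effects prim [.op .le g lim i, .op .sub g 8 g] (m''.set i (.num (j + 1))) := by
            simp [effects, Instr.effect, BasicOp.apply, h1, h3, Word.val]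
          obtain ⟨h5, h6, h7⟩ := hInv _ _ _ _ (by omega) h4
          rw [e, hcmp _ (j + 1) (by simp) h6 h7]
          exact ⟨by simp, hg _ _ _ _ _ (by omega) (hg _ _ _ _ _ (by omega) h4)⟩) le_rfl
      exact ((this (L :: k) d').mono (by omega)).conseq fun a'' _ c'' hc'' => ⟨hc''.1, hc''.2.1, hc''.2.2⟩
  have := (main M le_rfl).bind (B' := 1) (κ' := PMF.pure)
    (Post' := fun a c => c.code = k ∧ Inv M a c.mem c.out) ?_
  · rw [PMF.bind_pure] at this
    exact this.mono (by omega)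
  rintro a' - ⟨code, m', o', d'⟩ ⟨rfl, hc2, hc3⟩
  have hMx : x ≤ M := Nat.le_ceil x
  simp only [hMx, if_true] at hc2 hc3
  exact .det_step (c' := ⟨k, m', o', d'⟩) (by simp [step, hc2, hL]) (.done 0 ⟨rfl, hc3⟩)

end Logic

/-! ### Running on a tape of examples -/

section Tape

variable {U : Type*} {Q : Type*} {Op : Type*} {prim : Primitives U Q Op}

/-- Execution with the examples read off a tape. -/
def runTape (prim : Primitives U Q Op) (coin : ℝ → PMF Bool) (w : ℕ → Word U Q × Word U Q) :
    ℕ → Config U Q Op → PMF (Config U Q Op)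
  | 0, c => .pure c
  | N + 1, c => (step prim ⟨.pure (w c.draws), coin⟩ c).bind (runTape prim coin w N)

lemma runTape_deterministic (N : ℕ) (c : Config U Q Op) :
    runTape prim (fun _ => .pure false) (fun _ => (.num 0, .num 0)) N c
      = run prim .deterministic N c := by
  induction N generalizing c with
  | zero => rfl
  | succ N ih => 
    rw [runTape, run]
    congr 1
    funext c'
    exact ih c'

/-- A step is either independent of the example oracle or draws an example. -/
lemma step_cases (prim : Primitives U Q Op) (coin : ℝ → PMF Bool) (c : Config U Q Op) :
    (∃ p : PMF (Config U Q Op), (∀ E, step prim ⟨E, coin⟩ c = p) ∧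
      ∀ c' ∈ p.support, c'.draws = c.draws ∧ c'.out.length ≤ c.out.length + 1) ∨
    (∃ f : Word U Q × Word U Q → Config U Q Op, (∀ E, step prim ⟨E, coin⟩ c = E.map f) ∧
      ∀ e, (f e).draws = c.draws + 1 ∧ (f e).out.length ≤ c.out.length + 1) := by
  obtain ⟨code, m, o, d⟩ := c
  have aux : ∀ c' : Config U Q Op, (∀ E, step prim ⟨E, coin⟩ ⟨code, m, o, d⟩ = .pure c') →
      c'.draws = d → c'.out.length ≤ o.length + 1 →
      (∃ p : PMF (Config U Q Op), (∀ E, step prim ⟨E, coin⟩ ⟨code, m, o, d⟩ = p) ∧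
        ∀ c' ∈ p.support, c'.draws = d ∧ c'.out.length ≤ o.length + 1) ∨
      (∃ f : Word U Q × Word U Q → Config U Q Op,
        (∀ E, step prim ⟨E, coin⟩ ⟨code, m, o, d⟩ = E.map f) ∧
        ∀ e, (f e).draws = d + 1 ∧ (f e).out.length ≤ o.length + 1) := by
    intro c' h1 h2 h3
    refine .inl ⟨_, h1, fun c'' h => ?_⟩
    rw [PMF.support_pure, Set.mem_singleton_iff] at h
    exact h ▸ ⟨h2, h3⟩
  match code with
  | [] => exact aux _ (fun E => rfl) rfl (by simp)
  | .seq p r :: k => exact aux _ (fun E => rfl) rfl (by simp)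
  | .cond x p r :: k => exact aux _ (fun E => rfl) rfl (by simp)
  | .loop x p :: k => exact aux _ (fun E => rfl) rfl (by simp)
  | .instr (.draw x y) :: k => exact .inr ⟨_, fun E => rfl, by simp⟩
  | .instr (.const x y) :: k => exact aux _ (fun E => rfl) rfl (by simp)
  | .instr (.move x y) :: k => exact aux _ (fun E => rfl) rfl (by simp)
  | .instr (.op _ x y z) :: k => exact aux _ (fun E => rfl) rfl (by simp)
  | .instr (.load x y z) :: k => exact aux _ (fun E => rfl) rfl (by simp)
  | .instr (.store x y z) :: k => exact aux _ (fun E => rfl) rfl (by simp)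
  | .instr (.reset x) :: k => exact aux _ (fun E => rfl) rfl (by simp)
  | .instr (.emit x) :: k => exact aux _ (fun E => rfl) rfl (by simp)
  | .instr (.toss x y) :: k =>
    refine .inl ⟨(coin (m.reg y).val).map fun b =>
      ⟨k, m.set x (.bit b), o, d⟩, fun E => rfl, ?_⟩
    intro c' hc'
    simp only [PMF.mem_support_map_iff] at hc'
    obtain ⟨b, -, rfl⟩ := hc'
    simp

lemma step_bounds {env : Env U Q} {c c' : Config U Q Op} (h : c' ∈ (step prim env c).support) :
    c.draws ≤ c'.draws ∧ c'.draws ≤ c.draws + 1 ∧ c'.out.length ≤ c.out.length + 1 := by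
  obtain ⟨E, coin⟩ := env
  rcases step_cases prim coin c with ⟨p, hp, hp'⟩ | ⟨f, hf, hf'⟩
  · rw [hp] at h
    have := hp' c' h
    omega
  · rw [hf, PMF.mem_support_map_iff] at h
    obtain ⟨e, -, rfl⟩ := h
    have := hf' e
    omega

lemma run_bounds {env : Env U Q} {N : ℕ} {c c' : Config U Q Op}
    (h : c' ∈ (run prim env N c).support) :
    c.draws ≤ c'.draws ∧ c'.draws ≤ c.draws + N ∧ c'.out.length ≤ c.out.length + N := by
  induction N generalizing c with
  | zero => simp only [run, PMF.support_pure, Set.mem_singleton_iff] at h; subst h; simp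
  | succ N ih =>
    rw [run, PMF.mem_support_bind_iff] at h
    obtain ⟨c1, h1, h2⟩ := h
    have := step_bounds h1
    have := ih h2
    omega

lemma runTape_bounds {coin : ℝ → PMF Bool} {w : ℕ → Word U Q × Word U Q} {N : ℕ}
    {c c' : Config U Q Op} (h : c' ∈ (runTape prim coin w N c).support) :
    c.draws ≤ c'.draws ∧ c'.draws ≤ c.draws + N ∧ c'.out.length ≤ c.out.length + N := by
  induction N generalizing c with
  | zero => simp only [runTape, PMF.support_pure, Set.mem_singleton_iff] at h; subst h; simp
  | succ N ih =>
    rw [runTape, PMF.mem_support_bind_iff] at h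
    obtain ⟨c1, h1, h2⟩ := h
    have := step_bounds h1
    have := ih h2
    omega

/-- Only the cells of the tape that are read matter. -/
lemma runTape_congr {coin : ℝ → PMF Bool} {w w' : ℕ → Word U Q × Word U Q} {N : ℕ}
    {c : Config U Q Op} (h : ∀ c' ∈ (runTape prim coin w N c).support,
      ∀ i, c.draws ≤ i → i < c'.draws → w i = w' i) :
    runTape prim coin w N c = runTape prim coin w' N c := by
  induction N generalizing c with
  | zero => rfl
  | succ N ih =>
    have hs : step prim ⟨.pure (w c.draws), coin⟩ c = step prim ⟨.pure (w' c.draws), coin⟩ c := by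
      rcases step_cases prim coin c with ⟨p, hp, hp'⟩ | ⟨f, hf, hf'⟩
      · rw [hp, hp]
      · obtain ⟨c', hc'⟩ := (runTape prim coin w (N + 1) c).support_nonempty
        have h1 := h c' hc' c.draws le_rfl
        rw [runTape, hf, PMF.pure_map, PMF.pure_bind] at hc'
        have := runTape_bounds hc'
        have := hf' (w c.draws)
        rw [h1 (by omega)]
    rw [runTape, runTape, ← hs]
    refine PMF.bind_congr_support _ fun c1 h1 => ih fun c' hc' i hi hi' => h c' ?_ i ?_ hi'
    · rw [runTape, PMF.mem_support_bind_iff]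
      exact ⟨c1, h1, hc'⟩
    · exact (step_bounds h1).1.trans hi

/-- Independent samples. -/
def iid {X : Type*} (p : PMF X) : ℕ → PMF (List X)
  | 0 => .pure []
  | m + 1 => p.bind fun x => (iid p m).map (x :: ·)

/-- The list `l` as a tape. -/
def tape (l : List (Word U Q × Word U Q)) (i : ℕ) : Word U Q × Word U Q :=
  l.getD i (.num 0, .num 0)

/-- Drawing the examples beforehand gives the same distribution. -/
lemma iid_bind_runTape_shift {env : Env U Q} {N M : ℕ} {c : Config U Q Op}
    (h : ∀ c' ∈ (run prim env N c).support, c'.draws ≤ c.draws + M) :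
    ((iid env.examples M).bind fun l => runTape prim env.coin (fun i => tape l (i - c.draws)) N c)
      = run prim env N c := by
  induction N generalizing c M with
  | zero => simp [runTape, run]
  | succ N ih =>
    simp only [runTape]
    rw [run]
    have hsub : ∀ c1 ∈ (step prim env c).support, ∀ c' ∈ (run prim env N c1).support,
        c'.draws ≤ c.draws + M := fun c1 h1 c' hc' => h c' (by
      rw [run, PMF.mem_support_bind_iff]; exact ⟨c1, h1, hc'⟩)
    rcases step_cases prim env.coin c with ⟨p, hp, hp'⟩ | ⟨f, hf, hf'⟩
    · have hs : step prim env c = p := hp env.examples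
      simp only [hp]
      rw [PMF.bind_comm]
      refine PMF.bind_congr_support _ fun c1 h1 => ?_
      have hd := (hp' c1 h1).1
      rw [← ih (M := M) (fun c' hc' => hd ▸ hsub c1 (hs ▸ h1) c' hc'), hd]
    · have hs : step prim env c = env.examples.map f := hf env.examples
      obtain ⟨M, rfl⟩ : ∃ M', M = M' + 1 := by
        obtain ⟨c1, h1⟩ := (step prim env c).support_nonempty
        obtain ⟨c', hc'⟩ := (run prim env N c1).support_nonempty
        have h2 := hsub c1 h1 c' hc'
        have h3 := (run_bounds hc').1
        rw [hs, PMF.mem_support_map_iff] at h1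
        obtain ⟨e, -, rfl⟩ := h1
        have := (hf' e).1
        exact ⟨M - 1, by omega⟩
      simp only [hf, PMF.pure_map, PMF.pure_bind]
      rw [iid, PMF.bind_bind, PMF.bind_map]
      refine PMF.bind_congr_support _ fun e he => ?_
      have hd := (hf' e).1
      simp only [PMF.bind_map, Function.comp_def]
      have h0 : ∀ l : List (Word U Q × Word U Q), tape (e :: l) (c.draws - c.draws) = e := by
        simp [tape]
      simp only [h0]
      rw [← ih (M := M) (c := f e) (fun c' hc' => by
        have := hsub (f e) (by rw [hs, PMF.mem_support_map_iff]; exact ⟨e, he, rfl⟩) c' hc'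
        omega)]
      refine PMF.bind_congr_support _ fun l _ => runTape_congr fun c' _ i hi _ => ?_
      rw [hd] at hi ⊢
      obtain ⟨j, rfl⟩ := Nat.exists_eq_add_of_le hi
      have e1 : c.draws + 1 + j - c.draws = j + 1 := by omega
      have e2 : c.draws + 1 + j - (c.draws + 1) = j := by omega
      rw [e1, e2]
      simp [tape]

lemma iid_bind_runTape {env : Env U Q} {N M : ℕ} {c : Config U Q Op} (hc : c.draws = 0)
    (h : ∀ c' ∈ (run prim env N c).support, c'.draws ≤ M) :
    ((iid env.examples M).bind fun l => runTape prim env.coin (tape l) N c) = run prim env N c := by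
  have := iid_bind_runTape_shift (prim := prim) (env := env) (N := N) (M := M) (c := c)
    (by simpa [hc] using h)
  simpa [hc] using this

end Tape

/-! ### Clocked simulation of a program -/

section Clocked

variable {U : Type*} {Q : Type*} {Op : Type*} {prim : Primitives U Q Op}

/-- The instruction with all registers and arrays shifted by `50`; examples are read off the tape
in the arrays `40`, `41` at the pointer in register `41`, and the output is appended to the array
`42`, whose length is in register `42`. -/
def Instr.shifted : Instr Op → Program Op
  | .const x c => .instr (.const (x + 50) c)
  | .move x y => .instr (.move (x + 50) (y + 50))
  | .op o x y z => .instr (.op o (x + 50) (y + 50) (z + 50))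
  | .load x a i => .instr (.load (x + 50) (a + 50) (i + 50))
  | .store a i x => .instr (.store (a + 50) (i + 50) (x + 50))
  | .reset j => .instr (.reset (j + 50))
  | .toss x p => .instr (.toss (x + 50) (p + 50))
  | .draw x y => block [.load (x + 50) 40 41, .load (y + 50) 41 41, .op .add 41 41 8]
  | .emit x => block [.store 42 42 (x + 50), .op .add 42 42 8]

/-- The body of the translation of a loop on the register `x`, given the translated loop body. -/
def clockedLoopBody (x : ℕ) (p : Program Op) : Program Op :=
  .cond 40 (.seq (.instr (.op .sub 40 40 8))
    (.cond (x + 50) (.seq p (.instr (.const 43 1))) (.instr (.const 43 0)))) (.instr (.const 43 0))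

/-- The translation of a program to one that simulates as many of its steps as the number in the
register `40` tells. -/
def Program.clocked : Program Op → Program Op
  | .instr i => .cond 40 (.seq (.instr (.op .sub 40 40 8)) i.shifted) (.instr (.const 43 0))
  | .seq p r => .cond 40 (.seq (.instr (.op .sub 40 40 8)) (.seq p.clocked r.clocked))
      (.instr (.const 43 0))
  | .cond x p r => .cond 40 (.seq (.instr (.op .sub 40 40 8)) (.cond (x + 50) p.clocked r.clocked))
      (.instr (.const 43 0))
  | .loop x p => .seq (.instr (.const 43 1)) (.loop 43 (clockedLoopBody x p.clocked))

/-- The memory `m` of the simulator represents the memory, output and number of draws of the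
simulated machine, the tape, and the number `N` of remaining steps; its lower part is that of
`low`. -/
structure Represented (low : Memory U Q) (w : ℕ → Word U Q × Word U Q) (N : ℕ) (c : Config U Q Op)
    (m : Memory U Q) : Prop where
  reg : ∀ x, m.reg (x + 50) = c.mem.reg x
  arr : ∀ a, m.arr (a + 50) = c.mem.arr a
  clock : m.reg 40 = .num N
  pointer : m.reg 41 = .num c.draws
  length : m.reg 42 = .num c.out.length
  out : m.arr 42 = listCells c.out
  tape_fst : ∀ i, m.arr 40 i = (w i).1
  tape_snd : ∀ i, m.arr 41 i = (w i).2
  low_reg : ∀ x < 40, m.reg x = low.reg x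
  low_arr : ∀ a < 40, m.arr a = low.arr a
  one : low.reg 8 = .num 1

lemma Word.addr_natCast (n : ℕ) : (Word.num (n : ℝ) : Word U Q).addr = n := by
  simp [Word.addr, Word.val]

lemma listCells_append (l : List (Word U Q)) (w : Word U Q) :
    listCells (l ++ [w]) = Function.update (listCells l) l.length w := by
  funext i
  rw [Function.update_apply]
  unfold listCells
  split_ifs with h
  · subst h; simp
  · rcases lt_or_gt_of_ne h with h' | h'
    · exact List.getD_append _ _ _ _ h'
    · rw [List.getD_eq_default _ _ (by simp; omega), List.getD_eq_default _ _ h'.le]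

variable {low : Memory U Q} {w : ℕ → Word U Q × Word U Q} {N : ℕ} {c : Config U Q Op}
  {m : Memory U Q} {env : Env U Q}

lemma Represented.set (h : Represented low w N c m) {k : List (Program Op)} (x : ℕ) (v : Word U Q) :
    Represented low w N { c with code := k, mem := c.mem.set x v } (m.set (x + 50) v) where
  reg y := by simp [h.reg]
  arr := h.arr
  clock := by simp [h.clock]
  pointer := by simp [h.pointer]
  length := by simp [h.length]
  out := h.out
  tape_fst := h.tape_fst
  tape_snd := h.tape_snd
  low_reg y hy := by
    have : y ≠ x + 50 := by omega
    simp [this, h.low_reg y hy]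
  low_arr := h.low_arr
  one := h.one

lemma Represented.scratch (h : Represented low w N c m) (v : Word U Q) :
    Represented low w N c (m.set 43 v) where
  reg y := by simp [h.reg]
  arr := h.arr
  clock := by simp [h.clock]
  pointer := by simp [h.pointer]
  length := by simp [h.length]
  out := h.out
  tape_fst := h.tape_fst
  tape_snd := h.tape_snd
  low_reg y hy := by
    have : y ≠ 43 := by omega
    simp [this, h.low_reg y hy]
  low_arr := h.low_arr
  one := h.one

lemma Represented.tick (h : Represented low w (N + 1) c m) :
    Represented low w N c (m.set 40 (BasicOp.sub.apply prim (m.reg 40) (m.reg 8))) where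
  reg y := by simp [h.reg]
  arr := h.arr
  clock := by
    have := h.low_reg 8 (by norm_num)
    simp [BasicOp.apply, h.clock, this, h.one, Word.val]
  pointer := by simp [h.pointer]
  length := by simp [h.length]
  out := h.out
  tape_fst := h.tape_fst
  tape_snd := h.tape_snd
  low_reg y hy := by
    have : y ≠ 40 := by omega
    simp [this, h.low_reg y hy]
  low_arr := h.low_arr
  one := h.one

lemma Represented.code (h : Represented low w N c m) (k : List (Program Op)) :
    Represented low w N { c with code := k } m :=
  ⟨h.1, h.2, h.3, h.4, h.5, h.6, h.7, h.8, h.9, h.10, h.11⟩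

lemma Represented.shifted {i : Instr Op} {k : List (Program Op)} {o : List (Word U Q)}
    (hc : c.code = .instr i :: k) (h : Represented low w N c m) :
    Triple prim env i.shifted m o 7 (DataRelease.step prim ⟨.pure (w c.draws), env.coin⟩ c)
      fun c' m' o' => o' = o ∧ c'.code = k ∧ Represented low w N c' m' := by
  obtain ⟨code, mem, out, d⟩ := c
  simp only at hc
  subst hc
  have one : m.reg 8 = .num 1 := (h.low_reg 8 (by norm_num)).trans h.one
  cases i with
  | const x n =>
    refine .mono (Triple.instr (f := fun m => m.set (x + 50) (.num n)) (g := id) (fun _ => rfl)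
      (⟨rfl, rfl, h.set _ _⟩)) (by norm_num)
  | move x y =>
    refine .mono (Triple.instr (f := fun m => m.set (x + 50) (m.reg (y + 50))) (g := id)
      (fun _ => rfl) (⟨rfl, rfl, ?_⟩)) (by norm_num)
    rw [h.reg]; exact h.set _ _
  | op o x y z =>
    refine .mono (Triple.instr (f := fun m => m.set (x + 50)
      (o.apply prim (m.reg (y + 50)) (m.reg (z + 50)))) (g := id)
      (fun _ => rfl) (⟨rfl, rfl, ?_⟩)) (by norm_num)
    rw [h.reg, h.reg]; exact h.set _ _
  | load x a i =>
    refine .mono (Triple.instr (f := fun m => m.set (x + 50)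
      (m.arr (a + 50) (m.reg (i + 50)).addr)) (g := id)
      (fun _ => rfl) (⟨rfl, rfl, ?_⟩)) (by norm_num)
    rw [h.reg, h.arr]; exact h.set _ _
  | store a i x =>
    refine .mono (Triple.instr (f := Instr.effect prim (.store (a + 50) (i + 50) (x + 50)))
      (g := id) (fun _ => rfl) (⟨rfl, rfl, ?_⟩)) (by norm_num)
    simp only [Instr.effect]
    rw [h.reg, h.reg, h.arr]
    exact { h with
      arr := fun b => by
        have := h.arr b
        by_cases hb : b = a
        · subst hb; simp
        · simp [hb, this]
      out := by simpa [Function.update_apply] using h.out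
      tape_fst := by simpa [Function.update_apply] using h.tape_fst
      tape_snd := by simpa [Function.update_apply] using h.tape_snd
      low_arr := fun b hb => by
        have : b ≠ a + 50 := by omega
        simp [this, h.low_arr b hb] }
  | reset j =>
    refine .mono (Triple.instr (f := Instr.effect prim (.reset (j + 50)))
      (g := id) (fun _ => rfl) (⟨rfl, rfl, ?_⟩)) (by norm_num)
    have l1 : ∀ x < 50, x < j + 50 := fun x hx => by omega
    exact { 
      reg := fun x => by simp [Instr.effect, h.reg]
      arr := fun b => by simp [Instr.effect, h.arr]
      clock := by simp [Instr.effect, l1, h.clock]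
      pointer := by simp [Instr.effect, l1, h.pointer]
      length := by simp [Instr.effect, l1, h.length]
      out := by simp [Instr.effect, l1, h.out]
      tape_fst := by simpa [Instr.effect, l1] using h.tape_fst
      tape_snd := by simpa [Instr.effect, l1] using h.tape_snd
      low_reg := fun x hx => by simp [Instr.effect, l1 x (by omega), h.low_reg x hx]
      low_arr := fun x hx => by simp [Instr.effect, l1 x (by omega), h.low_arr x hx]
      one := h.one }
  | toss x p =>
    have := Triple.toss (prim := prim) (env := env) (x := x + 50) (y := p + 50) (m := m) (o := o)
      (f := fun b => (⟨k, mem.set x (.bit b), out, d⟩ : Config U Q Op))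
      (Post := fun c' m' o' => o' = o ∧ c'.code = k ∧ Represented low w N c' m')
      (fun b => ⟨rfl, rfl, h.set _ _⟩)
    rw [h.reg] at this
    exact this.mono (by norm_num)
  | draw x y =>
    have e : step prim ⟨.pure (w d), env.coin⟩ (⟨.instr (.draw x y) :: k, mem, out, d⟩ : Config U Q Op)
        = .pure ⟨k, (mem.set x (w d).1).set y (w d).2, out, d + 1⟩ := by
      simp [step, Instr.exec, PMF.pure_map]
    simp only
    rw [e]
    refine Triple.block (by simp [Instr.Plain]) ⟨rfl, rfl, ?_⟩
    simp only [effects, List.foldl, Instr.effect]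
    have hp := h.pointer
    simp only at hp
    simp only [Memory.set_reg, Memory.set_arr]
    have n1 : ∀ z, 41 ≠ z + 50 := fun z => by omega
    have n2 : ∀ z, 8 ≠ z + 50 := fun z => by omega
    simp only [if_neg (n1 _), if_neg (n2 _), hp, Word.addr_natCast, one, h.tape_fst, h.tape_snd]
    have h1 := (h.set (k := k) x (w d).1).set (k := k) y (w d).2
    exact { h1 with
      reg := fun z => by have := h1.reg z; simpa using this
      clock := by have := h1.clock; simpa using this
      pointer := by simp [BasicOp.apply, Word.val]
      length := by have := h1.length; simpa using this
      low_reg := fun z hz => by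
        have := h1.low_reg z hz
        have n : z ≠ 41 := by omega
        simpa [n] using this }
  | emit x =>
    refine Triple.mono (B := 5) (Triple.block (by simp [Instr.Plain])
      (a := (⟨k, mem, out ++ [mem.reg x], d⟩ : Config U Q Op)) ⟨rfl, rfl, ?_⟩) (by norm_num)
    have hl := h.length
    have ho := h.out
    have hx := h.reg x
    simp only at hl ho hx
    simp only [effects, List.foldl, Instr.effect, hl, ho, hx, Word.addr_natCast, one]
    rw [← listCells_append]
    exact {
      reg := fun z => by have := h.reg z; simpa using this
      arr := fun b => by simpa [Function.update_apply] using h.arr b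
      clock := by simp [h.clock]
      pointer := by simp [h.pointer]
      length := by simp [BasicOp.apply, Word.val]
      out := by simp
      tape_fst := by simpa [Function.update_apply] using h.tape_fst
      tape_snd := by simpa [Function.update_apply] using h.tape_snd
      low_reg := fun z hz => by
        have := h.low_reg z hz
        have n : z ≠ 42 := by omega
        simpa [n] using this
      low_arr := fun b hb => by
        have := h.low_arr b hb
        have n : b ≠ 42 := by omega
        simpa [n] using this
      one := h.one }

/-- The stack of the simulator corresponds to that of the simulated machine. -/
inductive StackRel : List (Program Op) → List (Program Op) → Prop
  | nil : StackRel [] []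
  | cons {k k' : List (Program Op)} (p : Program Op) (h : StackRel k k') :
      StackRel (p :: k) (p.clocked :: k')
  | resume {k k' : List (Program Op)} (x : ℕ) (p : Program Op) (h : StackRel k k') :
      StackRel (.loop x p :: k)
        (.instr (.const 43 1) :: .loop 43 (clockedLoopBody x p.clocked) :: k')

variable (prim low w) in
/-- The final situations of the simulation. -/
abbrev Simulated (rest : List (Program Op)) (o : List (Word U Q)) (c C : Config U Q Op) : Prop :=
  C.code = rest ∧ C.out = o ∧ ∃ N, Represented low w N c C.mem

variable {rest : List (Program Op)} {o : List (Word U Q)}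

lemma reaches_const {R : Type*} {Post : R → Config U Q Op → Prop} {κ : PMF R} {B d x n : ℕ}
    (h : Reaches prim env Post ⟨rest, m.set x (.num n), o, d⟩ B κ) :
    Reaches prim env Post ⟨.instr (.const x n) :: rest, m, o, d⟩ (B + 1) κ :=
  .det_step rfl h

lemma reaches_tick {R : Type*} {Post : R → Config U Q Op → Prop} {κ : PMF R} {B d : ℕ}
    {p : Program Op}
    (h : Reaches prim env Post
      ⟨p :: rest, m.set 40 (BasicOp.sub.apply prim (m.reg 40) (m.reg 8)), o, d⟩ B κ) :
    Reaches prim env Post ⟨.seq (.instr (.op .sub 40 40 8)) p :: rest, m, o, d⟩ (B + 2) κ :=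
  .det_step rfl (.det_step rfl h)

lemma reaches_cond {R : Type*} {Post : R → Config U Q Op → Prop} {κ : PMF R} {B d x : ℕ}
    {p r : Program Op} (hx : m.reg x ≠ .num 0) (h : Reaches prim env Post ⟨p :: rest, m, o, d⟩ B κ) :
    Reaches prim env Post ⟨.cond x p r :: rest, m, o, d⟩ (B + 1) κ :=
  .det_step (by simp [step, hx]) h

lemma reaches_cond_zero {R : Type*} {Post : R → Config U Q Op → Prop} {κ : PMF R} {B d x : ℕ}
    {p r : Program Op} (hx : m.reg x = .num 0) (h : Reaches prim env Post ⟨r :: rest, m, o, d⟩ B κ) :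
    Reaches prim env Post ⟨.cond x p r :: rest, m, o, d⟩ (B + 1) κ :=
  .det_step (by simp [step, hx]) h

lemma reaches_loop {R : Type*} {Post : R → Config U Q Op → Prop} {κ : PMF R} {B d x : ℕ}
    {p : Program Op} (hx : m.reg x ≠ .num 0)
    (h : Reaches prim env Post ⟨p :: .loop x p :: rest, m, o, d⟩ B κ) :
    Reaches prim env Post ⟨.loop x p :: rest, m, o, d⟩ (B + 1) κ :=
  .det_step (by simp [step, hx]) h

lemma reaches_loop_zero {R : Type*} {Post : R → Config U Q Op → Prop} {κ : PMF R} {B d x : ℕ}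
    {p : Program Op} (hx : m.reg x = .num 0)
    (h : Reaches prim env Post ⟨rest, m, o, d⟩ B κ) :
    Reaches prim env Post ⟨.loop x p :: rest, m, o, d⟩ (B + 1) κ :=
  .det_step (by simp [step, hx]) h

lemma clocked_out_of_time {k k' : List (Program Op)} (hk : StackRel k k') (d : ℕ)
    (h : Represented low w 0 c m) :
    Reaches prim env (Simulated low w rest o) ⟨k' ++ rest, m, o, d⟩ (8 * k.length) (.pure c) := by
  have hz : ∀ m : Memory U Q, Represented low w 0 c m → m.reg 40 = .num 0 := fun m h => by
    simpa using h.clock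
  have loop : ∀ (k k' : List (Program Op)) (m : Memory U Q) (x : ℕ) (p : Program Op),
      Represented low w 0 c m → (∀ m, Represented low w 0 c m →
        Reaches prim env (Simulated low w rest o) ⟨k' ++ rest, m, o, d⟩ (8 * k.length) (.pure c)) →
      Reaches prim env (Simulated low w rest o)
        ⟨.instr (.const 43 1) :: .loop 43 (clockedLoopBody x p.clocked) :: k' ++ rest, m, o, d⟩
        (8 * k.length + 5) (.pure c) := by
    intro k k' m x p h ih
    refine reaches_const (reaches_loop (by simp) ?_)
    refine reaches_cond_zero (by simpa using hz _ h) (reaches_const (reaches_loop_zero (by simp) ?_))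
    exact ih _ ((h.scratch _).scratch _)
  induction hk generalizing m with
  | nil => exact .done _ ⟨rfl, rfl, 0, h⟩
  | @cons k k' p hk ih =>
    have nop : ∀ p', Reaches prim env (Simulated low w rest o)
        ⟨.cond 40 p' (.instr (.const 43 0)) :: k' ++ rest, m, o, d⟩ (8 * (k.length + 1)) (.pure c) :=
      fun p' => Reaches.mono (reaches_cond_zero (hz _ h) (reaches_const (ih (h.scratch _))))
        (by omega)
    cases p with
    | instr i => exact nop _
    | seq p r => exact nop _
    | cond x p r => exact nop _
    | loop x p =>
      exact Reaches.mono (.det_step rfl (loop k k' m x p h fun m h => ih h))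
        (by simp only [List.length_cons]; omega)
  | @resume k k' x p hk ih =>
    exact (loop k k' m x p h fun m h => ih h).mono (by simp only [List.length_cons]; omega)

/-- The simulator computes what the simulated machine computes on the tape. -/
theorem clocked_simulates {k' : List (Program Op)} (hk : StackRel c.code k') (d : ℕ)
    (h : Represented low w N c m) :
    Reaches prim env (Simulated low w rest o) ⟨k' ++ rest, m, o, d⟩ (8 * c.code.length + 30 * N)
      (runTape prim env.coin w N c) := by
  induction N generalizing c m k' d with
  | zero => exact clocked_out_of_time hk d h
  | succ N ih =>
    obtain ⟨code, mem, out, dr⟩ := c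
    simp only at hk ⊢
    have hz : ∀ m : Memory U Q, Represented low w (N + 1) ⟨code, mem, out, dr⟩ m →
      m.reg 40 ≠ .num 0 := fun m h => by
        rw [h.clock]; simp only [ne_eq, Word.num.injEq]; positivity
    have pure_step : ∀ c' : Config U Q Op, step prim ⟨.pure (w dr), env.coin⟩ ⟨code, mem, out, dr⟩
        = .pure c' → runTape prim env.coin w (N + 1) ⟨code, mem, out, dr⟩
          = runTape prim env.coin w N c' := fun c' hc' => by
      rw [runTape, hc', PMF.pure_bind]
    have loop : ∀ (k k' : List (Program Op)) (m : Memory U Q) (x : ℕ) (p : Program Op),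
        code = .loop x p :: k → StackRel k k' → Represented low w (N + 1) ⟨code, mem, out, dr⟩ m →
        Reaches prim env (Simulated low w rest o)
          ⟨.instr (.const 43 1) :: .loop 43 (clockedLoopBody x p.clocked) :: k' ++ rest, m, o, d⟩
          (8 * (k.length + 2) + 30 * N + 9) (runTape prim env.coin w (N + 1) ⟨code, mem, out, dr⟩) := by
      rintro k k' m x p rfl hk h
      refine Reaches.mono (reaches_const (reaches_loop (by simp) (reaches_cond
        (by simpa using hz _ h) (reaches_tick (B := 8 * (k.length + 2) + 30 * N + 3) ?_)))) (by omega)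
      have h' := (h.scratch (.num (1 : ℕ))).tick (prim := prim)
      by_cases hx : mem.reg x = .num 0
      · rw [pure_step ⟨k, mem, out, dr⟩ (by simp [step, hx])]
        refine Reaches.mono (reaches_cond_zero (by rw [h'.reg]; exact hx) (reaches_const
          (reaches_loop_zero (by simp) (ih hk d ((h'.scratch _).code k))))) (by simp only []; omega)
      · rw [pure_step ⟨p :: .loop x p :: k, mem, out, dr⟩ (by simp [step, hx])]
        refine Reaches.mono (reaches_cond (by rw [h'.reg]; exact hx) (.det_step rfl
          (ih (.cons p (.resume x p hk)) d (h'.code _)))) (by simp only [List.length_cons]; omega)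
    cases hk with
    | nil =>
      rw [runTape, step, PMF.pure_bind]
      have : runTape prim env.coin w N ⟨[], mem, out, dr⟩ = .pure ⟨[], mem, out, dr⟩ := by
        clear ih h pure_step hz loop
        induction N with
        | zero => rfl
        | succ N ih => rw [runTape, step, PMF.pure_bind, ih]
      rw [this]
      exact .done _ ⟨rfl, rfl, N + 1, h⟩
    | @resume k k' x p hk =>
      exact (loop k k' m x p rfl hk h).mono (by simp only [List.length_cons]; omega)
    | @cons k k' p hk =>
      cases p with
      | loop x p =>
        exact Reaches.mono (.det_step rfl (loop k k' m x p rfl hk h))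
          (by simp only [List.length_cons]; omega)
      | seq p r =>
        rw [pure_step ⟨p :: r :: k, mem, out, dr⟩ rfl]
        exact Reaches.mono (reaches_cond (hz _ h) (reaches_tick (.det_step rfl
          (ih (.cons p (.cons r hk)) d (h.tick.code _))))) (by simp only [List.length_cons]; omega)
      | cond x p r =>
        have h' := h.tick (prim := prim)
        by_cases hx : mem.reg x = .num 0
        · rw [pure_step ⟨r :: k, mem, out, dr⟩ (by simp [step, hx])]
          exact Reaches.mono (reaches_cond (hz _ h) (reaches_tick (reaches_cond_zero
            (by rw [h'.reg]; exact hx)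
            (ih (.cons r hk) d (h'.code _))))) (by simp only [List.length_cons]; omega)
        · rw [pure_step ⟨p :: k, mem, out, dr⟩ (by simp [step, hx])]
          exact Reaches.mono (reaches_cond (hz _ h) (reaches_tick (reaches_cond
            (by rw [h'.reg]; exact hx)
            (ih (.cons p hk) d (h'.code _))))) (by simp only [List.length_cons]; omega)
      | instr i =>
        have h' := h.tick (prim := prim)
        refine Reaches.mono (B := 7 + (8 * k.length + 30 * N) + 2 + 1) (reaches_cond (hz _ h)
          (reaches_tick ((h'.shifted (env := env) (o := o) rfl (k' ++ rest) d).bind ?_)))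
          (by simp only [List.length_cons]; omega)
        rintro c' - ⟨C, M', o', d'⟩ hC
        obtain ⟨h1, h2, h3, h4⟩ := hC
        simp only at h1 h2 h3 h4
        subst h1 h2 h3
        exact ih hk d' h4

theorem Program.clocked_triple {p : Program Op} (hc : c.code = [p]) (h : Represented low w N c m) :
    Triple prim env p.clocked m o (8 + 30 * N) (runTape prim env.coin w N c)
      fun c m o' => o' = o ∧ ∃ N, Represented low w N c m := by
  intro k d
  have := clocked_simulates (prim := prim) (env := env) (k' := [p.clocked]) (rest := k) (o := o)
    (c := c) (by rw [hc]; exact .cons _ .nil) d h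
  rw [hc] at this
  exact this

end Clocked

/-! ### The release program -/

section Frames

variable {U : Type*} {Q : Type*} {Op : Type*} {prim : Primitives U Q Op} {env : Env U Q}

/-- The instruction writes no register below `r`. -/
def Instr.KeepsReg (r : ℕ) : Instr Op → Prop
  | .const x _ | .move x _ | .op _ x _ _ | .load x _ _ | .reset x => r ≤ x
  | _ => True

/-- The instruction writes no array below `r`. -/
def Instr.KeepsArr (r : ℕ) : Instr Op → Prop
  | .store a _ _ | .reset a => r ≤ a
  | _ => True

lemma effects_reg {r : ℕ} {l : List (Instr Op)} (hl : ∀ i ∈ l, i.KeepsReg r) (m : Memory U Q)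
    {x : ℕ} (hx : x < r) : (effects prim l m).reg x = m.reg x := by
  induction l generalizing m with
  | nil => rfl
  | cons i l ih =>
    rw [effects, List.foldl, ← effects, ih fun j hj => hl j (by simp [hj])]
    have hi := hl i (by simp)
    cases i <;> simp only [Instr.KeepsReg] at hi <;>
      simp only [Instr.effect, Memory.set_reg] <;> first | rw [if_neg (by omega)] | rw [if_pos (by omega)]

lemma effects_arr {r : ℕ} {l : List (Instr Op)} (hl : ∀ i ∈ l, i.KeepsArr r) (m : Memory U Q)
    {a : ℕ} (ha : a < r) : (effects prim l m).arr a = m.arr a := by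
  induction l generalizing m with
  | nil => rfl
  | cons i l ih =>
    rw [effects, List.foldl, ← effects, ih fun j hj => hl j (by simp [hj])]
    have hi := hl i (by simp)
    cases i <;> simp only [Instr.KeepsArr] at hi <;>
      simp only [Instr.effect, Memory.set_arr]
    · rw [Function.update_of_ne (by omega)]
    · rw [if_pos (by omega)]

/-- `m'` agrees with `m` on the registers below `r` and the arrays below `s`. -/
def Memory.Agrees (r s : ℕ) (m m' : Memory U Q) : Prop :=
  (∀ x < r, m'.reg x = m.reg x) ∧ ∀ a < s, m'.arr a = m.arr a

lemma Memory.Agrees.refl {r s : ℕ} (m : Memory U Q) : m.Agrees r s m :=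
  ⟨fun _ _ => rfl, fun _ _ => rfl⟩

lemma Memory.Agrees.trans {r s : ℕ} {m₁ m₂ m₃ : Memory U Q} (h : m₁.Agrees r s m₂)
    (h' : m₂.Agrees r s m₃) : m₁.Agrees r s m₃ :=
  ⟨fun x hx => (h'.1 x hx).trans (h.1 x hx), fun a ha => (h'.2 a ha).trans (h.2 a ha)⟩

lemma Memory.Agrees.mono {r s r' s' : ℕ} {m m' : Memory U Q} (h : m.Agrees r s m') (hr : r' ≤ r)
    (hs : s' ≤ s) : m.Agrees r' s' m' :=
  ⟨fun x hx => h.1 x (by omega), fun a ha => h.2 a (by omega)⟩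

lemma Memory.Agrees.set {r s : ℕ} {m m' : Memory U Q} (h : m.Agrees r s m') {x : ℕ} (hx : r ≤ x)
    (w : Word U Q) : m.Agrees r s (m'.set x w) :=
  ⟨fun y hy => by rw [Memory.set_reg, if_neg (by omega), h.1 y hy], h.2⟩

lemma effects_agrees {r s : ℕ} {l : List (Instr Op)} (hl : ∀ i ∈ l, i.KeepsReg r ∧ i.KeepsArr s)
    (m : Memory U Q) : m.Agrees r s (effects prim l m) :=
  ⟨fun _ hx => effects_reg (fun i hi => (hl i hi).1) m hx,
    fun _ ha => effects_arr (fun i hi => (hl i hi).2) m ha⟩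

lemma Triple.block_seq {R : Type*} {l : List (Instr Op)} (hl : ∀ i ∈ l, i.Plain)
    {m : Memory U Q} {o : List (Word U Q)} {r : Program Op} {B : ℕ} {κ : PMF R}
    {Post : R → Memory U Q → List (Word U Q) → Prop}
    (h : Triple prim env r (effects prim l m) o B κ Post) {C : ℕ} (hC : 2 * l.length + 2 + B ≤ C) :
    Triple prim env (.seq (DataRelease.block l) r) m o C κ Post := by
  have := Triple.seq_unit (prim := prim) (env := env) (p := DataRelease.block l) (m := m) (o := o)
    (r := r) (B' := B) (κ' := κ) (Post' := Post) (B := 2 * l.length + 1)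
    (Pu := fun m' o' => m' = effects prim l m ∧ o' = o)
    (Triple.block hl ⟨rfl, rfl⟩) (by rintro _ _ ⟨rfl, rfl⟩; exact h) le_rfl
  exact this.mono (by omega)

/-- A loop without a ghost value. -/
lemma Triple.forLoop_unit {i lim g : ℕ} {body : Program Op} {x : ℝ}
    {Inv : ℕ → Memory U Q → List (Word U Q) → Prop} {B : ℕ}
    {m : Memory U Q} {o : List (Word U Q)} (h8 : g ≠ 8)
    (hInv : ∀ j m o, j ≤ ⌈x⌉₊ → Inv j m o →
      m.reg i = .num j ∧ m.reg lim = .num x ∧ m.reg 8 = .num 1)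
    (hg : ∀ j m o w, j ≤ ⌈x⌉₊ → Inv j m o → Inv j (m.set g w) o)
    (h0 : Inv 0 m o)
    (hbody : ∀ j m o, j < ⌈x⌉₊ → Inv j m o → Triple prim env body m o B (.pure ())
      fun _ m o => m.reg i = .num j ∧ m.reg 8 = .num 1 ∧ Inv (j + 1) (m.set i (.num (j + 1))) o) :
    Triple prim env (DataRelease.forLoop i lim g body) m o (⌈x⌉₊ * (B + 10) + 10) (.pure ())
      fun _ => Inv ⌈x⌉₊ := by
  have := Triple.forLoop (prim := prim) (env := env) (i := i) (lim := lim) (g := g) (body := body)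
    (x := x) (Inv := fun j (_ : Unit) => Inv j) (κ := fun _ => .pure) (B := B) (m := m) (o := o)
    (a := ()) h8 (fun j _ => hInv j) (fun j _ => hg j) h0 (fun j _ => hbody j)
  have e : ∀ M, iterate (fun _ : ℕ => (PMF.pure : Unit → PMF Unit)) M () = .pure () := by
    intro M
    induction M with
    | zero => rfl
    | succ M ih => rw [iterate, ih, PMF.pure_bind]
  rwa [e] at this

end Frames

section Counting

variable {U : Type*} {Q : Type*} {Op : Type*} {prim : Primitives U Q Op} {env : Env U Q}

/-- Add up the values of the query in the register `20` at the items of the database. -/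
def countLoop : Program Op :=
  forLoop 23 0 39 (block [.load 24 0 23, .op .pred 24 20 24, .op .add 22 22 24])

lemma countLoop_triple {n : ℕ} (D : Fin n → U) {q : Q} {m : Memory U Q} {o : List (Word U Q)}
    (h0 : m.reg 0 = .num n) (h8 : m.reg 8 = .num 1) (h20 : m.reg 20 = .qry q)
    (h22 : m.reg 22 = .num 0) (h23 : m.reg 23 = .num 0)
    (hD : ∀ i : Fin n, m.arr 0 i = .itm (D i)) :
    Triple prim env countLoop m o (n * 17 + 10) (.pure ()) fun _ m' o' => o' = o ∧
      m.Agrees 22 40 m' ∧ m'.reg 22 = .num (∑ i, if prim.pred q (D i) then (1 : ℝ) else 0) := by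
  have := Triple.forLoop_unit (prim := prim) (env := env) (i := 23) (lim := 0) (g := 39)
    (body := block [.load 24 0 23, .op .pred 24 20 24, .op .add 22 22 24]) (x := n) (m := m)
    (o := o) (B := 7) (Inv := fun j m' o' => o' = o ∧ m.Agrees 22 40 m' ∧ m'.reg 23 = .num j ∧
      m'.reg 22 = .num (∑ i : Fin n, if (i : ℕ) < j ∧ prim.pred q (D i) then (1 : ℝ) else 0))
    (by norm_num) ?_ ?_ ?_ ?_
  · rw [Nat.ceil_natCast] at this
    refine (this.mono (by omega)).conseq ?_
    rintro - - m' o' ⟨h1, h2, h3, h4⟩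
    refine ⟨h1, h2, ?_⟩
    rw [h4]
    simp
  · rintro j m' o' - ⟨h1, h2, h3, h4⟩
    exact ⟨h3, by rw [h2.1 0 (by norm_num), h0], by rw [h2.1 8 (by norm_num), h8]⟩
  · rintro j m' o' w - ⟨h1, h2, h3, h4⟩
    exact ⟨h1, h2.set (by norm_num) _, by simpa using h3, by simpa using h4⟩
  · exact ⟨rfl, .refl _, by simpa using h23, by simpa using h22⟩
  · rintro j m' o' hj ⟨h1, h2, h3, h4⟩
    rw [Nat.ceil_natCast] at hj
    refine Triple.block (by simp [Instr.Plain]) ?_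
    have e8 : m'.reg 8 = .num 1 := by rw [h2.1 8 (by norm_num), h8]
    have e20 : m'.reg 20 = .qry q := by rw [h2.1 20 (by norm_num), h20]
    have ed : m'.arr 0 j = .itm (D ⟨j, hj⟩) := by
      rw [h2.2 0 (by norm_num)]; exact hD ⟨j, hj⟩
    refine ⟨?_, ?_, h1, (h2.trans (effects_agrees (by simp [Instr.KeepsReg, Instr.KeepsArr]) m')).set
      (by norm_num) _, by simp, ?_⟩
    · simp [effects, Instr.effect, h3]
    · simp [effects, Instr.effect, e8]
    · simp only [effects, List.foldl, Instr.effect, Memory.set_reg, h3, Word.addr_natCast, ed, e20,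
        BasicOp.apply, h4]
      simp only [Nat.reduceEqDiff, if_true, if_false, Word.val, Word.bit,
        Word.num.injEq]
      have split : ∀ i : Fin n, (if (i : ℕ) < j + 1 ∧ prim.pred q (D i) then (1 : ℝ) else 0)
          = (if (i : ℕ) < j ∧ prim.pred q (D i) then (1 : ℝ) else 0)
            + if i = ⟨j, hj⟩ then (if prim.pred q (D ⟨j, hj⟩) then 1 else 0) else 0 := by
        intro i
        rcases lt_trichotomy (i : ℕ) j with h | h | h
        · have : i ≠ ⟨j, hj⟩ := fun e => by simp [e] at h
          simp [h, this, Nat.lt_succ_of_lt h]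
        · have : i = ⟨j, hj⟩ := Fin.ext h
          simp [this]
        · have h' : i ≠ ⟨j, hj⟩ := fun e => by simp [e] at h
          have h'' : ¬ (i : ℕ) < j + 1 := by omega
          simp [h', h'', h.not_gt]
      simp only [split, Finset.sum_add_distrib, Finset.sum_ite_eq', Finset.mem_univ, if_true]

end Counting

section Sampling

variable {U : Type*} {Q : Type*} {Op : Type*} {prim : Primitives U Q Op} {env : Env U Q}

/-- The weight of the answer `a / (16 k)` to a query with the true answer `f`. -/
def noiseWeight (k : ℕ) (η f : ℝ) (a : ℕ) : ℝ := Real.exp (-(|a / (16 * k) - f| * η))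

/-- One step of weighted reservoir sampling. -/
def reservoir (w : ℕ → ℝ) (i J : ℕ) : PMF ℕ :=
  (biasedCoin (w i / ∑ a ∈ Finset.range (i + 1), w a)).map fun b => if b then i else J

/-- A noisy answer, as a multiple of `1 / (16 k)`. -/
def noisyAnswer (k : ℕ) (η f : ℝ) : PMF ℕ :=
  iterate (reservoir (noiseWeight k η f)) (16 * k + 1) 0

/-- A random query with its noisy answer on the database. -/
def noisyPair (P : Q → U → Bool) (G : PMF Q) (k : ℕ) (η : ℝ) {n : ℕ} (D : Fin n → U) :
    PMF (Q × ℕ) :=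
  G.bind fun q => (noisyAnswer k η (countingAnswer P D q)).map fun a => (q, a)

/-- Compute the weight of the answer in the register `26` and let it enter the reservoir. -/
def noiseBody : Program Op :=
  .seq (block [.op .div 28 26 16, .op .sub 28 28 22, .const 29 0, .op .le 29 29 28,
      .op .add 29 29 29, .op .sub 29 29 8, .op .mul 28 28 29, .op .mul 28 28 14, .const 29 0,
      .op .sub 28 29 28, .op .exp 28 28 28, .op .add 25 25 28, .op .div 29 28 25])
    (.seq (.instr (.toss 30 29)) (.cond 30 (block [.move 27 26]) (block [])))

def noiseLoop : Program Op := forLoop 26 15 39 noiseBody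

lemma noiseLoop_triple (henv : env.coin = biasedCoin) {k : ℕ} {η f : ℝ} {m : Memory U Q}
    {o : List (Word U Q)} (h8 : m.reg 8 = .num 1) (h14 : m.reg 14 = .num η)
    (h15 : m.reg 15 = .num (16 * k + 1)) (h16 : m.reg 16 = .num (16 * k)) (h22 : m.reg 22 = .num f)
    (h25 : m.reg 25 = .num 0) (h26 : m.reg 26 = .num 0) (h27 : m.reg 27 = .num 0) :
    Triple prim env noiseLoop m o ((16 * k + 1) * 50 + 10) (noisyAnswer k η f) fun a m' o' =>
      o' = o ∧ m.Agrees 25 40 m' ∧ m'.reg 27 = .num a := by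
  have hx : ⌈(16 * k + 1 : ℝ)⌉₊ = 16 * k + 1 := by
    rw [show (16 * k + 1 : ℝ) = ((16 * k + 1 : ℕ) : ℝ) by push_cast; ring, Nat.ceil_natCast]
  have := Triple.forLoop (prim := prim) (env := env) (i := 26) (lim := 15) (g := 39)
    (body := noiseBody) (x := 16 * k + 1) (m := m) (o := o) (B := 40) (a := 0)
    (κ := reservoir (noiseWeight k η f))
    (Inv := fun j J m' o' => o' = o ∧ m.Agrees 25 40 m' ∧ m'.reg 26 = .num j ∧
      m'.reg 27 = .num (J : ℕ) ∧ m'.reg 25 = .num (∑ a ∈ Finset.range j, noiseWeight k η f a))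
    (by norm_num) ?_ ?_ ?_ ?_
  · rw [hx] at this
    refine (this.mono (by omega)).conseq ?_
    rintro J - m' o' ⟨h1, h2, h3, h4, h5⟩
    exact ⟨h1, h2, h4⟩
  · rintro j J m' o' - ⟨h1, h2, h3, h4, h5⟩
    exact ⟨h3, by rw [h2.1 15 (by norm_num), h15], by rw [h2.1 8 (by norm_num), h8]⟩
  · rintro j J m' o' w - ⟨h1, h2, h3, h4, h5⟩
    exact ⟨h1, h2.set (by norm_num) _, by simpa using h3, by simpa using h4, by simpa using h5⟩
  · exact ⟨rfl, .refl _, by simpa using h26, by simpa using h27, by simpa using h25⟩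
  · rintro j J m' o' hj ⟨h1, h2, h3, h4, h5⟩
    have e8 : m'.reg 8 = .num 1 := by rw [h2.1 8 (by norm_num), h8]
    have e14 : m'.reg 14 = .num η := by rw [h2.1 14 (by norm_num), h14]
    have e16 : m'.reg 16 = .num (16 * k) := by rw [h2.1 16 (by norm_num), h16]
    have e22 : m'.reg 22 = .num f := by rw [h2.1 22 (by norm_num), h22]
    refine Triple.block_seq (B := 6) (by simp [Instr.Plain]) ?_ (by norm_num)
    obtain ⟨m₁, hm₁⟩ : ∃ m₁, m₁ = effects prim (Op := Op) [.op .div 28 26 16, .op .sub 28 28 22, .const 29 0,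
      .op .le 29 29 28, .op .add 29 29 29, .op .sub 29 29 8, .op .mul 28 28 29, .op .mul 28 28 14,
      .const 29 0, .op .sub 28 29 28, .op .exp 28 28 28, .op .add 25 25 28, .op .div 29 28 25] m' :=
      ⟨_, rfl⟩
    rw [← hm₁]
    have abs : ∀ d : ℝ, d * ((if 0 ≤ d then (1 : ℝ) else 0) + (if 0 ≤ d then 1 else 0) - 1) = |d| := by
      intro d
      split_ifs with h
      · rw [abs_of_nonneg h]; ring
      · rw [abs_of_neg (not_le.mp h)]; ring
    have s8 : m₁.reg 8 = .num 1 := by simpa [hm₁, effects, Instr.effect] using e8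
    have s26 : m₁.reg 26 = .num j := by simpa [hm₁, effects, Instr.effect] using h3
    have s27 : m₁.reg 27 = .num J := by simpa [hm₁, effects, Instr.effect] using h4
    have s25 : m₁.reg 25 = .num (∑ a ∈ Finset.range (j + 1), noiseWeight k η f a) := by
      rw [Finset.sum_range_succ]
      simp [hm₁, effects, Instr.effect, BasicOp.apply, Word.val, Word.bit, e8, e14, e16, e22, h3, h5,
        noiseWeight, abs, -sub_nonneg]
    have s29 : m₁.reg 29 = .num (noiseWeight k η f j /
        ∑ a ∈ Finset.range (j + 1), noiseWeight k η f a) := by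
      rw [Finset.sum_range_succ]
      simp [hm₁, effects, Instr.effect, BasicOp.apply, Word.val, Word.bit, e8, e14, e16, e22, h3, h5,
        noiseWeight, abs, -sub_nonneg]
    have sf : m.Agrees 25 40 m₁ :=
      h2.trans (hm₁ ▸ effects_agrees (by simp [Instr.KeepsReg, Instr.KeepsArr]) m')
    have toss := Triple.toss (prim := prim) (env := env) (x := 30) (y := 29) (m := m₁) (o := o')
      (f := fun b : Bool => if b then j else J)
      (Post := fun J' m'' o'' => o'' = o ∧ (m''.reg 30 = .num 0 ∧ J' = J ∨ m''.reg 30 ≠ .num 0 ∧ J' = j)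
        ∧ ∃ w, m'' = m₁.set 30 w)
      (by
        intro b
        refine ⟨h1, ?_, _, rfl⟩
        cases b <;> simp [Word.bit])
    rw [s29, henv] at toss
    refine (Triple.seq_then (B' := 4) toss ?_ (by norm_num))
    rintro J' - m'' o'' ⟨rfl, h30, w, rfl⟩
    rcases h30 with ⟨h30, rfl⟩ | ⟨h30, rfl⟩
    · refine Triple.cond_neg h30 (.mono (Triple.block (by simp) ?_) (by simp))
      refine ⟨by simpa [effects] using s26, by simpa [effects] using s8, rfl,
        (sf.set (by norm_num) _).set (by norm_num) _, by simp,
        by simpa [effects] using s27, by simpa [effects] using s25⟩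
    · refine Triple.cond_pos h30 (.mono (Triple.block (by simp [Instr.Plain]) ?_) (by simp))
      refine ⟨by simpa [effects, Instr.effect] using s26, by simpa [effects, Instr.effect] using s8, rfl,
        ((sf.set (by norm_num) _).set (by norm_num) _).set (by norm_num) _, by simp,
        by simpa [effects, Instr.effect] using s26, by simpa [effects, Instr.effect] using s25⟩

lemma Triple.draw_query {G : PMF Q} (hG : env.examples = G.map fun q => (.qry q, .num 0)) {x y : ℕ}
    (hxy : x ≠ y) {m : Memory U Q} {o : List (Word U Q)} :
    Triple prim env (.instr (.draw x y)) m o 1 G fun q m' o' =>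
      o' = o ∧ m' = (m.set x (.qry q)).set y (.num 0) := by
  obtain ⟨q₀, -⟩ := G.support_nonempty
  let f : Word U Q × Word U Q → Q := fun e => match e.1 with
    | .qry q => q
    | _ => q₀
  have := Triple.draw (prim := prim) (env := env) (x := x) (y := y) (m := m) (o := o) (f := f)
    (Post := fun q m' o' => o' = o ∧ m' = (m.set x (.qry q)).set y (.num 0)) (by
      intro e he
      rw [hG, PMF.mem_support_map_iff] at he
      obtain ⟨q, -, rfl⟩ := he
      exact ⟨rfl, rfl⟩) hxy
  rw [hG, PMF.map_comp] at this
  have e : (f ∘ fun q => ((.qry q, .num 0) : Word U Q × Word U Q)) = id := rfl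
  rwa [e, PMF.map_id] at this

def sampleBody : Program Op :=
  .seq (.instr (.draw 20 21)) (.seq (block [.const 22 0, .const 23 0]) (.seq countLoop
    (.seq (block [.op .div 22 22 0, .const 25 0, .const 26 0, .const 27 0]) (.seq noiseLoop
      (block [.store 1 18 20, .store 2 18 27])))))

/-- The samples `l` are stored in the arrays `1` and `2`. -/
def Stored (l : List (Q × ℕ)) (m : Memory U Q) : Prop :=
  ∀ i (hi : i < l.length), m.arr 1 i = .qry (l[i]).1 ∧ m.arr 2 i = .num (l[i]).2

lemma Stored.agrees {l : List (Q × ℕ)} {m m' : Memory U Q} {r : ℕ} (h : Stored l m)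
    (h' : m.Agrees r 3 m') : Stored l m' := by
  intro i hi
  rw [h'.2 1 (by norm_num), h'.2 2 (by norm_num)]
  exact h i hi

lemma sampleBody_triple {G : PMF Q} (hG : env.examples = G.map fun q => (.qry q, .num 0))
    (henv : env.coin = biasedCoin) {k n : ℕ} {η : ℝ} (D : Fin n → U) {l : List (Q × ℕ)}
    {m : Memory U Q} {o : List (Word U Q)}
    (h0 : m.reg 0 = .num n) (h8 : m.reg 8 = .num 1) (h14 : m.reg 14 = .num η)
    (h15 : m.reg 15 = .num (16 * k + 1)) (h16 : m.reg 16 = .num (16 * k))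
    (h18 : m.reg 18 = .num l.length) (hD : ∀ i : Fin n, m.arr 0 i = .itm (D i)) (hl : Stored l m) :
    Triple prim env sampleBody m o (n * 17 + (16 * k + 1) * 50 + 60)
      ((noisyPair prim.pred G k η D).map fun x => l ++ [x]) fun l' m' o' =>
        o' = o ∧ m.Agrees 20 1 m' ∧ Stored l' m' := by
  have key : (noisyPair prim.pred G k η D).map (fun x => l ++ [x])
      = G.bind fun q => (noisyAnswer k η (countingAnswer prim.pred D q)).map
        fun a => l ++ [(q, a)] := by
    simp only [noisyPair, PMF.map_bind, PMF.map_comp]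
    rfl
  rw [key]
  refine Triple.seq (B' := n * 17 + (16 * k + 1) * 50 + 50)
    (Triple.draw_query hG (by norm_num)) ?_ (by omega)
  rintro q - _ _ ⟨rfl, rfl⟩
  refine Triple.block_seq (B := n * 17 + (16 * k + 1) * 50 + 40) (by simp [Instr.Plain]) ?_
    (by simp only [List.length_cons, List.length_nil]; omega)
  refine Triple.seq_unit (B' := (16 * k + 1) * 50 + 29)
    (countLoop_triple (q := q) D ?_ ?_ ?_ ?_ ?_ ?_) ?_ (by omega)
  · simpa [effects, Instr.effect] using h0
  · simpa [effects, Instr.effect] using h8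
  · simp [effects, Instr.effect]
  · simp [effects, Instr.effect]
  · simp [effects, Instr.effect]
  · simpa [effects, Instr.effect] using hD
  rintro m₁ o₁ ⟨rfl, h1, h22⟩
  have h1' : m.Agrees 20 40 m₁ := by
    refine Memory.Agrees.trans ?_ (h1.mono (by norm_num) le_rfl)
    exact (((Memory.Agrees.refl m).set (by norm_num) _).set (by norm_num) _).trans
      (effects_agrees (by simp [Instr.KeepsReg, Instr.KeepsArr]) _)
  have e20 : m₁.reg 20 = .qry q := by
    rw [h1.1 20 (by norm_num)]; simp [effects, Instr.effect]
  refine Triple.block_seq (B := (16 * k + 1) * 50 + 19) (by simp [Instr.Plain]) ?_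
    (by simp only [List.length_cons, List.length_nil]; omega)
  obtain ⟨m₂, hm₂⟩ : ∃ m₂, m₂ = effects prim (Op := Op)
    [.op .div 22 22 0, .const 25 0, .const 26 0, .const 27 0] m₁ := ⟨_, rfl⟩
  rw [← hm₂]
  have h2 : m.Agrees 20 40 m₂ :=
    h1'.trans (hm₂ ▸ effects_agrees (by simp [Instr.KeepsReg, Instr.KeepsArr]) _)
  refine Triple.seq_then (B' := 5) ((noiseLoop_triple (k := k) (η := η)
    (f := countingAnswer prim.pred D q) henv
    ?_ ?_ ?_ ?_ ?_ ?_ ?_ ?_).map (Post' := fun l' m' o' => o' = o₁ ∧ m₂.Agrees 25 40 m' ∧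
      ∃ a, m'.reg 27 = .num (a : ℕ) ∧ l' = l ++ [(q, a)]) (fun a => l ++ [(q, a)])
        fun a _ m' o' h => ⟨h.1, h.2.1, a, h.2.2, rfl⟩) ?_ (by omega)
  · rw [h2.1 8 (by norm_num), h8]
  · rw [h2.1 14 (by norm_num), h14]
  · rw [h2.1 15 (by norm_num), h15]
  · rw [h2.1 16 (by norm_num), h16]
  · simp [hm₂, effects, Instr.effect, BasicOp.apply, h22, h1'.1 0 (by norm_num), h0, Word.val,
      countingAnswer]
  · simp [hm₂, effects, Instr.effect]
  · simp [hm₂, effects, Instr.effect]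
  · simp [hm₂, effects, Instr.effect]
  rintro _ - m₃ o₃ ⟨rfl, h3, a, h27, rfl⟩
  have h3' := h2.trans (h3.mono (by norm_num) le_rfl)
  have e18 : m₃.reg 18 = .num l.length := by rw [h3'.1 18 (by norm_num), h18]
  have e20' : m₃.reg 20 = .qry q := by
    rw [h3.1 20 (by norm_num), hm₂]; simp [effects, Instr.effect, e20]
  refine Triple.block (by simp [Instr.Plain]) ⟨rfl, ?_, ?_⟩
  · exact (h3'.mono le_rfl (by norm_num)).trans
      (effects_agrees (by simp [Instr.KeepsReg, Instr.KeepsArr]) _)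
  · have hl' := hl.agrees (h3'.mono le_rfl (by norm_num))
    intro i hi
    simp only [effects, List.foldl, Instr.effect, e18, Word.addr_natCast, e20', h27]
    simp only [List.length_append, List.length_cons, List.length_nil] at hi
    rcases Nat.lt_succ_iff_lt_or_eq.mp hi with h | rfl
    · have := hl' i h
      simp [h.ne, List.getElem_append_left h, this]
    · simp

def sampleLoop : Program Op := forLoop 18 13 39 sampleBody

lemma iid_succ_right {X : Type*} (p : PMF X) (m : ℕ) :
    iid p (m + 1) = (iid p m).bind fun l => p.map fun x => l ++ [x] := by
  induction m with
  | zero => 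
    simp only [iid, PMF.pure_map, PMF.pure_bind, List.nil_append]
    rfl
  | succ m ih =>
    have h2 : iid p (m + 1 + 1) = p.bind fun x => (iid p (m + 1)).map (x :: ·) := rfl
    have h1 : iid p (m + 1) = p.bind fun x => (iid p m).map (x :: ·) := rfl
    rw [h2]
    conv_rhs => rw [h1, PMF.bind_bind]
    refine congrArg _ (funext fun x => ?_)
    rw [ih, PMF.map_bind, PMF.bind_map]
    refine congrArg _ (funext fun l => ?_)
    simp [PMF.map_comp, Function.comp_def]

lemma iterate_append {X : Type*} (p : PMF X) (m : ℕ) :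
    iterate (fun _ l => p.map fun x => l ++ [x]) m [] = iid p m := by
  induction m with
  | zero => rfl
  | succ m ih => rw [iterate, ih, iid_succ_right]

lemma sampleLoop_triple {G : PMF Q} (hG : env.examples = G.map fun q => (.qry q, .num 0))
    (henv : env.coin = biasedCoin) {k n M : ℕ} {η : ℝ} (D : Fin n → U)
    {m : Memory U Q} {o : List (Word U Q)}
    (h0 : m.reg 0 = .num n) (h8 : m.reg 8 = .num 1) (h13 : m.reg 13 = .num M)
    (h14 : m.reg 14 = .num η) (h15 : m.reg 15 = .num (16 * k + 1)) (h16 : m.reg 16 = .num (16 * k))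
    (h18 : m.reg 18 = .num 0) (hD : ∀ i : Fin n, m.arr 0 i = .itm (D i)) :
    Triple prim env sampleLoop m o (M * (n * 17 + (16 * k + 1) * 50 + 70) + 10)
      (iid (noisyPair prim.pred G k η D) M) fun l m' o' =>
        o' = o ∧ m.Agrees 18 1 m' ∧ l.length = M ∧ Stored l m' := by
  have := Triple.forLoop (prim := prim) (env := env) (i := 18) (lim := 13) (g := 39)
    (body := sampleBody) (x := M) (m := m) (o := o) (B := n * 17 + (16 * k + 1) * 50 + 60) (a := [])
    (κ := fun _ l => (noisyPair prim.pred G k η D).map fun x => l ++ [x])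
    (Inv := fun j l m' o' => o' = o ∧ m.Agrees 18 1 m' ∧ m'.reg 18 = .num j ∧
      l.length = j ∧ Stored l m')
    (by norm_num) ?_ ?_ ?_ ?_
  · rw [Nat.ceil_natCast, iterate_append] at this
    refine (this.mono (by ring_nf; omega)).conseq ?_
    rintro l - m' o' ⟨h1, h2, h3, h4, h5⟩
    exact ⟨h1, h2, h4, h5⟩
  · rintro j l m' o' - ⟨h1, h2, h3, h4, h5⟩
    exact ⟨h3, by rw [h2.1 13 (by norm_num), h13], by rw [h2.1 8 (by norm_num), h8]⟩
  · rintro j l m' o' w - ⟨h1, h2, h3, h4, h5⟩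
    exact ⟨h1, h2.set (by norm_num) _, by simpa using h3, h4, h5⟩
  · exact ⟨rfl, .refl _, by simpa using h18, rfl, by simp [Stored]⟩
  · rintro j l m' o' - ⟨h1, h2, h3, h4, h5⟩
    refine (sampleBody_triple hG henv (k := k) (η := η) D (l := l) ?_ ?_ ?_ ?_ ?_ ?_ ?_ h5
      |>.conseq fun l' hl' m'' o'' h => ?_)
    · rw [h2.1 0 (by norm_num), h0]
    · rw [h2.1 8 (by norm_num), h8]
    · rw [h2.1 14 (by norm_num), h14]
    · rw [h2.1 15 (by norm_num), h15]
    · rw [h2.1 16 (by norm_num), h16]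
    · rw [h4, h3]
    · intro i; rw [h2.2 0 (by norm_num), hD]
    · rw [PMF.mem_support_map_iff] at hl'
      obtain ⟨x, -, rfl⟩ := hl'
      have h2' := h2.trans (h.2.1.mono (by norm_num) le_rfl)
      exact ⟨by rw [h.2.1.1 18 (by norm_num), h3], by rw [h2'.1 8 (by norm_num), h8],
        h.1.trans h1, h2'.set le_rfl _, by simp, by simp [h4], h.2.2⟩

end Sampling

section Learning

variable {U : Type*} {Q : Type*} {Op : Type*} {prim : Primitives U Q Op} {env : Env U Q}

/-- The noisy answer `a / (16 k)` is far enough from the threshold `i / k`. -/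
def accepts (i a : ℕ) : Bool := decide (16 < ((a : ℝ) - 16 * i) ^ 2)

/-- The labeled examples for the `i`-th threshold. -/
def accepted (i : ℕ) (l : List (Q × ℕ)) : List (Word U Q × Word U Q) :=
  (l.filter fun x => accepts i x.2).map fun x => (.qry x.1, .bit (decide (16 * i ≤ x.2)))

lemma tape_append (l : List (Word U Q × Word U Q)) (e : Word U Q × Word U Q) :
    tape (l ++ [e]) = Function.update (tape l) l.length e := by
  funext i
  rw [Function.update_apply]
  unfold tape
  split_ifs with h
  · subst h; simp
  · rcases lt_or_gt_of_ne h with h' | h'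
    · exact List.getD_append _ _ _ _ h'
    · rw [List.getD_eq_default _ _ (by simp; omega), List.getD_eq_default _ _ h'.le]

def filterBody : Program Op :=
  .seq (block [.load 24 2 22, .op .sub 25 24 21, .op .mul 25 25 25, .const 26 16, .op .le 25 25 26])
    (.cond 25 (block []) (block [.op .le 26 21 24, .load 27 1 22, .store 40 23 27, .store 41 23 26,
      .op .add 23 23 8]))

/-- Write the accepted examples for the threshold in register `20` to the tape. -/
def filterLoop : Program Op := forLoop 22 13 39 filterBody

/-- `m'` agrees with `m` on the registers from `40` and the arrays from `42` on. -/
def Memory.AgreesAbove (m m' : Memory U Q) : Prop :=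
  (∀ x ≥ 40, m'.reg x = m.reg x) ∧ ∀ a ≥ 42, m'.arr a = m.arr a

lemma Memory.AgreesAbove.set {m m' : Memory U Q} (h : m.AgreesAbove m') {x : ℕ} (hx : x < 40)
    (w : Word U Q) : m.AgreesAbove (m'.set x w) :=
  ⟨fun y hy => by rw [Memory.set_reg, if_neg (by omega), h.1 y hy], h.2⟩

lemma filterLoop_triple {i : ℕ} {l : List (Q × ℕ)} {m : Memory U Q} {o : List (Word U Q)}
    (h8 : m.reg 8 = .num 1) (h13 : m.reg 13 = .num l.length) (h21 : m.reg 21 = .num (16 * i : ℕ))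
    (h22 : m.reg 22 = .num 0) (h23 : m.reg 23 = .num 0) (hl : Stored l m)
    (h40 : m.arr 40 = fun _ => .num 0) (h41 : m.arr 41 = fun _ => .num 0) :
    Triple prim env filterLoop m o (l.length * 40 + 10) (.pure ()) fun _ m' o' => o' = o ∧
      m.Agrees 22 40 m' ∧ m.AgreesAbove m' ∧
      (∀ j, m'.arr 40 j = (tape (accepted i l) j).1) ∧
      ∀ j, m'.arr 41 j = (tape (accepted i l) j).2 := by
  have := Triple.forLoop_unit (prim := prim) (env := env) (i := 22) (lim := 13) (g := 39)
    (body := filterBody) (x := l.length) (m := m)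
    (o := o) (B := 30) (Inv := fun j m' o' => o' = o ∧ m.Agrees 22 40 m' ∧ m.AgreesAbove m' ∧
      m'.reg 22 = .num j ∧ m'.reg 23 = .num (accepted (U := U) i (l.take j)).length ∧
      (∀ j', m'.arr 40 j' = (tape (accepted i (l.take j)) j').1) ∧
      ∀ j', m'.arr 41 j' = (tape (accepted i (l.take j)) j').2)
    (by norm_num) ?_ ?_ ?_ ?_
  · rw [Nat.ceil_natCast] at this
    refine (this.mono (by omega)).conseq ?_
    rintro - - m' o' ⟨h1, h2, h3, h4, h5, h6, h7⟩
    rw [List.take_length] at h6 h7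
    exact ⟨h1, h2, h3, h6, h7⟩
  · rintro j m' o' - ⟨h1, h2, h3, h4, -⟩
    exact ⟨h4, by rw [h2.1 13 (by norm_num), h13], by rw [h2.1 8 (by norm_num), h8]⟩
  · rintro j m' o' w - ⟨h1, h2, h3, h4, h5, h6, h7⟩
    exact ⟨h1, h2.set (by norm_num) _, h3.set (by norm_num) _, by simpa using h4, by simpa using h5,
      h6, h7⟩
  · exact ⟨rfl, .refl _, ⟨fun _ _ => rfl, fun _ _ => rfl⟩, by simpa using h22,
      by simpa [accepted] using h23, by simp [h40, accepted, tape], by simp [h41, accepted, tape]⟩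
  · rintro j m' o' hj ⟨h1, h2, h3, h4, h5, h6, h7⟩
    rw [Nat.ceil_natCast] at hj
    have e8 : m'.reg 8 = .num 1 := by rw [h2.1 8 (by norm_num), h8]
    have e21 : m'.reg 21 = .num (16 * i : ℕ) := by rw [h2.1 21 (by norm_num), h21]
    obtain ⟨ea, eb⟩ := (hl.agrees (h2.mono le_rfl (by norm_num))) j hj
    set x := l[j] with hx
    have htake : l.take (j + 1) = l.take j ++ [x] := by
      rw [hx, List.take_append_getElem]
    refine Triple.block_seq (B := 12) (by simp [Instr.Plain]) ?_ (by norm_num)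
    obtain ⟨m₁, hm₁⟩ : ∃ m₁, m₁ = effects prim (Op := Op) [.load 24 2 22, .op .sub 25 24 21,
      .op .mul 25 25 25, .const 26 16, .op .le 25 25 26] m' := ⟨_, rfl⟩
    rw [← hm₁]
    have s1 : m'.Agrees 24 42 m₁ := hm₁ ▸ effects_agrees (by simp [Instr.KeepsReg, Instr.KeepsArr]) m'
    have s2 : m.AgreesAbove m₁ := by
      have : m₁ = ((((m'.set 24 (m₁.reg 24)).set 25 (.num (x.2 - (16 * i : ℕ)))).set 25
        (.num ((x.2 - (16 * i : ℕ)) * (x.2 - (16 * i : ℕ))))).set 26 (m₁.reg 26)).set 25 (m₁.reg 25) := by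
        simp [hm₁, effects, Instr.effect, BasicOp.apply, Word.val, h4, Word.addr_natCast, eb, e21]
      rw [this]
      exact ((((h3.set (by norm_num) _).set (by norm_num) _).set (by norm_num) _).set (by norm_num) _).set (by norm_num) _
    have s24 : m₁.reg 24 = .num x.2 := by
      simp [hm₁, effects, Instr.effect, h4, Word.addr_natCast, eb]
    have s25 : m₁.reg 25 = .num (if accepts i x.2 then 0 else 1) := by
      have : m₁.reg 25 = .bit (decide (((x.2 : ℝ) - (16 * i : ℕ)) * (x.2 - (16 * i : ℕ)) ≤ 16)) := by
        simp [hm₁, effects, Instr.effect, BasicOp.apply, Word.val, h4, Word.addr_natCast, eb, e21]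
      rw [this, ← sq, Nat.cast_mul, Nat.cast_ofNat, accepts, Word.bit]
      by_cases h : 16 < ((x.2 : ℝ) - 16 * i) ^ 2
      · simp [h]
      · simp [h, not_lt.mp h]
    have s22 : m₁.reg 22 = .num j := by rw [s1.1 22 (by norm_num), h4]
    have s23 : m₁.reg 23 = .num (accepted (U := U) i (l.take j)).length := by
      rw [s1.1 23 (by norm_num), h5]
    have s8 : m₁.reg 8 = .num 1 := by rw [s1.1 8 (by norm_num), e8]
    have s21 : m₁.reg 21 = .num (16 * i : ℕ) := by rw [s1.1 21 (by norm_num), e21]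
    have s40 : m₁.arr 40 = fun j' => (tape (accepted i (l.take j)) j').1 := by
      rw [s1.2 40 (by norm_num)]; exact funext h6
    have s41 : m₁.arr 41 = fun j' => (tape (accepted i (l.take j)) j').2 := by
      rw [s1.2 41 (by norm_num)]; exact funext h7
    have sf : m.Agrees 22 40 m₁ := h2.trans (s1.mono (by norm_num) (by norm_num))
    by_cases hacc : accepts i x.2
    · refine Triple.cond_neg (B := 11) (by rw [s25, if_pos hacc]) (Triple.block (by simp [Instr.Plain]) ?_)
      have hnew : accepted (U := U) i (l.take (j + 1)) = accepted i (l.take j) ++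
          [(.qry x.1, .bit (decide (16 * i ≤ x.2)))] := by
        rw [htake]; simp [accepted, hacc]
      rw [hnew, tape_append]
      have sa : m₁.arr 1 j = .qry x.1 := by rw [s1.2 1 (by norm_num), ea]
      refine ⟨by simpa [effects, Instr.effect] using s22, by simpa [effects, Instr.effect] using s8,
        h1, ?_, ?_, by simp, ?_, ?_, ?_⟩
      · exact (sf.trans (effects_agrees (by simp [Instr.KeepsReg, Instr.KeepsArr]) _)).set (by norm_num) _
      · refine Memory.AgreesAbove.set ⟨fun y hy => ?_, fun a ha => ?_⟩ (by norm_num) _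
        · have n1 : y ≠ 26 := by omega
          have n2 : y ≠ 27 := by omega
          have n3 : y ≠ 23 := by omega
          simpa [effects, Instr.effect, n1, n2, n3] using s2.1 y hy
        · have n1 : a ≠ 40 := by omega
          have n2 : a ≠ 41 := by omega
          simpa [effects, Instr.effect, n1, n2] using s2.2 a ha
      · simp [effects, Instr.effect, BasicOp.apply, s23, s8, Word.val]
      · intro j'
        have e : (effects prim (Op := Op) [.op .le 26 21 24, .load 27 1 22, .store 40 23 27,
            .store 41 23 26, .op .add 23 23 8] m₁).arr 40
            = Function.update (m₁.arr 40) (m₁.reg 23).addr (m₁.arr 1 (m₁.reg 22).addr) := by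
          simp [effects, Instr.effect]
        rw [Memory.set_arr, e, s22, s23, Word.addr_natCast, Word.addr_natCast, sa, s40,
          Function.update_apply, Function.update_apply]
        split_ifs <;> rfl
      · intro j'
        have e : (effects prim (Op := Op) [.op .le 26 21 24, .load 27 1 22, .store 40 23 27,
            .store 41 23 26, .op .add 23 23 8] m₁).arr 41
            = Function.update (m₁.arr 41) (m₁.reg 23).addr
              (.bit (decide ((m₁.reg 21).val ≤ (m₁.reg 24).val))) := by
          simp [effects, Instr.effect, BasicOp.apply]
        have hle : decide ((Word.num (16 * i : ℕ) : Word U Q).val ≤ (Word.num x.2 : Word U Q).val)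
            = decide (16 * i ≤ x.2) := by
          simp only [Word.val, Nat.cast_le]
        rw [Memory.set_arr, e, s21, s23, s24, Word.addr_natCast, hle, s41,
          Function.update_apply, Function.update_apply]
        split_ifs <;> rfl
    · refine Triple.mono (B := 1 + 1) (Triple.cond_pos (by rw [s25]; simp [hacc]) (Triple.block (by simp) ?_))
        (by norm_num)
      have hnew : accepted (U := U) i (l.take (j + 1)) = accepted i (l.take j) := by
        rw [htake]; simp [accepted, hacc]
      rw [hnew]
      exact ⟨s22, s8, h1, sf.set (by norm_num) _, s2.set (by norm_num) _, by simp [effects],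
        by simpa [effects] using s23, by simp [effects, s40], by simp [effects, s41]⟩

def emitLoop : Program Op := forLoop 22 42 39 (.seq (block [.load 23 42 22]) (.instr (.emit 23)))

lemma emitLoop_triple {out o : List (Word U Q)} {m : Memory U Q} (h8 : m.reg 8 = .num 1)
    (h22 : m.reg 22 = .num 0) (h42 : m.reg 42 = .num out.length) (ha : m.arr 42 = listCells out) :
    Triple prim env emitLoop m o (out.length * 20 + 10) (.pure ()) fun _ m' o' => o' = o ++ out ∧
      m.Agrees 22 40 m' := by
  have := Triple.forLoop_unit (prim := prim) (env := env) (i := 22) (lim := 42) (g := 39)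
    (body := .seq (block [.load 23 42 22]) (.instr (.emit 23))) (x := out.length) (m := m)
    (o := o) (B := 5) (Inv := fun j m' o' => o' = o ++ out.take j ∧ m.Agrees 22 40 m' ∧
      m'.reg 22 = .num j ∧ m'.reg 42 = .num out.length ∧ m'.arr 42 = listCells out)
    (by norm_num) ?_ ?_ ?_ ?_
  · rw [Nat.ceil_natCast, List.take_length] at this
    refine (this.mono (by omega)).conseq ?_
    rintro - - m' o' ⟨h1, h2, -⟩
    exact ⟨h1, h2⟩
  · rintro j m' o' - ⟨h1, h2, h3, h4, h5⟩
    exact ⟨h3, h4, by rw [h2.1 8 (by norm_num), h8]⟩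
  · rintro j m' o' w - ⟨h1, h2, h3, h4, h5⟩
    exact ⟨h1, h2.set (by norm_num) _, by simpa using h3, by simpa using h4, h5⟩
  · exact ⟨by simp, .refl _, by simpa using h22, h42, ha⟩
  · rintro j m' o' hj ⟨h1, h2, h3, h4, h5⟩
    rw [Nat.ceil_natCast] at hj
    have e8 : m'.reg 8 = .num 1 := by rw [h2.1 8 (by norm_num), h8]
    refine Triple.block_seq (B := 1) (by simp [Instr.Plain]) (Triple.emit ?_) (by norm_num)
    refine ⟨by simpa [effects, Instr.effect] using h3, by simpa [effects, Instr.effect] using e8, ?_,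
      (h2.trans (effects_agrees (by simp [Instr.KeepsReg, Instr.KeepsArr]) _)).set (by norm_num) _,
      by simp, by simpa [effects, Instr.effect] using h4, by simpa [effects, Instr.effect] using h5⟩
    rw [h1, ← List.take_append_getElem hj]
    simp [effects, Instr.effect, h3, Word.addr_natCast, h5, listCells, hj]

/-- The distribution of the description that the learner writes when its examples are on a tape. -/
def learnOut (prim : Primitives U Q Op) (L : FunAlg Op) (t n : ℕ) (θ γ β : ℝ)
    (w : ℕ → Word U Q × Word U Q) : PMF (List (Word U Q)) :=
  (runTape prim biasedCoin w t (learnerStart L n θ γ β)).map Config.out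

lemma learnOut_length {L : FunAlg Op} {t n : ℕ} {θ γ β : ℝ} {w : ℕ → Word U Q × Word U Q}
    {d : List (Word U Q)} (hd : d ∈ (learnOut prim L t n θ γ β w).support) : d.length ≤ t := by
  rw [learnOut, PMF.mem_support_map_iff] at hd
  obtain ⟨c, hc, rfl⟩ := hd
  have := (runTape_bounds hc).2.2
  simpa [learnerStart, start] using this

def learnBody (L : FunAlg Op) : Program Op :=
  .seq (block [.reset 40, .op .add 20 18 8, .op .div 51 20 9, .const 21 16, .op .mul 21 21 20,
      .const 22 0, .const 23 0, .move 50 5, .move 52 12, .move 53 11])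
    (.seq filterLoop (.seq (block [.move 40 7]) (.seq L.main.clocked (.seq (.instr (.emit 42))
      (.seq (block [.const 22 0]) emitLoop)))))

lemma learnBody_triple (henv : env.coin = biasedCoin) {L : FunAlg Op} {k n t i : ℕ} {γ β : ℝ}
    {l : List (Q × ℕ)} {m : Memory U Q} {o : List (Word U Q)}
    (h5 : m.reg 5 = .num n) (h7 : m.reg 7 = .num t) (h8 : m.reg 8 = .num 1) (h9 : m.reg 9 = .num k)
    (h11 : m.reg 11 = .num β) (h12 : m.reg 12 = .num γ) (h13 : m.reg 13 = .num l.length)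
    (h18 : m.reg 18 = .num i) (hl : Stored l m) :
    Triple prim env (learnBody L) m o (l.length * 40 + t * 50 + 100)
      (learnOut prim L t n ((i + 1) / k) γ β (tape (accepted (i + 1) l))) fun d m' o' =>
        o' = o ++ .num d.length :: d ∧ m.Agrees 20 40 m' := by
  refine Triple.block_seq (B := l.length * 40 + t * 50 + 78) (by simp [Instr.Plain]) ?_
    (by simp only [List.length_cons, List.length_nil]; omega)
  obtain ⟨m₁, hm₁⟩ : ∃ m₁, m₁ = effects prim (Op := Op) [.reset 40, .op .add 20 18 8,
    .op .div 51 20 9, .const 21 16, .op .mul 21 21 20, .const 22 0, .const 23 0, .move 50 5,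
    .move 52 12, .move 53 11] m := ⟨_, rfl⟩
  rw [← hm₁]
  have s1 : m.Agrees 20 40 m₁ := hm₁ ▸ effects_agrees (by simp [Instr.KeepsReg, Instr.KeepsArr]) m
  have shi : ∀ x, m₁.reg (x + 50) = (learnerStart (U := U) (Q := Q) L n ((i + 1) / k) γ β).mem.reg x := by
    intro x
    rcases x with _ | _ | _ | _ | x <;>
    simp [hm₁, effects, Instr.effect, BasicOp.apply, Word.val, h5, h9, h8, h18, h12, h11,
      learnerStart, start, listCells]
  refine Triple.seq_unit (B' := t * 50 + 67) (filterLoop_triple (i := i + 1) (l := l)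
    ?_ ?_ ?_ ?_ ?_ (hl.agrees (s1.mono le_rfl (by norm_num))) ?_ ?_) ?_ (by omega)
  · rw [s1.1 8 (by norm_num), h8]
  · rw [s1.1 13 (by norm_num), h13]
  · simp [hm₁, effects, Instr.effect, BasicOp.apply, Word.val, h18, h8]
  · simp [hm₁, effects, Instr.effect]
  · simp [hm₁, effects, Instr.effect]
  · simp [hm₁, effects, Instr.effect]
  · simp [hm₁, effects, Instr.effect]
  rintro m₂ o₂ ⟨rfl, h2, h2', ht1, ht2⟩
  have s2 : m.Agrees 20 40 m₂ := s1.trans (h2.mono (by norm_num) le_rfl)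
  refine Triple.block_seq (B := t * 50 + 60) (by simp [Instr.Plain]) ?_
    (by simp only [List.length_cons, List.length_nil]; omega)
  obtain ⟨m₃, hm₃⟩ : ∃ m₃, m₃ = effects prim (Op := Op) [.move 40 7] m₂ := ⟨_, rfl⟩
  rw [← hm₃]
  have s3 : m.Agrees 20 40 m₃ :=
    s2.trans (hm₃ ▸ effects_agrees (by simp [Instr.KeepsReg, Instr.KeepsArr]) _)
  have hrep : Represented m₃ (tape (accepted (i + 1) l)) t
      (learnerStart L n ((i + 1) / k) γ β) m₃ := {
    reg := fun x => by
      rw [← shi, ← h2'.1 _ (by omega)]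
      have : x + 50 ≠ 40 := by omega
      simp [hm₃, effects, Instr.effect]
    arr := fun a => by
      have : m₃.arr (a + 50) = m₁.arr (a + 50) := by
        rw [← h2'.2 _ (by omega)]; simp [hm₃, effects, Instr.effect]
      rw [this]
      simp [hm₁, effects, Instr.effect, learnerStart, start]
      unfold listCells
      simp
    clock := by simp [hm₃, effects, Instr.effect, s2.1 7 (by norm_num), h7]
    pointer := by
      have : m₃.reg 41 = m₁.reg 41 := by
        rw [← h2'.1 _ (by omega)]; simp [hm₃, effects, Instr.effect]
      rw [this]
      simp [hm₁, effects, Instr.effect, learnerStart, start]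
    length := by
      have : m₃.reg 42 = m₁.reg 42 := by
        rw [← h2'.1 _ (by omega)]; simp [hm₃, effects, Instr.effect]
      rw [this]
      simp [hm₁, effects, Instr.effect, learnerStart, start]
    out := by
      have : m₃.arr 42 = m₁.arr 42 := by
        rw [← h2'.2 _ (by omega)]; simp [hm₃, effects, Instr.effect]
      rw [this]
      simp [hm₁, effects, Instr.effect, learnerStart, start]
      unfold listCells
      simp
    tape_fst := by simpa [hm₃, effects, Instr.effect] using ht1
    tape_snd := by simpa [hm₃, effects, Instr.effect] using ht2
    low_reg := fun _ _ => rfl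
    low_arr := fun _ _ => rfl
    one := by rw [s3.1 8 (by norm_num), h8] }
  have hlearn : Triple prim env L.main.clocked m₃ o₂ (8 + 30 * t)
      (learnOut prim L t n ((i + 1) / k) γ β (tape (accepted (i + 1) l))) fun d m' o' =>
        o' = o₂ ∧ d.length ≤ t ∧ m₃.Agrees 40 40 m' ∧ m'.reg 42 = .num d.length ∧
        m'.arr 42 = listCells d := by
    rw [learnOut, ← henv]
    refine (L.main.clocked_triple rfl hrep).map _ ?_
    rintro c hc m' o' ⟨rfl, N, h⟩
    have hlen := (runTape_bounds hc).2.2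
    exact ⟨rfl, by simpa [learnerStart, start] using hlen, ⟨h.low_reg, h.low_arr⟩, h.length, h.out⟩
  refine hlearn.seq_then (B' := t * 20 + 20) ?_ (by omega)
  rintro d - m₄ o₄ ⟨rfl, hlen, s4, h42, ha42⟩
  have s4' : m.Agrees 20 40 m₄ := s3.trans (s4.mono (by norm_num) le_rfl)
  refine Triple.seq_unit (B' := t * 20 + 15) (Triple.emit (Post := fun _ m' o' => m' = m₄ ∧ o' = o₄ ++ [m₄.reg 42]) ⟨rfl, rfl⟩) ?_ (by omega)
  rintro _ _ ⟨rfl, rfl⟩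
  refine Triple.block_seq (B := t * 20 + 10) (by simp [Instr.Plain]) ?_
    (by simp only [List.length_cons, List.length_nil]; omega)
  refine Triple.mono ((emitLoop_triple (out := d) ?_ ?_ ?_ ?_).conseq ?_) (B := d.length * 20 + 10) (by omega)
  · simp [effects, Instr.effect, s4'.1 8 (by norm_num), h8]
  · simp [effects, Instr.effect]
  · simp [effects, Instr.effect, h42]
  · simp [effects, Instr.effect, ha42]
  · rintro - - m₅ o₅ ⟨rfl, h5⟩
    refine ⟨by simp [h42], (s4'.trans (effects_agrees (by simp [Instr.KeepsReg, Instr.KeepsArr]) _)).trans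
      (h5.mono (by norm_num) le_rfl)⟩

def learnLoop (L : FunAlg Op) : Program Op := forLoop 18 9 39 (learnBody L)

/-- The descriptions of the hypotheses for all thresholds. -/
def learnAll (prim : Primitives U Q Op) (L : FunAlg Op) (k t n : ℕ) (γ β : ℝ) (l : List (Q × ℕ)) :
    PMF (List (List (Word U Q))) :=
  iterate (fun i ds => (learnOut prim L t n ((i + 1) / k) γ β (tape (accepted (i + 1) l))).map
    fun d => ds ++ [d]) k []

/-- The output that the hypotheses are written to. -/
def encodeAll (ds : List (List (Word U Q))) : List (Word U Q) :=
  ds.flatMap fun d => .num d.length :: d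

lemma learnLoop_triple (henv : env.coin = biasedCoin) {L : FunAlg Op} {k n t : ℕ} {γ β : ℝ}
    {l : List (Q × ℕ)} {m : Memory U Q} {o : List (Word U Q)}
    (h5 : m.reg 5 = .num n) (h7 : m.reg 7 = .num t) (h8 : m.reg 8 = .num 1) (h9 : m.reg 9 = .num k)
    (h11 : m.reg 11 = .num β) (h12 : m.reg 12 = .num γ) (h13 : m.reg 13 = .num l.length)
    (h18 : m.reg 18 = .num 0) (hl : Stored l m) :
    Triple prim env (learnLoop L) m o (k * (l.length * 40 + t * 50 + 110) + 10)
      (learnAll prim L k t n γ β l) fun ds _ o' => o' = o ++ encodeAll ds := by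
  have := Triple.forLoop (prim := prim) (env := env) (i := 18) (lim := 9) (g := 39)
    (body := learnBody L) (x := k) (m := m) (o := o) (B := l.length * 40 + t * 50 + 100) (a := [])
    (κ := fun i ds => (learnOut prim L t n ((i + 1) / k) γ β (tape (accepted (i + 1) l))).map
      fun d => ds ++ [d])
    (Inv := fun j ds m' o' => o' = o ++ encodeAll ds ∧ m.Agrees 18 40 m' ∧ m'.reg 18 = .num j)
    (by norm_num) ?_ ?_ ?_ ?_
  · rw [Nat.ceil_natCast] at this
    refine (this.mono (by ring_nf; omega)).conseq ?_
    rintro ds - m' o' ⟨h1, -⟩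
    exact h1
  · rintro j ds m' o' - ⟨h1, h2, h3⟩
    exact ⟨h3, by rw [h2.1 9 (by norm_num), h9], by rw [h2.1 8 (by norm_num), h8]⟩
  · rintro j ds m' o' w - ⟨h1, h2, h3⟩
    exact ⟨h1, h2.set (by norm_num) _, by simpa using h3⟩
  · exact ⟨by simp [encodeAll], .refl _, by simpa using h18⟩
  · rintro j ds m' o' - ⟨h1, h2, h3⟩
    refine (learnBody_triple (n := n) (k := k) (i := j) henv ?_ ?_ ?_ ?_ ?_ ?_ ?_ h3
      (hl.agrees (h2.mono le_rfl (by norm_num)))).map _ ?_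
    · rw [h2.1 5 (by norm_num), h5]
    · rw [h2.1 7 (by norm_num), h7]
    · rw [h2.1 8 (by norm_num), h8]
    · rw [h2.1 9 (by norm_num), h9]
    · rw [h2.1 11 (by norm_num), h11]
    · rw [h2.1 12 (by norm_num), h12]
    · rw [h2.1 13 (by norm_num), h13]
    · rintro d - m'' o'' ⟨h4, h5⟩
      refine ⟨by rw [h5.1 18 (by norm_num), h3], by rw [h5.1 8 (by norm_num), h2.1 8 (by norm_num), h8],
        by simp [h4, h1, encodeAll], (h2.trans (h5.mono (by norm_num) le_rfl)).set le_rfl _, by simp⟩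

end Learning

section Main

variable {U : Type*} {Q : Type*} {Op : Type*} {prim : Primitives U Q Op} {env : Env U Q}

lemma counter_triple {c lim : ℕ} (hc : c ≠ 39) (hl : lim ≠ 39) (hcl : lim ≠ c) (hc8 : c ≠ 8) {x : ℝ}
    {m : Memory U Q} {o : List (Word U Q)} (h8 : m.reg 8 = .num 1) (h0 : m.reg c = .num 0)
    (hx : m.reg lim = .num x) :
    Triple prim env (forLoop c lim 39 (block [])) m o (⌈x⌉₊ * 11 + 10) (.pure ()) fun _ m' o' =>
      o' = o ∧ m'.reg c = .num ⌈x⌉₊ ∧ (∀ y, y ≠ c → y ≠ 39 → m'.reg y = m.reg y) ∧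
      m'.arr = m.arr := by
  have := Triple.forLoop_unit (prim := prim) (env := env) (i := c) (lim := lim) (g := 39)
    (body := block []) (x := x) (m := m) (o := o) (B := 1) (Inv := fun j m' o' => o' = o ∧
      m'.reg c = .num j ∧ (∀ y, y ≠ c → y ≠ 39 → m'.reg y = m.reg y) ∧ m'.arr = m.arr)
    (by norm_num) ?_ ?_ ?_ ?_
  · exact this
  · rintro j m' o' - ⟨h1, h2, h3, h4⟩
    exact ⟨h2, by rw [h3 _ hcl hl, hx], by rw [h3 8 hc8.symm (by norm_num), h8]⟩
  · rintro j m' o' w - ⟨h1, h2, h3, h4⟩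
    exact ⟨h1, by simp [hc, h2], fun y hy hy' => by simp [hy', h3 y hy hy'], h4⟩
  · exact ⟨rfl, by simpa using h0, fun _ _ _ => rfl, rfl⟩
  · rintro j m' o' hj ⟨h1, h2, h3, h4⟩
    refine Triple.block (by simp) ⟨h2, ?_, h1, by simp, fun y hy hy' => ?_, h4⟩
    · rw [← h8]; exact h3 8 hc8.symm (by norm_num)
    · simpa [effects, hy] using h3 y hy hy'

def releaseCore (L : FunAlg Op) : Program Op :=
  .seq (forLoop 9 16 39 (block []))
    (.seq (block [.op .le 20 6 7, .op .sub 21 8 20, .op .mul 10 20 6, .op .mul 21 21 7,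
      .op .add 10 10 21, .const 20 24, .op .mul 11 3 2, .op .div 11 11 20, .const 20 8,
      .op .mul 12 4 2, .op .div 12 12 20, .op .div 21 8 11, .op .log 21 21 21, .op .mul 17 20 10,
      .op .mul 17 17 21, .op .div 17 17 4, .const 13 0])
    (.seq (forLoop 13 17 39 (block []))
    (.seq (block [.op .mul 14 1 0, .const 20 2, .op .mul 20 20 13, .op .div 14 14 20, .const 20 16,
      .op .mul 16 20 9, .op .add 15 16 8, .const 18 0])
    (.seq sampleLoop
    (.seq (.instr (.emit 9)) (.seq (.instr (.emit 7)) (.seq (block [.const 18 0]) (learnLoop L))))))))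

/-- The release program; for `α ≥ 1 / 2` it outputs the empty description. -/
def releaseMain (L : FunAlg Op) : Program Op :=
  .seq (block [.const 8 1, .const 20 2, .op .div 16 20 2, .const 9 0, .const 21 4, .op .le 22 16 21])
    (.cond 22 (block []) (releaseCore L))

/-- The number of samples that the release program takes. -/
def sampleCount (b t : ℕ) (α β γ : ℝ) : ℕ :=
  ⌈8 * (min b t : ℕ) * Real.log (1 / (β * α / 24)) / γ⌉₊

lemma releaseMain_triple_of_ge {L : FunAlg Op} {α : ℝ} (hα : 0 < α) (hα' : 1 / 2 ≤ α)
    {m : Memory U Q} {o : List (Word U Q)} (h2 : m.reg 2 = .num α) :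
    Triple prim env (releaseMain L) m o 20 (.pure ()) fun _ _ o' => o' = o := by
  refine Triple.block_seq (B := 2) (by simp [Instr.Plain]) ?_ (by norm_num)
  refine Triple.cond_pos ?_ (Triple.block (by simp) rfl)
  have : 2 / α ≤ 4 := by rw [div_le_iff₀ hα]; linarith
  simp [effects, Instr.effect, BasicOp.apply, Word.val, Word.bit, h2, this]

lemma releaseMain_triple {L : FunAlg Op} {G : PMF Q}
    (hG : env.examples = G.map fun q => (.qry q, .num 0)) (henv : env.coin = biasedCoin)
    {n n' b t k M : ℕ} {ε α β γ : ℝ} (hα : 0 < α) (hα' : α < 1 / 2) (D : Fin n → U)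
    (hk : k = ⌈2 / α⌉₊) (hM : M = sampleCount b t α β γ) {m : Memory U Q} {o : List (Word U Q)}
    (h0 : m.reg 0 = .num n) (h1 : m.reg 1 = .num ε) (h2 : m.reg 2 = .num α) (h3 : m.reg 3 = .num β)
    (h4 : m.reg 4 = .num γ) (h5 : m.reg 5 = .num n') (h6 : m.reg 6 = .num b) (h7 : m.reg 7 = .num t)
    (hD : ∀ i : Fin n, m.arr 0 i = .itm (D i)) :
    Triple prim env (releaseMain L) m o
      (k * 11 + M * 11 + M * (n * 17 + (16 * k + 1) * 50 + 70) + k * (M * 40 + t * 50 + 110) + 150)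
      ((iid (noisyPair prim.pred G k (ε * n / (2 * M)) D) M).bind
        (learnAll prim L k t n' (γ * α / 8) (β * α / 24))) fun ds _ o' =>
          o' = o ++ [.num k, .num t] ++ encodeAll ds := by
  set B₁ := M * (n * 17 + (16 * k + 1) * 50 + 70) with hB₁
  set B₂ := k * (M * 40 + t * 50 + 110) with hB₂
  refine Triple.block_seq (B := k * 11 + M * 11 + B₁ + B₂ + 130) (by simp [Instr.Plain]) ?_
    (by simp only [List.length_cons, List.length_nil]; omega)
  obtain ⟨m₁, hm₁⟩ : ∃ m₁, m₁ = effects prim (Op := Op) [.const 8 1, .const 20 2, .op .div 16 20 2,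
    .const 9 0, .const 21 4, .op .le 22 16 21] m := ⟨_, rfl⟩
  rw [← hm₁]
  have low1 : m.Agrees 8 40 m₁ := hm₁ ▸ effects_agrees (by simp [Instr.KeepsReg, Instr.KeepsArr]) m
  have hα4 : ¬ 2 / α ≤ 4 := by rw [not_le, lt_div_iff₀ hα]; linarith
  have a8 : m₁.reg 8 = .num 1 := by simp [hm₁, effects, Instr.effect]
  refine Triple.mono (B := k * 11 + M * 11 + B₁ + B₂ + 129 + 1) (Triple.cond_neg ?_ ?_) (by omega)
  · simp [hm₁, effects, Instr.effect, BasicOp.apply, Word.val, Word.bit, h2, not_le.mp hα4]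
  refine Triple.seq_unit (B' := M * 11 + B₁ + B₂ + 118)
    (counter_triple (x := 2 / α) (by norm_num) (by norm_num) (by norm_num) (by norm_num) a8 ?_ ?_) ?_
    (by rw [← hk]; omega)
  · simp [hm₁, effects, Instr.effect]
  · simp [hm₁, effects, Instr.effect, BasicOp.apply, Word.val, h2]
  rintro m₂ o₂ ⟨rfl, b9, b2, b2'⟩
  rw [← hk] at b9
  have low2 : m.Agrees 8 40 m₂ := ⟨fun x hx => by rw [b2 x (by omega) (by omega), low1.1 x hx],
    fun a ha => by rw [b2', low1.2 a ha]⟩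
  have b8 : m₂.reg 8 = .num 1 := by rw [b2 8 (by norm_num) (by norm_num), a8]
  refine Triple.block_seq (B := M * 11 + B₁ + B₂ + 82) (by simp [Instr.Plain]) ?_
    (by simp only [List.length_cons, List.length_nil]; omega)
  obtain ⟨m₃, hm₃⟩ : ∃ m₃, m₃ = effects prim (Op := Op) [.op .le 20 6 7, .op .sub 21 8 20,
    .op .mul 10 20 6, .op .mul 21 21 7, .op .add 10 10 21, .const 20 24, .op .mul 11 3 2,
    .op .div 11 11 20, .const 20 8, .op .mul 12 4 2, .op .div 12 12 20, .op .div 21 8 11,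
    .op .log 21 21 21, .op .mul 17 20 10, .op .mul 17 17 21, .op .div 17 17 4, .const 13 0] m₂ :=
    ⟨_, rfl⟩
  rw [← hm₃]
  have low3 : m₂.Agrees 10 40 m₃ :=
    hm₃ ▸ effects_agrees (by simp [Instr.KeepsReg, Instr.KeepsArr]) m₂
  have c8 : m₃.reg 8 = .num 1 := by rw [low3.1 8 (by norm_num), b8]
  have e2 := (low2.1 2 (by norm_num)).trans h2
  have e3 := (low2.1 3 (by norm_num)).trans h3
  have e4 := (low2.1 4 (by norm_num)).trans h4
  have e6 := (low2.1 6 (by norm_num)).trans h6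
  have e7 := (low2.1 7 (by norm_num)).trans h7
  have c11 : m₃.reg 11 = .num (β * α / 24) := by
    simp [hm₃, effects, Instr.effect, BasicOp.apply, Word.val, e2, e3]
  have c12 : m₃.reg 12 = .num (γ * α / 8) := by
    simp [hm₃, effects, Instr.effect, BasicOp.apply, Word.val, e2, e4]
  have c17 : m₃.reg 17 = .num (8 * (min b t : ℕ) * Real.log (1 / (β * α / 24)) / γ) := by
    have hmin : ((min b t : ℕ) : ℝ) = (if (b : ℝ) ≤ t then (1 : ℝ) else 0) * b
        + (1 - if (b : ℝ) ≤ t then (1 : ℝ) else 0) * t := by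
      by_cases h : b ≤ t
      · have h' : (b : ℝ) ≤ t := by exact_mod_cast h
        simp [h]
      · have h' : ¬ (b : ℝ) ≤ t := by exact_mod_cast h
        rw [if_neg h', min_eq_right (not_le.mp h).le]; simp
    rw [hmin]
    simp [hm₃, effects, Instr.effect, BasicOp.apply, Word.val, Word.bit, e2, e3, e4, e6, e7, b8]
  refine Triple.seq_unit (B' := B₁ + B₂ + 71)
    (counter_triple (c := 13) (lim := 17) (x := 8 * (min b t : ℕ) * Real.log (1 / (β * α / 24)) / γ)
      (by norm_num) (by norm_num) (by norm_num) (by norm_num) c8 ?_ c17) ?_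
    (by have := hM; unfold sampleCount at this; rw [← this]; omega)
  · simp [hm₃, effects, Instr.effect]
  rintro m₄ o₄ ⟨rfl, d13, d4, d4'⟩
  rw [show ⌈8 * (min b t : ℕ) * Real.log (1 / (β * α / 24)) / γ⌉₊ = M from hM.symm] at d13
  have low4 : m₂.Agrees 10 40 m₄ := ⟨fun x hx => by rw [d4 x (by omega) (by omega), low3.1 x hx],
    fun a ha => by rw [d4', low3.2 a ha]⟩
  refine Triple.block_seq (B := B₁ + B₂ + 53) (by simp [Instr.Plain]) ?_
    (by simp only [List.length_cons, List.length_nil]; omega)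
  obtain ⟨m₅, hm₅⟩ : ∃ m₅, m₅ = effects prim (Op := Op) [.op .mul 14 1 0, .const 20 2,
    .op .mul 20 20 13, .op .div 14 14 20, .const 20 16, .op .mul 16 20 9, .op .add 15 16 8,
    .const 18 0] m₄ := ⟨_, rfl⟩
  rw [← hm₅]
  have low5 : m₄.Agrees 14 40 m₅ :=
    hm₅ ▸ effects_agrees (by simp [Instr.KeepsReg, Instr.KeepsArr]) m₄
  have low : m₂.Agrees 10 40 m₅ := low4.trans (low5.mono (by norm_num) le_rfl)
  have low' : m.Agrees 8 40 m₅ := low2.trans (low.mono (by norm_num) le_rfl)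
  have e0 : m₄.reg 0 = .num n := by rw [low4.1 0 (by norm_num), low2.1 0 (by norm_num), h0]
  have e1 : m₄.reg 1 = .num ε := by rw [low4.1 1 (by norm_num), low2.1 1 (by norm_num), h1]
  have e8 : m₄.reg 8 = .num 1 := by rw [low4.1 8 (by norm_num), b8]
  have e9 : m₄.reg 9 = .num k := by rw [low4.1 9 (by norm_num), b9]
  have f8 : m₅.reg 8 = .num 1 := by rw [low5.1 8 (by norm_num), e8]
  have f9 : m₅.reg 9 = .num k := by rw [low5.1 9 (by norm_num), e9]
  have f13 : m₅.reg 13 = .num M := by rw [low5.1 13 (by norm_num), d13]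
  refine Triple.seq (B' := B₂ + 30) (sampleLoop_triple (k := k) (η := ε * n / (2 * M)) hG henv D
    ?_ f8 f13 ?_ ?_ ?_ ?_ ?_) ?_ (by omega)
  · rw [low'.1 0 (by norm_num), h0]
  · simp [hm₅, effects, Instr.effect, BasicOp.apply, Word.val, e0, e1, d13]
  · simp [hm₅, effects, Instr.effect, BasicOp.apply, Word.val, e8, e9]
  · simp [hm₅, effects, Instr.effect, BasicOp.apply, Word.val, e9]
  · simp [hm₅, effects, Instr.effect]
  · intro i; rw [low'.2 0 (by norm_num), hD]
  rintro l - m₆ o₆ ⟨rfl, s6, rfl, hl⟩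
  refine Triple.seq_unit (B' := B₂ + 25) (Triple.emit (Post := fun _ m' o' => m' = m₆ ∧
    o' = o₆ ++ [m₆.reg 9]) ⟨rfl, rfl⟩) ?_ (by omega)
  rintro m' o' ⟨hm', ho'⟩
  rw [hm', ho']
  clear hm' ho' m' o'
  refine Triple.seq_unit (B' := B₂ + 20) (Triple.emit (Post := fun _ m' o' => m' = m₆ ∧
    o' = o₆ ++ [m₆.reg 9] ++ [m₆.reg 7]) ⟨rfl, rfl⟩) ?_ (by omega)
  rintro m' o' ⟨hm', ho'⟩
  rw [hm', ho']
  clear hm' ho' m' o'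
  refine Triple.block_seq (B := B₂ + 10) (by simp [Instr.Plain]) ?_
    (by simp only [List.length_cons, List.length_nil]; omega)
  obtain ⟨m₇, hm₇⟩ : ∃ m₇, m₇ = effects prim (Op := Op) [.const 18 0] m₆ := ⟨_, rfl⟩
  rw [← hm₇]
  have s7 : m₆.Agrees 18 40 m₇ := hm₇ ▸ effects_agrees (by simp [Instr.KeepsReg, Instr.KeepsArr]) m₆
  have s57 : m₅.Agrees 18 1 m₇ := s6.trans (s7.mono le_rfl (by norm_num))
  refine (learnLoop_triple (n := n') (t := t) (k := k) (l := l) henv ?_ ?_ ?_ ?_ ?_ ?_ ?_ ?_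
    (hl.agrees (s7.mono le_rfl (by norm_num)))).conseq ?_
  · rw [s57.1 5 (by norm_num), low'.1 5 (by norm_num), h5]
  · rw [s57.1 7 (by norm_num), low'.1 7 (by norm_num), h7]
  · rw [s57.1 8 (by norm_num), f8]
  · rw [s57.1 9 (by norm_num), f9]
  · rw [s57.1 11 (by norm_num), low5.1 11 (by norm_num), d4 11 (by norm_num) (by norm_num), c11]
  · rw [s57.1 12 (by norm_num), low5.1 12 (by norm_num), d4 12 (by norm_num) (by norm_num), c12]
  · rw [s57.1 13 (by norm_num), f13]
  · simp [hm₇, effects, Instr.effect]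
  · rintro ds - m' o' rfl
    rw [s6.1 9 (by norm_num), f9, s6.1 7 (by norm_num), low'.1 7 (by norm_num), h7]
    simp

end Main

/-! ### Evaluation of a synopsis -/

section Eval

variable {U : Type*} {Q : Type*} {Op : Type*} {prim : Primitives U Q Op}

/-- Without randomness the run is a single computation. -/
lemma run_deterministic (prim : Primitives U Q Op) (N : ℕ) (c : Config U Q Op) :
    ∃ c', run prim .deterministic N c = .pure c' := by
  have hstep : ∀ c : Config U Q Op, ∃ c', step prim .deterministic c = .pure c' := by
    rintro ⟨code, m, o, d⟩
    match code with
    | [] => exact ⟨_, rfl⟩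
    | .seq p r :: k => exact ⟨_, rfl⟩
    | .cond x p r :: k => exact ⟨_, rfl⟩
    | .loop x p :: k => exact ⟨_, rfl⟩
    | .instr (.draw x y) :: k =>
      exact ⟨_, by simp only [step, Instr.exec, Env.deterministic, PMF.pure_map]; rfl⟩
    | .instr (.toss x y) :: k =>
      exact ⟨_, by simp only [step, Instr.exec, Env.deterministic, PMF.pure_map]; rfl⟩
    | .instr (.const x y) :: k => exact ⟨_, rfl⟩
    | .instr (.move x y) :: k => exact ⟨_, rfl⟩
    | .instr (.op _ x y z) :: k => exact ⟨_, rfl⟩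
    | .instr (.load x y z) :: k => exact ⟨_, rfl⟩
    | .instr (.store x y z) :: k => exact ⟨_, rfl⟩
    | .instr (.reset x) :: k => exact ⟨_, rfl⟩
    | .instr (.emit x) :: k => exact ⟨_, rfl⟩
  induction N generalizing c with
  | zero => exact ⟨c, rfl⟩
  | succ N ih =>
    obtain ⟨c₁, h₁⟩ := hstep c
    obtain ⟨c₂, h₂⟩ := ih c₁
    exact ⟨c₂, by rw [run, h₁, PMF.pure_bind, h₂]⟩

/-- The final configuration of the evaluation of the description `d` at `q`. -/
def evalConfig (prim : Primitives U Q Op) (L : FunAlg Op) (t : ℕ) (d : List (Word U Q)) (q : Q) :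
    Config U Q Op :=
  (run_deterministic prim t (start L.eval [.qry q, .num d.length] d)).choose

lemma run_eval (L : FunAlg Op) (t : ℕ) (d : List (Word U Q)) (q : Q) :
    run prim .deterministic t (start L.eval [.qry q, .num d.length] d)
      = .pure (evalConfig prim L t d q) :=
  (run_deterministic prim t (start L.eval [.qry q, .num d.length] d)).choose_spec

open Classical in
/-- The hypothesis that the description `d` stands for, `false` where the evaluation fails. -/
def hypothesis (prim : Primitives U Q Op) (L : FunAlg Op) (t : ℕ) (d : List (Word U Q)) (q : Q) :
    Bool := decide ((evalConfig prim L t d q).out = [.num 1])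

lemma Represents.hypothesis_eq {L : FunAlg Op} {t : ℕ} {d : List (Word U Q)} {h : Q → Bool}
    (hr : Represents prim L.eval t d fun q => .bit (h q)) (q : Q) :
    hypothesis prim L t d q = h q := by
  have := (hr q (evalConfig prim L t d q) (by rw [run_eval]; simp)).2
  rw [hypothesis, this]
  cases hb : h q <;> simp [Word.bit, hb]

def copyLoop : Program Op :=
  forLoop 11 10 39 (block [.load 12 0 9, .store 50 11 12, .op .add 9 9 8])

lemma copyLoop_triple {env : Env U Q} {pre d post o : List (Word U Q)} {m : Memory U Q}
    (h8 : m.reg 8 = .num 1)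
    (h9 : m.reg 9 = .num pre.length) (h10 : m.reg 10 = .num d.length) (h11 : m.reg 11 = .num 0)
    (h0 : m.arr 0 = listCells (pre ++ d ++ post)) (h50 : m.arr 50 = fun _ => .num 0) :
    Triple prim env copyLoop m o (d.length * 17 + 10) (.pure ()) fun _ m' o' => o' = o ∧
      m.Agrees 9 40 m' ∧ (∀ x ≥ 40, m'.reg x = m.reg x) ∧ (∀ a, a ≠ 50 → m'.arr a = m.arr a) ∧
      m'.arr 50 = listCells d ∧ m'.reg 9 = .num (pre.length + d.length : ℕ) := by
  have := Triple.forLoop_unit (prim := prim) (env := env) (i := 11) (lim := 10) (g := 39)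
    (body := block [.load 12 0 9, .store 50 11 12, .op .add 9 9 8]) (x := d.length) (m := m)
    (o := o) (B := 7) (Inv := fun j m' o' => o' = o ∧
      (∀ x, x ≠ 9 → x ≠ 11 → x ≠ 12 → x ≠ 39 → m'.reg x = m.reg x) ∧
      (∀ a, a ≠ 50 → m'.arr a = m.arr a) ∧ m'.arr 50 = listCells (d.take j) ∧
      m'.reg 9 = .num (pre.length + j : ℕ) ∧ m'.reg 11 = .num j)
    (by norm_num) ?_ ?_ ?_ ?_
  · rw [Nat.ceil_natCast, List.take_length] at this
    refine (this.mono (by omega)).conseq ?_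
    rintro - - m' o' ⟨h1, h2, h3, h4, h5, h6⟩
    exact ⟨h1, ⟨fun x hx => h2 x (by omega) (by omega) (by omega) (by omega),
      fun a ha => h3 a (by omega)⟩, fun x hx => h2 x (by omega) (by omega) (by omega) (by omega),
      h3, h4, h5⟩
  · rintro j m' o' - ⟨h1, h2, h3, h4, h5, h6⟩
    exact ⟨h6, by rw [h2 10 (by norm_num) (by norm_num) (by norm_num) (by norm_num), h10],
      by rw [h2 8 (by norm_num) (by norm_num) (by norm_num) (by norm_num), h8]⟩
  · rintro j m' o' w - ⟨h1, h2, h3, h4, h5, h6⟩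
    exact ⟨h1, fun x hx hx' hx'' hx''' => by simpa [hx'''] using h2 x hx hx' hx'' hx''', h3, h4,
      by simpa using h5, by simpa using h6⟩
  · exact ⟨rfl, fun _ _ _ _ _ => rfl, fun _ _ => rfl,
      by rw [h50]; funext i; simp [listCells], by simpa using h9, by simpa using h11⟩
  · rintro j m' o' hj ⟨h1, h2, h3, h4, h5, h6⟩
    rw [Nat.ceil_natCast] at hj
    have e8 : m'.reg 8 = .num 1 := by
      rw [h2 8 (by norm_num) (by norm_num) (by norm_num) (by norm_num), h8]
    have e0 : m'.arr 0 (pre.length + j) = d[j] := by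
      rw [h3 0 (by norm_num), h0, listCells, List.append_assoc, List.getD_eq_getElem?_getD,
        List.getElem?_append_right (by omega), Nat.add_sub_cancel_left,
        List.getElem?_append_left hj, List.getElem?_eq_getElem hj]
      rfl
    refine Triple.block (by simp [Instr.Plain]) ⟨?_, ?_, h1, ?_, ?_, ?_, ?_, ?_⟩
    · simpa [effects, Instr.effect] using h6
    · simpa [effects, Instr.effect] using e8
    · intro x hx hx' hx'' hx'''
      simpa [effects, Instr.effect, hx, hx', hx''] using h2 x hx hx' hx'' hx'''
    · intro a ha
      simpa [effects, Instr.effect, ha] using h3 a ha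
    · have e : (effects prim (Op := Op) [.load 12 0 9, .store 50 11 12, .op .add 9 9 8] m').arr 50
          = Function.update (m'.arr 50) (m'.reg 11).addr (m'.arr 0 (m'.reg 9).addr) := by
        simp [effects, Instr.effect]
      rw [Memory.set_arr, e, h4, h5, h6, Word.addr_natCast, Word.addr_natCast, e0,
        ← List.take_append_getElem hj, listCells_append]
      simp [hj.le]
    · simp [effects, Instr.effect, BasicOp.apply, h5, e8, Word.val]; ring
    · simp

def evalBody (L : FunAlg Op) : Program Op :=
  .seq (block [.reset 40, .load 10 0 9, .op .add 9 9 8, .const 11 0, .move 50 0, .move 51 10])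
    (.seq copyLoop (.seq (block [.move 40 4]) (.seq L.eval.clocked
      (block [.op .eq 12 42 8, .const 13 0, .load 13 42 13, .op .eq 13 13 8, .op .mul 12 12 13,
        .op .add 7 7 12]))))

lemma evalBody_triple {L : FunAlg Op} {pre d post o : List (Word U Q)} {m : Memory U Q} {q : Q}
    {s : ℝ} {t : ℕ} (hq : m.reg 0 = .qry q) (h4 : m.reg 4 = .num t) (h7 : m.reg 7 = .num s)
    (h8 : m.reg 8 = .num 1) (h9 : m.reg 9 = .num pre.length)
    (h0 : m.arr 0 = listCells (pre ++ .num d.length :: d ++ post)) :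
    Triple prim .deterministic (evalBody L) m o (d.length * 17 + t * 30 + 60) (.pure ())
      fun _ m' o' => o' = o ∧ m.Agrees 7 40 m' ∧ m'.reg 8 = .num 1 ∧
        m'.reg 7 = .num (s + if hypothesis prim L t d q then 1 else 0) ∧
        m'.reg 9 = .num (pre ++ .num d.length :: d).length := by
  refine Triple.block_seq (B := d.length * 17 + t * 30 + 46) (by simp [Instr.Plain]) ?_
    (by simp only [List.length_cons, List.length_nil]; omega)
  obtain ⟨m₁, hm₁⟩ : ∃ m₁, m₁ = effects prim (Op := Op) [.reset 40, .load 10 0 9, .op .add 9 9 8,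
    .const 11 0, .move 50 0, .move 51 10] m := ⟨_, rfl⟩
  rw [← hm₁]
  have s1 : m.Agrees 9 40 m₁ := hm₁ ▸ effects_agrees (by simp [Instr.KeepsReg, Instr.KeepsArr]) m
  have hcell : m.arr 0 pre.length = .num d.length := by
    rw [h0, listCells, List.append_assoc]; simp
  have shi : ∀ x, m₁.reg (x + 50) =
      (start (U := U) (Q := Q) L.eval [.qry q, .num d.length] d).mem.reg x := by
    intro x
    rcases x with _ | _ | x <;>
    simp [hm₁, effects, Instr.effect, h9, Word.addr_natCast, hcell, hq, start, listCells]
  refine Triple.seq_unit (B' := t * 30 + 35) (copyLoop_triple (pre := pre ++ [.num d.length])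
    (d := d) (post := post) ?_ ?_ ?_ ?_ ?_ ?_) ?_ (by omega)
  · rw [s1.1 8 (by norm_num), h8]
  · simp [hm₁, effects, Instr.effect, BasicOp.apply, h9, h8, Word.val]
  · simp [hm₁, effects, Instr.effect, h9, Word.addr_natCast, hcell]
  · simp [hm₁, effects, Instr.effect]
  · rw [s1.2 0 (by norm_num), h0]; simp
  · simp [hm₁, effects, Instr.effect]
  rintro m₂ o₂ ⟨rfl, s2, r2, a2, a50, r9⟩
  have s12 : m.Agrees 9 40 m₂ := s1.trans s2
  refine Triple.block_seq (B := t * 30 + 30) (by simp [Instr.Plain]) ?_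
    (by simp only [List.length_cons, List.length_nil]; omega)
  obtain ⟨m₃, hm₃⟩ : ∃ m₃, m₃ = effects prim (Op := Op) [.move 40 4] m₂ := ⟨_, rfl⟩
  rw [← hm₃]
  have s23 : m₂.Agrees 40 40 m₃ :=
    hm₃ ▸ effects_agrees (by simp [Instr.KeepsReg, Instr.KeepsArr]) _
  have s3 : m.Agrees 9 40 m₃ := s12.trans (s23.mono (by norm_num) le_rfl)
  have hreg : ∀ x ≥ 41, m₃.reg x = m₁.reg x := fun x hx => by
    rw [← r2 x (by omega)]
    have : x ≠ 40 := by omega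
    simp [hm₃, effects, Instr.effect, this]
  have harr : ∀ a, a ≠ 50 → m₃.arr a = m₁.arr a := fun a ha => by
    rw [← a2 a ha]; simp [hm₃, effects, Instr.effect]
  have hrep : Represented m₃ (fun _ => (.num 0, .num 0)) t
      (start L.eval [.qry q, .num d.length] d) m₃ := {
    reg := fun x => by rw [← shi, hreg _ (by omega)]
    arr := fun a => by
      by_cases ha : a = 0
      · subst ha
        simpa [hm₃, effects, Instr.effect, start] using a50
      · rw [harr _ (by omega)]
        simp [hm₁, effects, Instr.effect, start, ha]
    clock := by simp [hm₃, effects, Instr.effect, s12.1 4 (by norm_num), h4]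
    pointer := by
      rw [hreg _ (by norm_num)]
      simp [hm₁, effects, Instr.effect, start]
    length := by
      rw [hreg _ (by norm_num)]
      simp [hm₁, effects, Instr.effect, start]
    out := by
      rw [harr _ (by norm_num)]
      funext i
      simp [hm₁, effects, Instr.effect, start, listCells]
    tape_fst := by
      rw [harr _ (by norm_num)]
      simp [hm₁, effects, Instr.effect]
    tape_snd := by
      rw [harr _ (by norm_num)]
      simp [hm₁, effects, Instr.effect]
    low_reg := fun _ _ => rfl
    low_arr := fun _ _ => rfl
    one := by rw [s3.1 8 (by norm_num), h8] }
  have heval : Triple prim .deterministic L.eval.clocked m₃ o₂ (8 + 30 * t)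
      (.pure (evalConfig prim L t d q)) fun c m' o' => o' = o₂ ∧ m₃.Agrees 40 40 m' ∧
        m'.reg 42 = .num c.out.length ∧ m'.arr 42 = listCells c.out := by
    rw [← run_eval, ← runTape_deterministic]
    refine (L.eval.clocked_triple rfl hrep).conseq ?_
    rintro c - m' o' ⟨rfl, N, h⟩
    exact ⟨rfl, ⟨h.low_reg, h.low_arr⟩, h.length, h.out⟩
  have h := heval.map (Post' := fun _ m' o' => o' = o₂ ∧ m₃.Agrees 40 40 m' ∧
    m'.reg 42 = .num (evalConfig prim L t d q).out.length ∧
    m'.arr 42 = listCells (evalConfig prim L t d q).out) (fun _ => ()) (by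
      rintro c hc m' o' h
      rw [PMF.support_pure, Set.mem_singleton_iff] at hc
      exact hc ▸ h)
  rw [PMF.pure_map] at h
  refine Triple.seq_unit (Pu := fun m' o' => o' = o₂ ∧ m₃.Agrees 40 40 m' ∧
    m'.reg 42 = .num (evalConfig prim L t d q).out.length ∧
    m'.arr 42 = listCells (evalConfig prim L t d q).out) (B' := 13) h ?_ (by omega)
  rintro m₄ o₄ ⟨rfl, s4, l4, out4⟩
  have s4' : m.Agrees 9 40 m₄ := s3.trans (s4.mono (by norm_num) le_rfl)
  have e8 : m₄.reg 8 = .num 1 := by rw [s4'.1 8 (by norm_num), h8]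
  have e7 : m₄.reg 7 = .num s := by rw [s4'.1 7 (by norm_num), h7]
  have e9 : m₄.reg 9 = .num (pre ++ .num d.length :: d).length := by
    rw [s4.1 9 (by norm_num), s23.1 9 (by norm_num), r9]
    simp; ring
  classical
  refine Triple.block (by simp [Instr.Plain]) ⟨rfl, ?_, ?_, ?_, ?_⟩
  · exact (s4'.mono (by norm_num) le_rfl).trans
      (effects_agrees (by simp [Instr.KeepsReg, Instr.KeepsArr]) _)
  · simpa [effects, Instr.effect] using e8
  · have e : (effects prim (Op := Op) [.op .eq 12 42 8, .const 13 0, .load 13 42 13, .op .eq 13 13 8,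
        .op .mul 12 12 13, .op .add 7 7 12] m₄).reg 7 = .num (s + (if m₄.reg 42 = .num 1 then 1 else 0)
          * (if m₄.arr 42 0 = .num 1 then 1 else 0)) := by
      simp [effects, Instr.effect, BasicOp.apply, e8, e7, Word.val, Word.bit, Word.addr]
    rw [e, l4, out4]
    have key : ∀ l : List (Word U Q), ((if (.num l.length : Word U Q) = .num 1 then (1 : ℝ) else 0) *
        if listCells l 0 = .num 1 then 1 else 0) = if l = [.num 1] then 1 else 0 := by
      intro l
      rcases l with _ | ⟨a, _ | ⟨b, l⟩⟩
      · simp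
      · simp [listCells]
      · have : ((l.length : ℝ) + 1 + 1 = 1) ↔ False := by
          rw [iff_false]
          intro h
          have : (0 : ℝ) ≤ l.length := Nat.cast_nonneg _
          linarith
        simp [listCells, this]
    rw [key]
    simp [hypothesis]
  · simpa [effects, Instr.effect] using e9

def evalLoop (L : FunAlg Op) : Program Op := forLoop 6 3 39 (evalBody L)

/-- The value of a synopsis given by hypotheses for all thresholds. -/
def synopsisValue (prim : Primitives U Q Op) (L : FunAlg Op) (k t : ℕ)
    (ds : List (List (Word U Q))) (q : Q) : ℝ :=
  (ds.map fun d => if hypothesis prim L t d q then (1 : ℝ) else 0).sum / k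

lemma evalLoop_triple {L : FunAlg Op} {ds : List (List (Word U Q))} {pre o : List (Word U Q)}
    {m : Memory U Q} {q : Q} {t : ℕ} (hq : m.reg 0 = .qry q) (h3 : m.reg 3 = .num ds.length)
    (h4 : m.reg 4 = .num t) (h6 : m.reg 6 = .num 0) (h7 : m.reg 7 = .num 0)
    (h8 : m.reg 8 = .num 1) (h9 : m.reg 9 = .num pre.length)
    (h0 : m.arr 0 = listCells (pre ++ encodeAll ds)) (hlen : ∀ d ∈ ds, d.length ≤ t) :
    Triple prim .deterministic (evalLoop L) m o (ds.length * (t * 47 + 70) + 10) (.pure ())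
      fun _ m' o' => o' = o ∧ m.Agrees 6 40 m' ∧
        m'.reg 7 = .num (ds.map fun d => if hypothesis prim L t d q then (1 : ℝ) else 0).sum := by
  have := Triple.forLoop_unit (prim := prim) (env := .deterministic) (i := 6) (lim := 3) (g := 39)
    (body := evalBody L) (x := ds.length) (m := m) (o := o) (B := t * 47 + 60)
    (Inv := fun j m' o' => o' = o ∧ m.Agrees 6 40 m' ∧ m'.reg 6 = .num j ∧ m'.reg 8 = .num 1 ∧
      m'.reg 7 = .num ((ds.take j).map fun d => if hypothesis prim L t d q then (1 : ℝ) else 0).sum ∧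
      m'.reg 9 = .num (pre ++ encodeAll (ds.take j)).length)
    (by norm_num) ?_ ?_ ?_ ?_
  · rw [Nat.ceil_natCast, List.take_length] at this
    refine (this.mono (by ring_nf; omega)).conseq ?_
    rintro - - m' o' ⟨h1, h2, h3, h4, h5, h6⟩
    exact ⟨h1, h2, h5⟩
  · rintro j m' o' - ⟨h1, h2, h3', h4, h5, h6⟩
    exact ⟨h3', by rw [h2.1 3 (by norm_num), h3], h4⟩
  · rintro j m' o' w - ⟨h1, h2, h3, h4, h5, h6⟩
    exact ⟨h1, h2.set (by norm_num) _, by simpa using h3, by simpa using h4, by simpa using h5,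
      by simpa using h6⟩
  · exact ⟨rfl, .refl _, by simpa using h6, h8, by simpa using h7,
      by simpa [encodeAll] using h9⟩
  · rintro j m' o' hj ⟨h1, h2, h3, h4', h5, h6⟩
    rw [Nat.ceil_natCast] at hj
    have htake : ds.take (j + 1) = ds.take j ++ [ds[j]] := (List.take_append_getElem hj).symm
    have hsplit : encodeAll ds = encodeAll (ds.take j) ++ (.num (ds[j]).length :: ds[j]) ++
        encodeAll (ds.drop (j + 1)) := by
      have : ds = ds.take j ++ ds[j] :: ds.drop (j + 1) := by simp
      refine (congrArg encodeAll this).trans ?_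
      simp only [encodeAll, List.flatMap_append, List.flatMap_cons, List.append_assoc]
    refine (evalBody_triple (L := L) (pre := pre ++ encodeAll (ds.take j)) (d := ds[j])
      (post := encodeAll (ds.drop (j + 1))) (q := q) (t := t) ?_ ?_ h5 h4' h6 ?_ |>.mono ?_).conseq ?_
    · rw [h2.1 0 (by norm_num), hq]
    · rw [h2.1 4 (by norm_num), h4]
    · rw [h2.2 0 (by norm_num), h0, hsplit]; simp
    · have := hlen ds[j] (List.getElem_mem hj); omega
    · rintro - - m'' o'' ⟨g1, g2, g3, g4, g5⟩
      refine ⟨by rw [g2.1 6 (by norm_num), h3], g3, g1.trans h1,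
        (h2.trans (g2.mono (by norm_num) le_rfl)).set le_rfl _, by simp, by simpa using g3, ?_, ?_⟩
      · rw [htake, List.map_append, List.sum_append, Memory.set_reg, if_neg (by norm_num), g4]
        simp
      · rw [htake, Memory.set_reg, if_neg (by norm_num), g5, encodeAll, encodeAll,
          List.flatMap_append, ← List.append_assoc]
        simp

/-- The evaluation program; the empty description stands for the constant `1 / 2`. -/
def releaseEval (L : FunAlg Op) : Program Op :=
  .cond 1
    (.seq (block [.const 8 1, .const 9 0, .load 3 0 9, .load 4 0 8, .const 9 2, .const 6 0,
      .const 7 0])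
      (.seq (evalLoop L) (.seq (block [.op .div 7 7 3]) (.instr (.emit 7)))))
    (.seq (block [.const 8 1, .const 2 2, .op .div 2 8 2]) (.instr (.emit 2)))

def releaseAlg (L : FunAlg Op) : FunAlg Op := ⟨releaseMain L, releaseEval L⟩

lemma Triple.represents {e : Program Op} {T B : ℕ} {d : List (Word U Q)} {h : Q → Word U Q}
    (H : ∀ q, Triple prim .deterministic e (start e [.qry q, .num d.length] d).mem [] B (.pure ())
      fun _ _ o => o = [h q]) (hT : B ≤ T) : Represents prim e T d h := by
  intro q c hc
  obtain ⟨-, -, h1, h2⟩ := Reaches.run_support (H q [] 0) (fun _ _ _ h => h.1) hT c hc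
  exact ⟨h1, h2⟩

lemma represents_half {L : FunAlg Op} {T : ℕ} (hT : 20 ≤ T) :
    Represents prim (releaseAlg L).eval T [] fun _ => .num (1 / 2) := by
  refine Triple.represents (B := 20) (fun q => ?_) hT
  refine Triple.mono (B := 9 + 1) (Triple.cond_neg (by simp [start, listCells]) ?_) (by norm_num)
  refine Triple.block_seq (B := 1) (by simp [Instr.Plain]) (Triple.emit ?_) (by norm_num)
  simp [effects, Instr.effect, BasicOp.apply, Word.val]

lemma represents_synopsisValue {L : FunAlg Op} {k t T : ℕ} {ds : List (List (Word U Q))}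
    (hk : ds.length = k) (hlen : ∀ d ∈ ds, d.length ≤ t) (hT : k * (t * 47 + 70) + 60 ≤ T) :
    Represents prim (releaseAlg L).eval T ([.num k, .num t] ++ encodeAll ds)
      fun q => .num (synopsisValue prim L k t ds q) := by
  refine Triple.represents (fun q => ?_) hT
  refine Triple.mono (B := k * (t * 47 + 70) + 50 + 1) (Triple.cond_pos ?_ ?_) (by omega)
  · simp only [start, listCells]
    simp
    positivity
  refine Triple.block_seq (B := k * (t * 47 + 70) + 30) (by simp [Instr.Plain]) ?_
    (by simp only [List.length_cons, List.length_nil]; omega)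
  subst hk
  refine Triple.seq_unit (B' := 10) (evalLoop_triple (ds := ds) (pre := [.num ds.length, .num t])
    (q := q) (t := t) ?_ ?_ ?_ ?_ ?_ ?_ ?_ ?_ hlen) ?_ (by omega)
  · simp [effects, Instr.effect, start, listCells]
  · simp [effects, Instr.effect, start, listCells, Word.addr, Word.val]
  · simp [effects, Instr.effect, start, listCells, Word.addr, Word.val]
  · simp [effects, Instr.effect]
  · simp [effects, Instr.effect]
  · simp [effects, Instr.effect]
  · simp [effects, Instr.effect]
  · simp [effects, Instr.effect, start]
  rintro m o ⟨rfl, h1, h2⟩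
  refine Triple.block_seq (B := 1) (by simp [Instr.Plain]) (Triple.emit ?_) (by norm_num)
  have h3 : m.reg 3 = .num ds.length := by
    rw [h1.1 3 (by norm_num)]
    simp [effects, Instr.effect, start, listCells, Word.addr, Word.val]
  simp [effects, Instr.effect, BasicOp.apply, Word.val, h2, h3, synopsisValue]

end Eval

/-! ### Expectations -/

section Expect

variable {X Y : Type*}

/-- The expectation of a nonnegative function. -/
def expect (p : PMF X) (f : X → ℝ≥0∞) : ℝ≥0∞ := ∑' x, p x * f x

lemma expect_bind (p : PMF X) (κ : X → PMF Y) (f : Y → ℝ≥0∞) :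
    expect (p.bind κ) f = expect p fun x => expect (κ x) f := by
  simp only [expect, PMF.bind_apply, ← ENNReal.tsum_mul_right, ← ENNReal.tsum_mul_left]
  rw [ENNReal.tsum_comm]
  simp only [mul_assoc]

lemma expect_pure (x : X) (f : X → ℝ≥0∞) : expect (.pure x) f = f x := by
  rw [expect, tsum_eq_single x]
  · simp
  · intro y hy; simp [hy]

lemma expect_map (p : PMF X) (g : X → Y) (f : Y → ℝ≥0∞) :
    expect (p.map g) f = expect p fun x => f (g x) := by
  rw [PMF.map, expect_bind]
  simp only [Function.comp, expect_pure]

lemma expect_mono_support {p : PMF X} {f g : X → ℝ≥0∞} (h : ∀ x ∈ p.support, f x ≤ g x) :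
    expect p f ≤ expect p g := by
  refine ENNReal.tsum_le_tsum fun x => ?_
  by_cases hx : x ∈ p.support
  · gcongr; exact h x hx
  · rw [PMF.mem_support_iff, not_not] at hx; simp [hx]

lemma expect_mono {p : PMF X} {f g : X → ℝ≥0∞} (h : ∀ x, f x ≤ g x) : expect p f ≤ expect p g :=
  expect_mono_support fun x _ => h x

lemma expect_add (p : PMF X) (f g : X → ℝ≥0∞) :
    expect p (fun x => f x + g x) = expect p f + expect p g := by
  simp only [expect, mul_add, ENNReal.tsum_add]

lemma expect_const (p : PMF X) (c : ℝ≥0∞) : expect p (fun _ => c) = c := by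
  rw [expect, ENNReal.tsum_mul_right, PMF.tsum_coe, one_mul]

lemma expect_const_mul (p : PMF X) (c : ℝ≥0∞) (f : X → ℝ≥0∞) :
    expect p (fun x => c * f x) = c * expect p f := by
  simp only [expect, ← ENNReal.tsum_mul_left]
  exact tsum_congr fun x => by ring

lemma expect_sum {ι : Type*} (p : PMF X) (s : Finset ι) (f : ι → X → ℝ≥0∞) :
    expect p (fun x => ∑ i ∈ s, f i x) = ∑ i ∈ s, expect p (f i) := by
  classical
  induction s using Finset.induction_on with
  | empty => simp [expect]
  | insert a s ha ih => simp only [Finset.sum_insert ha, expect_add, ih]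

lemma prob_eq_expect (p : PMF X) (S : Set X) : prob p S = expect p (S.indicator 1) := by
  classical
  rw [prob, PMF.toOuterMeasure_apply, expect]
  refine tsum_congr fun x => ?_
  by_cases h : x ∈ S <;> simp [h]

lemma prob_bind (p : PMF X) (κ : X → PMF Y) (S : Set Y) :
    prob (p.bind κ) S = expect p fun x => prob (κ x) S := by
  simp only [prob_eq_expect, expect_bind]

lemma prob_map (p : PMF X) (g : X → Y) (S : Set Y) : prob (p.map g) S = prob p (g ⁻¹' S) := by
  rw [prob_eq_expect, prob_eq_expect, expect_map]
  rfl

lemma prob_le_one (p : PMF X) (S : Set X) : prob p S ≤ 1 := by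
  rw [prob_eq_expect, ← expect_const p 1]
  exact expect_mono fun x => Set.indicator_le_self' (by simp) x

lemma prob_mono_support {p : PMF X} {S S' : Set X} (h : ∀ x ∈ p.support, x ∈ S → x ∈ S') :
    prob p S ≤ prob p S' := by
  classical
  rw [prob_eq_expect, prob_eq_expect]
  refine expect_mono_support fun x hx => ?_
  by_cases h' : x ∈ S
  · simp [h', h x hx h']
  · simp [h']

lemma prob_mono {p : PMF X} {S S' : Set X} (h : S ⊆ S') : prob p S ≤ prob p S' :=
  prob_mono_support fun _ _ hx => h hx

lemma prob_union_le (p : PMF X) (S S' : Set X) : prob p (S ∪ S') ≤ prob p S + prob p S' := by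
  classical
  rw [prob_eq_expect, prob_eq_expect, prob_eq_expect, ← expect_add]
  refine expect_mono fun x => ?_
  by_cases h : x ∈ S <;> by_cases h' : x ∈ S' <;> simp [h, h']

lemma prob_add_compl (p : PMF X) (S : Set X) : prob p S + prob p Sᶜ = 1 := by
  classical
  rw [prob_eq_expect, prob_eq_expect, ← expect_add, ← expect_const p 1]
  congr 1
  funext x
  by_cases h : x ∈ S <;> simp [h]

lemma prob_biUnion_le {ι : Type*} (p : PMF X) (s : Finset ι) (S : ι → Set X) :
    prob p (⋃ i ∈ s, S i) ≤ ∑ i ∈ s, prob p (S i) := by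
  classical
  simp only [prob_eq_expect, ← expect_sum]
  refine expect_mono fun x => ?_
  by_cases h : x ∈ ⋃ i ∈ s, S i
  · rw [Set.indicator_of_mem h]
    simp only [Set.mem_iUnion] at h
    obtain ⟨i, hi, hx⟩ := h
    refine le_trans ?_ (Finset.single_le_sum (f := fun i => (S i).indicator (1 : X → ℝ≥0∞) x)
      (fun _ _ => zero_le) hi)
    simp [hx]
  · simp [h]

lemma bind_le_mul {p p' : PMF X} {κ κ' : X → PMF Y} {c c' : ℝ≥0∞} (h : ∀ x, p x ≤ c * p' x)
    (h' : ∀ x y, κ x y ≤ c' * κ' x y) (y : Y) : p.bind κ y ≤ c * c' * p'.bind κ' y := by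
  rw [PMF.bind_apply, PMF.bind_apply, ← ENNReal.tsum_mul_left]
  refine ENNReal.tsum_le_tsum fun x => ?_
  calc p x * κ x y ≤ (c * p' x) * (c' * κ' x y) := mul_le_mul' (h x) (h' x y)
    _ = c * c' * (p' x * κ' x y) := by ring

lemma map_le_mul {p p' : PMF X} {g : X → Y} {c : ℝ≥0∞} (h : ∀ x, p x ≤ c * p' x) (y : Y) :
    p.map g y ≤ c * p'.map g y := by
  have := bind_le_mul (κ := PMF.pure ∘ g) (κ' := PMF.pure ∘ g) (c' := 1) h (fun x y => by simp) y
  simpa [PMF.map] using this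

lemma iid_le_mul {p p' : PMF X} {c : ℝ≥0∞} (h : ∀ x, p x ≤ c * p' x) (m : ℕ) (l : List X) :
    iid p m l ≤ c ^ m * iid p' m l := by
  induction m generalizing l with
  | zero => rw [pow_zero, one_mul]; exact le_rfl
  | succ m ih =>
    rw [pow_succ']
    exact bind_le_mul h (fun x y => map_le_mul ih y) l

lemma prob_bind_le_mul {p p' : PMF X} {c : ℝ≥0∞} (h : ∀ x, p x ≤ c * p' x) (κ : X → PMF Y)
    (S : Set Y) : prob (p.bind κ) S ≤ c * prob (p'.bind κ) S := by
  rw [prob_bind, prob_bind, ← expect_const_mul]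
  refine ENNReal.tsum_le_tsum fun x => ?_
  calc p x * prob (κ x) S ≤ c * p' x * prob (κ x) S := by gcongr; exact h x
    _ = p' x * (c * prob (κ x) S) := by ring

lemma expect_iid_succ (p : PMF X) (m : ℕ) (F : List X → ℝ≥0∞) :
    expect (iid p (m + 1)) F = expect p fun x => expect (iid p m) fun l => F (x :: l) := by
  rw [iid, expect_bind]
  simp only [expect_map]

/-- Replacing the law of independent samples by one that is larger on a set of large measure. -/
lemma expect_iid_le {p p' : PMF X} {S : Set X} {δ : ℝ≥0∞} (hδ : prob p Sᶜ ≤ δ)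
    (hS : ∀ x ∈ S, p x ≤ p' x) (m : ℕ) {F : List X → ℝ≥0∞} (hF : ∀ l, F l ≤ 1) :
    expect (iid p m) F ≤ m * δ + expect (iid p' m) F := by
  classical
  induction m generalizing F with
  | zero => simp [iid]
  | succ m ih =>
    rw [expect_iid_succ, expect_iid_succ]
    have h1 : ∀ x, expect (iid p m) (fun l => F (x :: l)) ≤ 1 := fun x => by
      rw [← expect_const (iid p m) 1]
      exact expect_mono fun l => hF _
    calc expect p (fun x => expect (iid p m) fun l => F (x :: l))
        ≤ prob p Sᶜ + expect p' (fun x => expect (iid p m) fun l => F (x :: l)) := by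
          rw [prob_eq_expect, expect, expect, expect, ← ENNReal.tsum_add]
          refine ENNReal.tsum_le_tsum fun x => ?_
          by_cases hx : x ∈ S
          · refine le_add_left ?_
            gcongr
            exact hS x hx
          · refine le_add_right ?_
            simp only [Set.indicator, Set.mem_compl_iff, hx, not_false_eq_true, if_true]
            gcongr
            exact h1 x
      _ ≤ δ + expect p' (fun x => m * δ + expect (iid p' m) fun l => F (x :: l)) := by
          refine add_le_add hδ (expect_mono fun x => ih fun l => hF _)
      _ = (m + 1 : ℕ) * δ + expect p' fun x => expect (iid p' m) fun l => F (x :: l) := by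
          rw [expect_add, expect_const]
          push_cast
          ring

lemma expect_split (p : PMF X) (S : Set X) (f : X → ℝ≥0∞) :
    expect p f = expect p (S.indicator f) + expect p (Sᶜ.indicator f) := by
  classical
  rw [← expect_add]
  congr 1
  funext x
  by_cases h : x ∈ S <;> simp [h]

lemma expect_indicator_const (p : PMF X) (S : Set X) (c : ℝ≥0∞) :
    expect p (S.indicator fun _ => c) = prob p S * c := by
  classical
  rw [prob_eq_expect, mul_comm, ← expect_const_mul]
  congr 1
  funext x
  by_cases h : x ∈ S <;> simp [h]

lemma prob_ne_zero {p : PMF X} {S : Set X} (h : ∃ a ∈ S, a ∈ p.support) : prob p S ≠ 0 := by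
  obtain ⟨a, ha, hp⟩ := h
  rw [prob, ne_eq, PMF.toOuterMeasure_apply_eq_zero_iff]
  exact fun hd => Set.disjoint_left.mp hd hp ha

lemma filter_apply_eq (p : PMF X) {S : Set X} (h : ∃ a ∈ S, a ∈ p.support) (x : X) :
    p.filter S h x = S.indicator p x * (prob p S)⁻¹ := by
  rw [PMF.filter_apply, prob, PMF.toOuterMeasure_apply]

lemma prob_mul_expect_filter (p : PMF X) {S : Set X} (h : ∃ a ∈ S, a ∈ p.support)
    (f : X → ℝ≥0∞) : prob p S * expect (p.filter S h) f = expect p (S.indicator f) := by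
  classical
  have h0 := prob_ne_zero h
  have h1 : prob p S ≠ ⊤ := ((prob_le_one p S).trans_lt ENNReal.one_lt_top).ne
  rw [expect, ← ENNReal.tsum_mul_left, expect]
  refine tsum_congr fun x => ?_
  rw [filter_apply_eq]
  by_cases hx : x ∈ S
  · rw [Set.indicator_of_mem hx, Set.indicator_of_mem hx]
    calc prob p S * (p x * (prob p S)⁻¹ * f x) = (prob p S * (prob p S)⁻¹) * (p x * f x) := by ring
      _ = p x * f x := by rw [ENNReal.mul_inv_cancel h0 h1, one_mul]
  · simp [hx]

open Classical in
/-- The first `b` samples that lie in `S` are distributed like `b` samples conditioned on `S`. -/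
lemma expect_iid_filter_le (p : PMF X) {S : Set X} (h : ∃ a ∈ S, a ∈ p.support) (m b : ℕ)
    (g : List X → ℝ≥0∞) :
    expect (iid p m) (fun l => if b ≤ (l.filter (· ∈ S)).length then g ((l.filter (· ∈ S)).take b)
      else 0) ≤ expect (iid (p.filter S h) b) g := by
  induction m generalizing b g with
  | zero =>
    rcases b with _ | b
    · simp [iid, expect_pure]
    · simp [iid, expect_pure]
  | succ m ih =>
    rcases b with _ | b
    · simp [iid, expect_pure, expect_const]
    · rw [expect_iid_succ]
      set R := expect (iid (p.filter S h) (b + 1)) g with hR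
      have hR' : R = expect (p.filter S h) fun x =>
          expect (iid (p.filter S h) b) fun l => g (x :: l) := by
        rw [hR, expect_iid_succ]
      rw [expect_split p S]
      calc _ ≤ expect p (S.indicator fun x => expect (iid (p.filter S h) b) fun l => g (x :: l))
            + expect p (Sᶜ.indicator fun _ => R) := by
            refine add_le_add (expect_mono fun x => ?_) (expect_mono fun x => ?_)
            · by_cases hx : x ∈ S
              · rw [Set.indicator_of_mem hx, Set.indicator_of_mem hx]
                refine le_trans (le_of_eq ?_) (ih b fun l => g (x :: l))
                congr 1
                funext l
                simp [hx]
              · simp [hx]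
            · by_cases hx : x ∈ S
              · simp [hx]
              · rw [Set.indicator_of_mem (Set.mem_compl hx), Set.indicator_of_mem (Set.mem_compl hx)]
                refine le_trans (le_of_eq ?_) (ih (b + 1) g)
                congr 1
                funext l
                simp [hx]
        _ = R := by
            rw [← prob_mul_expect_filter p h, ← hR', expect_indicator_const, ← add_mul,
              prob_add_compl, one_mul]

open Classical in
/-- A Chernoff bound. -/
lemma prob_iid_filter_lt (p : PMF X) {S : Set X} {z : ℝ} (hz : 0 ≤ z) (hz' : z ≤ 1)
    (hS : prob p S = ENNReal.ofReal z) (m b : ℕ) :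
    prob (iid p m) {l | (l.filter (· ∈ S)).length < b}
      ≤ ENNReal.ofReal (2 ^ b * (1 - z / 2) ^ m) := by
  have hSc : prob p Sᶜ = ENNReal.ofReal (1 - z) := by
    have := prob_add_compl p S
    rw [hS] at this
    rw [ENNReal.ofReal_sub _ hz, ENNReal.ofReal_one]
    exact ENNReal.eq_sub_of_add_eq ENNReal.ofReal_ne_top (by rw [add_comm]; exact this)
  induction m generalizing b with
  | zero =>
    refine (prob_le_one _ _).trans ?_
    rw [← ENNReal.ofReal_one]
    apply ENNReal.ofReal_le_ofReal
    rw [pow_zero, mul_one]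
    exact one_le_pow₀ (by norm_num)
  | succ m ih =>
    rcases b with _ | b
    · simp [prob_eq_expect, expect]
    · rw [prob_eq_expect, expect_iid_succ, expect_split p S]
      calc _ ≤ expect p (S.indicator fun _ => ENNReal.ofReal (2 ^ b * (1 - z / 2) ^ m))
            + expect p (Sᶜ.indicator fun _ => ENNReal.ofReal (2 ^ (b + 1) * (1 - z / 2) ^ m)) := by
            refine add_le_add (expect_mono fun x => ?_) (expect_mono fun x => ?_)
            · by_cases hx : x ∈ S
              · rw [Set.indicator_of_mem hx, Set.indicator_of_mem hx]
                refine le_trans (le_of_eq ?_) (ih b)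
                rw [prob_eq_expect]
                congr 1
                funext l
                simp [hx, Set.indicator_apply]
              · simp [hx]
            · by_cases hx : x ∈ S
              · simp [hx]
              · rw [Set.indicator_of_mem (Set.mem_compl hx), Set.indicator_of_mem (Set.mem_compl hx)]
                refine le_trans (le_of_eq ?_) (ih (b + 1))
                rw [prob_eq_expect]
                congr 1
                funext l
                simp [hx, Set.indicator_apply]
        _ = ENNReal.ofReal (2 ^ (b + 1) * (1 - z / 2) ^ (m + 1)) := by
            have hz2 : 0 ≤ 1 - z / 2 := by linarith
            rw [expect_indicator_const, expect_indicator_const, hS, hSc, ← ENNReal.ofReal_mul hz,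
              ← ENNReal.ofReal_mul (by linarith), ← ENNReal.ofReal_add (by positivity)
              (mul_nonneg (by linarith) (by positivity))]
            congr 1
            ring

end Expect

/-! ### The law of the noisy answers -/

section Noise

variable {U X Y Q : Type*}

lemma iterate_reservoir_apply {w : ℕ → ℝ} (hw : ∀ a, 0 < w a) (n a : ℕ) :
    iterate (reservoir w) (n + 1) 0 a
      = if a ≤ n then ENNReal.ofReal (w a / ∑ i ∈ Finset.range (n + 1), w i) else 0 := by
  have coin : ∀ p : ℝ, 0 ≤ p → p ≤ 1 → biasedCoin p true = ENNReal.ofReal p ∧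
      biasedCoin p false = ENNReal.ofReal (1 - p) := fun p h h' => by
    have h1 : min (ENNReal.ofReal p) 1 = ENNReal.ofReal p :=
      min_eq_left (by rw [← ENNReal.ofReal_one]; exact ENNReal.ofReal_le_ofReal h')
    constructor
    · simp [biasedCoin, h1]
    · simp [biasedCoin, h1, ENNReal.ofReal_sub _ h]
  have bind_reservoir : ∀ (p : PMF ℕ) (i : ℕ), p.bind (reservoir w i)
      = (biasedCoin (w i / ∑ a ∈ Finset.range (i + 1), w a)).bind
        fun b => if b then .pure i else p := by
    intro p i
    unfold reservoir PMF.map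
    rw [PMF.bind_comm]
    congr 1
    funext b
    cases b
    · simp
    · simp
  induction n generalizing a with
  | zero =>
    have : iterate (reservoir w) 1 0 = .pure 0 := by
      rw [iterate, iterate, bind_reservoir]
      simp
    rw [this]
    rcases Nat.eq_zero_or_pos a with h | h
    · subst h; simp [(hw 0).ne']
    · simp [h.ne']
  | succ n ih =>
    set S := ∑ i ∈ Finset.range (n + 1), w i with hS
    have hS0 : 0 < S := Finset.sum_pos (fun i _ => hw i) (by simp)
    rw [iterate, bind_reservoir, PMF.bind_apply, tsum_bool, Finset.sum_range_succ, ← hS]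
    have h0 := hw (n + 1)
    obtain ⟨ht, hf⟩ := coin (w (n + 1) / (S + w (n + 1))) (by positivity)
      ((div_le_one (by positivity)).2 (by linarith))
    rw [ht, hf]
    simp only [Bool.false_eq_true, if_false, if_true, ih, PMF.pure_apply]
    rcases lt_trichotomy a (n + 1) with h | h | h
    · rw [if_pos (by omega), if_neg h.ne, if_pos h.le, mul_zero, add_zero, ← ENNReal.ofReal_mul]
      · congr 1
        field_simp
        ring
      · rw [sub_nonneg]
        exact (div_le_one (by positivity)).2 (by linarith)
    · subst h
      simp
    · rw [if_neg (by omega), if_neg (by omega), if_neg (by omega)]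
      simp

lemma noiseWeight_pos (k : ℕ) (η f : ℝ) (a : ℕ) : 0 < noiseWeight k η f a := Real.exp_pos _

lemma noisyAnswer_apply (k : ℕ) (η f : ℝ) (a : ℕ) : noisyAnswer k η f a = if a ≤ 16 * k then
    ENNReal.ofReal (noiseWeight k η f a / ∑ i ∈ Finset.range (16 * k + 1), noiseWeight k η f i)
      else 0 :=
  iterate_reservoir_apply (noiseWeight_pos k η f) _ _

lemma noiseWeight_le {k : ℕ} {η : ℝ} (hη : 0 ≤ η) (f f' : ℝ) (a : ℕ) :
    noiseWeight k η f a ≤ Real.exp (η * |f - f'|) * noiseWeight k η f' a := by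
  rw [noiseWeight, noiseWeight, ← Real.exp_add]
  apply Real.exp_le_exp.2
  have := abs_sub_le ((a : ℝ) / (16 * k)) f f'
  nlinarith [mul_le_mul_of_nonneg_left this hη]

lemma noisyAnswer_le {k : ℕ} {η : ℝ} (hη : 0 ≤ η) (f f' : ℝ) (a : ℕ) :
    noisyAnswer k η f a
      ≤ ENNReal.ofReal (Real.exp (2 * (η * |f - f'|))) * noisyAnswer k η f' a := by
  rw [noisyAnswer_apply, noisyAnswer_apply]
  split_ifs
  swap
  · simp
  rw [← ENNReal.ofReal_mul (Real.exp_pos _).le]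
  apply ENNReal.ofReal_le_ofReal
  set S := ∑ i ∈ Finset.range (16 * k + 1), noiseWeight k η f i
  set S' := ∑ i ∈ Finset.range (16 * k + 1), noiseWeight k η f' i
  have hS : 0 < S := Finset.sum_pos (fun i _ => noiseWeight_pos _ _ _ _) (by simp)
  have hS' : 0 < S' := Finset.sum_pos (fun i _ => noiseWeight_pos _ _ _ _) (by simp)
  have hSS : S' ≤ Real.exp (η * |f - f'|) * S := by
    rw [Finset.mul_sum]
    refine Finset.sum_le_sum fun i _ => ?_
    rw [abs_sub_comm]
    exact noiseWeight_le hη f' f i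
  rw [two_mul, Real.exp_add, ← mul_div_assoc, div_le_div_iff₀ hS hS']
  calc noiseWeight k η f a * S'
      ≤ (Real.exp (η * |f - f'|) * noiseWeight k η f' a) * (Real.exp (η * |f - f'|) * S) :=
        mul_le_mul (noiseWeight_le hη f f' a) hSS hS'.le
          (mul_nonneg (Real.exp_pos _).le (noiseWeight_pos _ _ _ _).le)
    _ = _ := by ring

lemma countingAnswer_adjacent {P : Q → U → Bool} {n : ℕ} {D D' : Fin n → U} (h : Adjacent D D')
    (q : Q) : n * |countingAnswer P D q - countingAnswer P D' q| ≤ 1 := by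
  classical
  rcases Nat.eq_zero_or_pos n with rfl | hn
  · simp
  have hn' : (0 : ℝ) < n := by exact_mod_cast hn
  rw [countingAnswer, countingAnswer, ← sub_div, abs_div, abs_of_pos hn', mul_div_cancel₀ _ hn'.ne',
    ← Finset.sum_sub_distrib]
  calc _ ≤ ∑ i, |(if P q (D i) then (1 : ℝ) else 0) - if P q (D' i) then 1 else 0| :=
        Finset.abs_sum_le_sum_abs _ _
    _ ≤ ∑ i, if D i ≠ D' i then (1 : ℝ) else 0 := by
        refine Finset.sum_le_sum fun i _ => ?_
        by_cases hi : D i = D' i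
        · simp [hi]
        · rw [if_pos hi]
          split_ifs <;> norm_num
    _ ≤ 1 := by
        rw [Finset.sum_boole]
        have h' : {i | D i ≠ D' i}.ncard ≤ 1 := h
        rw [Set.ncard_eq_toFinset_card'] at h'
        have : (Finset.univ.filter fun i => D i ≠ D' i).card ≤ 1 := by
          convert h' using 2
          ext i; simp
        exact_mod_cast this

lemma bind_map_pair_apply (G : PMF X) (κ : X → PMF Y) (x : X) (y : Y) :
    (G.bind fun x => (κ x).map fun y => (x, y)) (x, y) = G x * κ x y := by
  classical
  rw [PMF.bind_apply, tsum_eq_single x]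
  · rw [PMF.map_apply, tsum_eq_single y]
    · simp
    · intro y' hy; simp [hy.symm]
  · intro x' hx
    rw [PMF.map_apply]
    simp [hx.symm]

lemma noisyPair_apply (P : Q → U → Bool) (G : PMF Q) (k : ℕ) (η : ℝ) {n : ℕ} (D : Fin n → U)
    (x : Q × ℕ) :
    noisyPair P G k η D x = G x.1 * noisyAnswer k η (countingAnswer P D x.1) x.2 :=
  bind_map_pair_apply _ _ _ _

lemma iid_noisyPair_le (P : Q → U → Bool) (G : PMF Q) (k M : ℕ) {ε : ℝ} (hε : 0 ≤ ε) {n : ℕ}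
    {D D' : Fin n → U} (h : Adjacent D D') (l : List (Q × ℕ)) :
    iid (noisyPair P G k (ε * n / (2 * M)) D) M l
      ≤ ENNReal.ofReal (Real.exp ε) * iid (noisyPair P G k (ε * n / (2 * M)) D') M l := by
  refine (iid_le_mul (p' := noisyPair P G k (ε * n / (2 * M)) D')
    (c := ENNReal.ofReal (Real.exp (ε / M))) (fun x => ?_) M l).trans ?_
  · rw [noisyPair_apply, noisyPair_apply]
    calc _ ≤ G x.1 * (ENNReal.ofReal (Real.exp (ε / M)) *
          noisyAnswer k (ε * n / (2 * M)) (countingAnswer P D' x.1) x.2) := by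
          gcongr
          refine (noisyAnswer_le (by positivity) _ (countingAnswer P D' x.1) _).trans ?_
          gcongr
          calc _ = ε / M * (n * |countingAnswer P D x.1 - countingAnswer P D' x.1|) := by ring
            _ ≤ ε / M * 1 := by gcongr; exact countingAnswer_adjacent h _
            _ = ε / M := mul_one _
      _ = _ := by ring
  · gcongr
    rw [← ENNReal.ofReal_pow (Real.exp_pos _).le, ← Real.exp_nat_mul]
    apply ENNReal.ofReal_le_ofReal
    rw [Real.exp_le_exp]
    rcases Nat.eq_zero_or_pos M with rfl | hM
    · simpa using hε
    · rw [mul_div_cancel₀]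
      exact_mod_cast hM.ne'

/-- The answers within `1 / (8 k)` of the truth. -/
def goodAnswers (k : ℕ) (f : ℝ) : Set ℕ := {a | |a / (16 * k) - f| ≤ 1 / (8 * k)}

open Classical in
/-- A noisy answer, conditioned on being good. -/
def idealAnswer (k : ℕ) (η f : ℝ) : PMF ℕ :=
  if h : ∃ a ∈ goodAnswers k f, a ∈ (noisyAnswer k η f).support then
    (noisyAnswer k η f).filter _ h else .pure 0

/-- A random query with its noisy answer, conditioned on being good. -/
def idealPair (P : Q → U → Bool) (G : PMF Q) (k : ℕ) (η : ℝ) {n : ℕ} (D : Fin n → U) :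
    PMF (Q × ℕ) :=
  G.bind fun q => (idealAnswer k η (countingAnswer P D q)).map fun a => (q, a)

lemma idealPair_apply (P : Q → U → Bool) (G : PMF Q) (k : ℕ) (η : ℝ) {n : ℕ} (D : Fin n → U)
    (x : Q × ℕ) :
    idealPair P G k η D x = G x.1 * idealAnswer k η (countingAnswer P D x.1) x.2 :=
  bind_map_pair_apply _ _ _ _

lemma floor_grid {k : ℕ} (hk : 0 < k) {f : ℝ} (hf : f ∈ Set.Icc (0 : ℝ) 1) :
    ⌊16 * k * f⌋₊ ≤ 16 * k ∧ |(⌊16 * k * f⌋₊ : ℝ) / (16 * k) - f| ≤ 1 / (16 * k) := by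
  have hk' : (0 : ℝ) < k := by exact_mod_cast hk
  have h0 : 0 ≤ 16 * k * f := mul_nonneg (by positivity) hf.1
  constructor
  · apply Nat.floor_le_of_le
    push_cast
    nlinarith [hf.2]
  · have h1 := Nat.floor_le h0
    have h2 := Nat.lt_floor_add_one (16 * k * f)
    have : (⌊16 * k * f⌋₊ : ℝ) / (16 * k) - f = (⌊16 * k * f⌋₊ - 16 * k * f) / (16 * k) := by
      field_simp
    rw [this, abs_div, abs_of_pos (by positivity : (0 : ℝ) < 16 * k)]
    gcongr
    rw [abs_le]
    constructor <;> linarith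

lemma mem_support_idealAnswer {k : ℕ} (hk : 0 < k) {η f : ℝ} (hf : f ∈ Set.Icc (0 : ℝ) 1) {a : ℕ}
    (ha : a ∈ (idealAnswer k η f).support) : a ∈ goodAnswers k f := by
  have h : ∃ a ∈ goodAnswers k f, a ∈ (noisyAnswer k η f).support := by
    obtain ⟨h1, h2⟩ := floor_grid hk hf
    refine ⟨_, h2.trans ?_, ?_⟩
    · gcongr; norm_num
    · rw [PMF.mem_support_iff, noisyAnswer_apply, if_pos h1, ne_eq, ENNReal.ofReal_eq_zero, not_le]
      exact div_pos (noiseWeight_pos _ _ _ _)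
        (Finset.sum_pos (fun i _ => noiseWeight_pos _ _ _ _) (by simp))
  rw [idealAnswer, dif_pos h, PMF.mem_support_filter_iff] at ha
  exact ha.1

lemma noisyAnswer_le_idealAnswer {k : ℕ} {η f : ℝ} {a : ℕ} (ha : a ∈ goodAnswers k f) :
    noisyAnswer k η f a ≤ idealAnswer k η f a := by
  by_cases h0 : a ∈ (noisyAnswer k η f).support
  · rw [idealAnswer, dif_pos ⟨a, ha, h0⟩, filter_apply_eq, Set.indicator_of_mem ha]
    refine le_mul_of_one_le_right zero_le ?_
    rw [ENNReal.one_le_inv]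
    exact prob_le_one _ _
  · rw [PMF.mem_support_iff, not_not] at h0
    simp [h0]

lemma prob_noisyAnswer_bad {k : ℕ} (hk : 0 < k) {η f : ℝ} (hη : 0 ≤ η)
    (hf : f ∈ Set.Icc (0 : ℝ) 1) : prob (noisyAnswer k η f) (goodAnswers k f)ᶜ
      ≤ ENNReal.ofReal ((16 * k + 1) * Real.exp (-(η / (16 * k)))) := by
  classical
  have hk' : (0 : ℝ) < k := by exact_mod_cast hk
  rw [prob, PMF.toOuterMeasure_apply]
  rw [tsum_eq_sum (s := Finset.range (16 * k + 1))]
  swap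
  · intro a ha
    rw [Finset.mem_range, not_lt] at ha
    rw [Set.indicator_apply, noisyAnswer_apply, if_neg (by omega : ¬ a ≤ 16 * k), ite_self]
  obtain ⟨h1, h2⟩ := floor_grid hk hf
  set S := ∑ i ∈ Finset.range (16 * k + 1), noiseWeight k η f i with hS
  have hS1 : Real.exp (-(η / (16 * k))) ≤ S := by
    refine le_trans ?_ (Finset.single_le_sum (f := noiseWeight k η f)
      (fun i _ => (noiseWeight_pos k η f i).le) (Finset.mem_range.2 (Nat.lt_succ_of_le h1)))
    · apply Real.exp_le_exp.2
      rw [neg_le_neg_iff]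
      calc _ ≤ 1 / (16 * k) * η := by gcongr
        _ = _ := by ring
  calc _ ≤ ∑ a ∈ Finset.range (16 * k + 1), ENNReal.ofReal (Real.exp (-(η / (16 * k)))) := by
        refine Finset.sum_le_sum fun a _ => ?_
        rw [Set.indicator_apply]
        split_ifs with h
        swap
        · exact zero_le
        rw [noisyAnswer_apply]
        split_ifs
        swap
        · exact zero_le
        apply ENNReal.ofReal_le_ofReal
        rw [← hS, div_le_iff₀ ((Real.exp_pos _).trans_le hS1)]
        calc noiseWeight k η f a ≤ Real.exp (-(η / (16 * k)) + -(η / (16 * k))) := by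
              apply Real.exp_le_exp.2
              rw [← neg_add, neg_le_neg_iff]
              have h' : 1 / (8 * k) < |(a : ℝ) / (16 * k) - f| := not_le.1 h
              calc _ = 1 / (8 * k) * η := by field_simp; ring
                _ ≤ _ := by gcongr
          _ ≤ _ := by
              rw [Real.exp_add]
              gcongr
    _ = _ := by
        rw [Finset.sum_const, Finset.card_range, nsmul_eq_mul,
          ENNReal.ofReal_mul (by positivity)]
        congr 1
        rw [← ENNReal.ofReal_natCast]
        push_cast
        rfl

lemma countingAnswer_mem_Icc (P : Q → U → Bool) {n : ℕ} (D : Fin n → U) (q : Q) :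
    countingAnswer P D q ∈ Set.Icc (0 : ℝ) 1 := by
  constructor
  · exact div_nonneg (Finset.sum_nonneg fun i _ => by split_ifs <;> norm_num) (by positivity)
  · apply div_le_one_of_le₀ _ (by positivity)
    calc _ ≤ ∑ _i : Fin n, (1 : ℝ) := Finset.sum_le_sum fun i _ => by split_ifs <;> norm_num
      _ = n := by simp

/-- Replacing the noisy answers by good ones. -/
lemma expect_iid_noisyPair_le (P : Q → U → Bool) (G : PMF Q) {k : ℕ} (hk : 0 < k) {η : ℝ}
    (hη : 0 ≤ η) {n : ℕ} (D : Fin n → U) (M : ℕ) {F : List (Q × ℕ) → ℝ≥0∞} (hF : ∀ l, F l ≤ 1) :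
    expect (iid (noisyPair P G k η D) M) F
      ≤ M * ENNReal.ofReal ((16 * k + 1) * Real.exp (-(η / (16 * k))))
        + expect (iid (idealPair P G k η D) M) F := by
  refine expect_iid_le (S := {x | x.2 ∈ goodAnswers k (countingAnswer P D x.1)}) ?_ ?_ M hF
  · rw [noisyPair, prob_bind]
    refine (expect_mono fun q => ?_).trans (expect_const G _).le
    rw [prob_map]
    exact prob_noisyAnswer_bad hk hη (countingAnswer_mem_Icc P D q)
  · intro x hx
    rw [noisyPair_apply, idealPair_apply]
    gcongr
    exact noisyAnswer_le_idealAnswer hx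

end Noise

/-! ### Subsampling a database -/

section Subsample

variable {U Q : Type*}

lemma exp_le_quadratic {x : ℝ} (hx : |x| ≤ 1) : Real.exp x ≤ 1 + x + x ^ 2 := by
  have := Real.abs_exp_sub_one_sub_id_le hx
  linarith [(abs_le.1 this).2]

lemma sum_exp_centered_le {n : ℕ} (hn : 0 < n) {x : Fin n → ℝ} (hx : ∀ i, x i ∈ Set.Icc (0 : ℝ) 1)
    {μ : ℝ} (hμ : μ = (∑ i, x i) / n) {c : ℝ} (hc : |c| ≤ 1) :
    ∑ i, Real.exp (c * (x i - μ)) ≤ n * Real.exp (c ^ 2) := by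
  have hn' : (0 : ℝ) < n := by exact_mod_cast hn
  have hs : ∑ i, x i = n * μ := by rw [hμ]; field_simp
  have h0 : 0 ≤ μ := by rw [hμ]; exact div_nonneg (Finset.sum_nonneg fun i _ => (hx i).1) hn'.le
  have h1 : μ ≤ 1 := by
    rw [hμ]
    apply div_le_one_of_le₀ _ hn'.le
    calc _ ≤ ∑ _i : Fin n, (1 : ℝ) := Finset.sum_le_sum fun i _ => (hx i).2
      _ = n := by simp
  have hd : ∀ i, |x i - μ| ≤ 1 := fun i => abs_le.2 ⟨by linarith [(hx i).1], by linarith [(hx i).2]⟩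
  calc _ ≤ ∑ i, (1 + c * (x i - μ) + c ^ 2) := by
        refine Finset.sum_le_sum fun i _ => ?_
        refine (exp_le_quadratic ?_).trans ?_
        · rw [abs_mul]; exact mul_le_one₀ hc (abs_nonneg _) (hd i)
        · have : (x i - μ) ^ 2 ≤ 1 := by rw [← sq_abs]; exact pow_le_one₀ (abs_nonneg _) (hd i)
          rw [mul_pow]
          nlinarith [sq_nonneg c]
    _ = n * (1 + c ^ 2) := by
        rw [Finset.sum_add_distrib, Finset.sum_add_distrib, ← Finset.mul_sum,
          Finset.sum_sub_distrib, hs]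
        simp
        ring
    _ ≤ _ := by
        gcongr
        linarith [Real.add_one_le_exp (c ^ 2)]

/-- A random subsample of logarithmic size has almost the same answers. -/
lemma exists_subsample [Fintype Q] (P : Q → U → Bool) {n : ℕ} (hn : 0 < n) (D : Fin n → U)
    {n' : ℕ} {δ : ℝ} (hδ : 0 < δ) (hδ' : δ ≤ 1)
    (h : 2 * Fintype.card Q * Real.exp (-(n' * δ ^ 2 / 4)) < 1) :
    ∃ D' : Fin n' → U, ∀ q, |countingAnswer P D' q - countingAnswer P D q| ≤ δ := by
  classical
  by_contra! hcon
  have hn0 : (0 : ℝ) < n := by exact_mod_cast hn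
  have hn' : 0 < n' := by
    rcases Nat.eq_zero_or_pos n' with rfl | h'
    · obtain ⟨q, -⟩ := hcon fun i => i.elim0
      have : 1 ≤ Fintype.card Q := Fintype.card_pos_iff.2 ⟨q⟩
      have : (1 : ℝ) ≤ Fintype.card Q := by exact_mod_cast this
      simp at h
      linarith
    · exact h'
  have hn1 : (0 : ℝ) < n' := by exact_mod_cast hn'
  set x : Q → Fin n → ℝ := fun q i => if P q (D i) then 1 else 0 with hx
  have hx01 : ∀ q i, x q i ∈ Set.Icc (0 : ℝ) 1 := fun q i => by
    simp only [hx]; split_ifs <;> norm_num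
  set μ : Q → ℝ := fun q => (∑ i, x q i) / n with hμ
  set E : ℝ → Q → (Fin n' → Fin n) → ℝ := fun c q p => ∏ j, Real.exp (c * (x q (p j) - μ q)) with hE
  have hEpos : ∀ c q p, 0 < E c q p := fun c q p => Finset.prod_pos fun j _ => Real.exp_pos _
  have hEexp : ∀ c q p, E c q p
      = Real.exp (c * (n' * (countingAnswer P (D ∘ p) q - countingAnswer P D q))) := by
    intro c q p
    simp only [hE]
    rw [← Real.exp_sum, ← Finset.mul_sum, Finset.sum_sub_distrib, mul_sub (n' : ℝ), countingAnswer,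
      mul_div_cancel₀ _ hn1.ne']
    simp [hx, hμ, countingAnswer]
  have upper : ∀ c, |c| ≤ 1 → ∀ q, ∑ p, E c q p ≤ (n : ℝ) ^ n' * Real.exp (n' * c ^ 2) := by
    intro c hc q
    simp only [hE]
    rw [← Fintype.sum_pow fun i => Real.exp (c * (x q i - μ q)), Real.exp_nat_mul, ← mul_pow]
    gcongr
    exact sum_exp_centered_le hn (hx01 q) rfl hc
  have lower : ∀ p, Real.exp (n' * δ ^ 2 / 2) ≤ ∑ q, (E (δ / 2) q p + E (-(δ / 2)) q p) := by
    intro p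
    obtain ⟨q, hq⟩ := hcon (D ∘ p)
    refine le_trans ?_ (Finset.single_le_sum
      (f := fun q => E (δ / 2) q p + E (-(δ / 2)) q p)
      (fun q _ => (add_pos (hEpos _ _ _) (hEpos _ _ _)).le) (Finset.mem_univ q))
    simp only [hEexp]
    rcases lt_abs.1 hq with h' | h'
    · refine le_add_of_le_of_nonneg (Real.exp_le_exp.2 ?_) (Real.exp_pos _).le
      nlinarith [mul_le_mul_of_nonneg_left h'.le (by positivity : 0 ≤ n' * δ)]
    · refine le_add_of_nonneg_of_le (Real.exp_pos _).le (Real.exp_le_exp.2 ?_)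
      nlinarith [mul_le_mul_of_nonneg_left h'.le (by positivity : 0 ≤ n' * δ)]
  have total : (n : ℝ) ^ n' * Real.exp (n' * δ ^ 2 / 2)
      ≤ 2 * Fintype.card Q * ((n : ℝ) ^ n' * Real.exp (n' * δ ^ 2 / 4)) := by
    calc _ = ∑ _p : Fin n' → Fin n, Real.exp (n' * δ ^ 2 / 2) := by simp
      _ ≤ ∑ p, ∑ q, (E (δ / 2) q p + E (-(δ / 2)) q p) := Finset.sum_le_sum fun p _ => lower p
      _ = ∑ q, (∑ p, E (δ / 2) q p + ∑ p, E (-(δ / 2)) q p) := by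
          rw [Finset.sum_comm]; simp only [Finset.sum_add_distrib]
      _ ≤ ∑ _q : Q, ((n : ℝ) ^ n' * Real.exp (n' * δ ^ 2 / 4)
            + (n : ℝ) ^ n' * Real.exp (n' * δ ^ 2 / 4)) := by
          have e : (n' : ℝ) * (δ / 2) ^ 2 = n' * δ ^ 2 / 4 := by ring
          refine Finset.sum_le_sum fun q _ => add_le_add ?_ ?_
          · rw [← e]
            exact upper _ (abs_le.2 ⟨by linarith, by linarith⟩) q
          · rw [← e, ← neg_sq]
            exact upper _ (abs_le.2 ⟨by linarith, by linarith⟩) q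
      _ = _ := by simp; ring
  have e : Real.exp (n' * δ ^ 2 / 2) = Real.exp (n' * δ ^ 2 / 4) * Real.exp (n' * δ ^ 2 / 4) := by
    rw [← Real.exp_add]; ring_nf
  have hpos : 0 < (n : ℝ) ^ n' * Real.exp (n' * δ ^ 2 / 4) := by positivity
  rw [e, ← mul_assoc, mul_comm] at total
  have := le_of_mul_le_mul_right total hpos
  rw [Real.exp_neg, ← div_eq_mul_inv, div_lt_one (Real.exp_pos _)] at h
  linarith

end Subsample

/-! ### The examples for one threshold -/

section Tape

variable {X Y : Type*} {U Q Op : Type*}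

lemma mem_support_iid {p : PMF X} {m : ℕ} {l : List X} (hl : l ∈ (iid p m).support) :
    l.length = m ∧ ∀ x ∈ l, x ∈ p.support := by
  induction m generalizing l with
  | zero =>
    simp only [iid, PMF.support_pure, Set.mem_singleton_iff] at hl
    subst hl; simp
  | succ m ih =>
    simp only [iid, PMF.mem_support_bind_iff, PMF.mem_support_map_iff] at hl
    obtain ⟨x, hx, l, hl, rfl⟩ := hl
    obtain ⟨h1, h2⟩ := ih hl
    refine ⟨by simp [h1], fun y hy => ?_⟩
    rcases List.mem_cons.1 hy with rfl | hy
    · exact hx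
    · exact h2 _ hy

lemma mem_support_iid_of_forall {p : PMF X} {m : ℕ} {l : List X} (hl : l.length = m)
    (h : ∀ x ∈ l, x ∈ p.support) : l ∈ (iid p m).support := by
  induction m generalizing l with
  | zero =>
    obtain rfl := List.length_eq_zero_iff.1 hl
    simp [iid]
  | succ m ih =>
    rcases l with _ | ⟨x, l⟩
    · simp at hl
    simp only [iid, PMF.mem_support_bind_iff, PMF.mem_support_map_iff]
    exact ⟨x, h x (by simp), l, ih (by simpa using hl) fun y hy => h y (by simp [hy]), rfl⟩

lemma iid_map (p : PMF X) (g : X → Y) (m : ℕ) : iid (p.map g) m = (iid p m).map (List.map g) := by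
  induction m with
  | zero => simp [iid, PMF.pure_map]
  | succ m ih =>
    simp only [iid, ih, PMF.bind_map, PMF.map_bind, PMF.map_comp]
    rfl

lemma runTape_eq_of_examples {prim : Primitives U Q Op} {env : Env U Q} {N b : ℕ}
    {c : Config U Q Op} (hc : c.draws = 0) (h : ∀ c' ∈ (run prim env N c).support, c'.draws ≤ b)
    {w w' : ℕ → Word U Q × Word U Q} (hw : ∀ i < b, w i ∈ env.examples.support)
    (hww : ∀ i < b, w i = w' i) :
    runTape prim env.coin w N c = runTape prim env.coin w' N c := by
  obtain ⟨e, he⟩ := env.examples.support_nonempty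
  set W : List (Word U Q × Word U Q) := (List.range (max b N)).map fun i => if i < b then w i else e
    with hW
  have hWs : W ∈ (iid env.examples (max b N)).support := by
    refine mem_support_iid_of_forall (by simp [hW]) fun x hx => ?_
    simp only [hW, List.mem_map] at hx
    obtain ⟨i, -, rfl⟩ := hx
    split_ifs with hi
    · exact hw i hi
    · exact he
  have hd : ∀ c' ∈ (runTape prim env.coin (tape W) N c).support, c'.draws ≤ b := by
    intro c' hc'
    apply h
    rw [← iid_bind_runTape (M := max b N) hc fun c' h' => (h c' h').trans (le_max_left _ _)]
    exact (PMF.mem_support_bind_iff _ _ _).2 ⟨W, hWs, hc'⟩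
  have hWw : ∀ i < b, tape W i = w i := by
    intro i hi
    have : i < max b N := lt_of_lt_of_le hi (le_max_left _ _)
    simp [tape, hW, List.getD, this, hi]
  rw [← runTape_congr (w := tape W) (w' := w), ← runTape_congr (w := tape W) (w' := w')]
  · intro c' hc' i _ hi
    rw [hWw i (hi.trans_le (hd c' hc')), hww i (hi.trans_le (hd c' hc'))]
  · intro c' hc' i _ hi
    rw [hWw i (hi.trans_le (hd c' hc'))]

end Tape

/-! ### Accuracy at one threshold -/

section Threshold

variable {U Q Op : Type*} {prim : Primitives U Q Op}

/-- The answer `f` is far from the threshold `i / k`. -/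
def Far (k i : ℕ) (f : ℝ) : Prop := 3 / (8 * k) < |f - i / k|

lemma far_iff {k : ℕ} (hk : 0 < k) {i : ℕ} {f : ℝ} : Far k i f ↔ 6 < |16 * k * f - 16 * i| := by
  have hk' : (0 : ℝ) < k := by exact_mod_cast hk
  have : 16 * k * f - 16 * i = (16 * k) * (f - i / k) := by field_simp
  rw [Far, this, abs_mul, abs_of_pos (by positivity : (0 : ℝ) < 16 * k), div_lt_iff₀ (by positivity)]
  constructor <;> intro h <;> linarith

lemma mem_goodAnswers_iff {k : ℕ} (hk : 0 < k) {a : ℕ} {f : ℝ} :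
    a ∈ goodAnswers k f ↔ |a - 16 * k * f| ≤ 2 := by
  have hk' : (0 : ℝ) < k := by exact_mod_cast hk
  have : a - 16 * k * f = (16 * k) * (a / (16 * k) - f) := by field_simp
  rw [goodAnswers, Set.mem_ofPred_eq, this, abs_mul, abs_of_pos (by positivity : (0 : ℝ) < 16 * k),
    le_div_iff₀ (by positivity)]
  constructor <;> intro h <;> linarith

lemma accepts_iff {i a : ℕ} : accepts i a = true ↔ 4 < |(a : ℝ) - 16 * i| := by
  rw [accepts, decide_eq_true_iff, ← sq_abs, show (16 : ℝ) = 4 ^ 2 by norm_num,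
    pow_lt_pow_iff_left₀ (by norm_num) (abs_nonneg _) (by norm_num)]

lemma accepts_of_far {k : ℕ} (hk : 0 < k) {i a : ℕ} {f : ℝ} (h : Far k i f)
    (ha : a ∈ goodAnswers k f) : accepts i a = true := by
  rw [accepts_iff]
  rw [far_iff hk] at h
  rw [mem_goodAnswers_iff hk] at ha
  have := abs_sub_le (16 * k * f) a (16 * i)
  rw [abs_sub_comm (16 * k * f) a] at this
  linarith

lemma label_iff {k : ℕ} (hk : 0 < k) {i a : ℕ} {f f' : ℝ} (ha : a ∈ goodAnswers k f)
    (h : accepts i a = true) (hf : |f' - f| ≤ 1 / (8 * k)) : 16 * i ≤ a ↔ (i : ℝ) / k ≤ f' := by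
  have hk' : (0 : ℝ) < k := by exact_mod_cast hk
  rw [accepts_iff] at h
  rw [mem_goodAnswers_iff hk] at ha
  have hf' : |16 * k * f' - 16 * k * f| ≤ 2 := by
    rw [← mul_sub, abs_mul, abs_of_pos (by positivity : (0 : ℝ) < 16 * k)]
    rw [le_div_iff₀ (by positivity)] at hf
    linarith
  have e : (i : ℝ) / k ≤ f' ↔ 16 * (i : ℝ) ≤ 16 * k * f' := by
    rw [div_le_iff₀ hk']; constructor <;> intro h <;> linarith
  have e' : 16 * i ≤ a ↔ 16 * (i : ℝ) ≤ a := by exact_mod_cast Iff.rfl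
  rw [e, e']
  rw [abs_le] at ha hf'
  rcases lt_abs.1 h with h' | h'
  · constructor <;> intro _ <;> linarith [ha.1, ha.2, hf'.1, hf'.2]
  · constructor <;> intro _ <;> linarith [ha.1, ha.2, hf'.1, hf'.2]

lemma far_or_far {k : ℕ} (hk : 0 < k) {i j : ℕ} (hij : i ≠ j) (f : ℝ) : Far k i f ∨ Far k j f := by
  rw [far_iff hk, far_iff hk]
  by_contra! h
  rw [abs_le, abs_le] at h
  rcases lt_or_gt_of_ne hij with h' | h'
  · have : (i : ℝ) + 1 ≤ j := by exact_mod_cast h'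
    linarith [h.1.1, h.1.2, h.2.1, h.2.2]
  · have : (j : ℝ) + 1 ≤ i := by exact_mod_cast h'
    linarith [h.1.1, h.1.2, h.2.1, h.2.2]

variable {G : PMF Q} {k i : ℕ} {η : ℝ} {n n' : ℕ} {D : Fin n → U} {D' : Fin n' → U}

lemma good_of_mem_support_idealPair {P : Q → U → Bool} (hk : 0 < k) {x : Q × ℕ}
    (hx : x ∈ (idealPair P G k η D).support) : x.2 ∈ goodAnswers k (countingAnswer P D x.1) := by
  rw [PMF.mem_support_iff, idealPair_apply] at hx
  exact mem_support_idealAnswer hk (countingAnswer_mem_Icc P D x.1)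
    ((PMF.mem_support_iff _ _).2 (right_ne_zero_of_mul hx))

lemma idealPair_map_fst (P : Q → U → Bool) : (idealPair P G k η D).map Prod.fst = G := by
  rw [idealPair, PMF.map_bind]
  simp only [PMF.map_comp]
  exact (congrArg _ (funext fun q => PMF.map_const _ q)).trans (PMF.bind_pure G)

/-- Far from the threshold every good answer is accepted. -/
lemma prob_far_le {P : Q → U → Bool} (hk : 0 < k) (B : Set Q) :
    prob G {q | Far k i (countingAnswer P D q) ∧ q ∈ B}
      ≤ prob (idealPair P G k η D) {x | accepts i x.2 = true ∧ x.1 ∈ B} := by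
  conv_lhs => rw [← idealPair_map_fst (G := G) (k := k) (η := η) (D := D) P, prob_map]
  refine prob_mono_support fun x hx h => ?_
  exact ⟨accepts_of_far hk h.1 (good_of_mem_support_idealPair hk hx), h.2⟩

/-- The descriptions that are wrong on many queries far from the threshold. -/
def badDescriptions (prim : Primitives U Q Op) (L : FunAlg Op) (G : PMF Q) (k : ℕ) (t : ℕ) (γ : ℝ)
    {n n' : ℕ} (D : Fin n → U) (D' : Fin n' → U) (i : ℕ) : Set (List (Word U Q)) :=
  {d | ENNReal.ofReal γ < prob G {q | Far k i (countingAnswer prim.pred D q) ∧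
    hypothesis prim L t d q ≠ decide ((i : ℝ) / k ≤ countingAnswer prim.pred D' q)}}

lemma one_sub_pow_mono {z γ : ℝ} (hz : γ ≤ z) (hz' : z ≤ 1) (M : ℕ) :
    (1 - z / 2) ^ M ≤ (1 - γ / 2) ^ M := by
  gcongr
  linarith

lemma expect_learnOut_le {L : FunAlg Op} {𝒢 : Set (PMF Q)} (hG : G ∈ 𝒢) {b t : ℕ → ℝ → ℝ → ℕ}
    {γ γ' β' : ℝ} (hγ : γ ∈ Set.Ioo (0 : ℝ) 1) (hγ' : γ' ∈ Set.Ioo (0 : ℝ) 1)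
    (hβ' : β' ∈ Set.Ioo (0 : ℝ) 1)
    (hL : LearnsThresholds prim L (smoothExtension (2 / γ) 𝒢) (itemPredicates prim.pred) b t)
    (hn' : 0 < n') (hk : 0 < k) (hik : i ≤ k)
    (hD : ∀ q, |countingAnswer prim.pred D' q - countingAnswer prim.pred D q| ≤ 1 / (8 * k))
    (hi : ENNReal.ofReal (γ / 2) ≤
      prob (idealPair prim.pred G k η D) {x | accepts i x.2 = true}) (M : ℕ) :
    expect (iid (idealPair prim.pred G k η D) M) (fun l =>
      prob (learnOut prim L (t n' γ' β') n' (i / k) γ' β' (tape (accepted i l)))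
        (badDescriptions prim L G k (t n' γ' β') γ' D D' i))
      ≤ ENNReal.ofReal (2 ^ min (b n' γ' β') (t n' γ' β') * (1 - γ / 4) ^ M)
        + ENNReal.ofReal β' := by
  classical
  set H := idealPair prim.pred G k η D with hH
  obtain ⟨A, hA⟩ : ∃ A : Set (Q × ℕ), A = {x | accepts i x.2 = true} := ⟨_, rfl⟩
  rw [← hA] at hi
  have hmem : ∀ x, x ∈ A ↔ accepts i x.2 = true := fun x => by rw [hA]; rfl
  set t₁ := t n' γ' β' with ht₁
  set b₀ := min (b n' γ' β') t₁ with hb₀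
  have hγ2 : 0 < γ / 2 := by linarith [hγ.1]
  have hA0 : prob H A ≠ 0 := (lt_of_lt_of_le (ENNReal.ofReal_pos.2 hγ2) hi).ne'
  have hA1 : prob H A ≠ ⊤ := ((prob_le_one H A).trans_lt ENNReal.one_lt_top).ne
  have hAs : ∃ a ∈ A, a ∈ H.support := by
    by_contra hcon
    push Not at hcon
    apply hA0
    rw [prob, PMF.toOuterMeasure_apply_eq_zero_iff]
    exact Set.disjoint_left.2 fun x hx hx' => hcon x hx' hx
  -- the learner's distribution and target
  set f : Q → Bool := fun q => decide ((i : ℝ) / k ≤ countingAnswer prim.pred D' q) with hf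
  set G' : PMF Q := (H.filter A hAs).map Prod.fst with hG'
  have hG'mem : G' ∈ smoothExtension (2 / γ) 𝒢 := by
    refine ⟨G, hG, fun q => ?_⟩
    have h1 : ∀ x, H.filter A hAs x ≤ ENNReal.ofReal (2 / γ) * H x := by
      intro x
      rw [filter_apply_eq, mul_comm]
      gcongr
      · rw [show (2 : ℝ) / γ = (γ / 2)⁻¹ by rw [inv_div], ENNReal.ofReal_inv_of_pos hγ2]
        exact ENNReal.inv_le_inv.2 hi
      · exact Set.indicator_le_self' (fun _ _ => zero_le) x
    have h2 := map_le_mul (g := Prod.fst) h1 q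
    have h3 : H.map Prod.fst = G := idealPair_map_fst _
    rwa [h3] at h2
  have hfmem : f ∈ nThresholds (itemPredicates prim.pred) n' ((i : ℝ) / k) :=
    ⟨fun j q => prim.pred q (D' j), fun j => ⟨D' j, rfl⟩, fun q => by
      simp [hf, countingAnswer]⟩
  have hk' : (0 : ℝ) < k := by exact_mod_cast hk
  have hθ : (i : ℝ) / k ∈ Set.Icc (0 : ℝ) 1 :=
    ⟨by positivity, by rw [div_le_one hk']; exact_mod_cast hik⟩
  obtain ⟨hrun, hacc⟩ := hL n' hn' γ' hγ' β' hβ' _ hθ f hfmem G' hG'mem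
  rw [← ht₁] at hrun hacc
  have hdraws : ∀ c' ∈ (run prim (.labeled G' f) t₁ (learnerStart L n' (i / k) γ' β')).support,
      c'.draws ≤ b₀ := fun c' hc' => by
    have h2 := (run_bounds hc').2.1
    simp only [learnerStart, start, zero_add] at h2
    exact le_min (hrun c' hc').2.1 h2
  -- the law of the accepted examples
  set lab : Q × ℕ → Word U Q × Word U Q := fun x => (.qry x.1, .bit (decide (16 * i ≤ x.2)))
    with hlab
  have hlabel : ∀ x ∈ H.support, x ∈ A → lab x = (.qry x.1, .bit (f x.1)) := by
    intro x hx hxA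
    simp only [hlab, hf]
    congr 2
    exact decide_eq_decide.2 (label_iff hk (good_of_mem_support_idealPair hk hx) ((hmem x).1 hxA) (hD x.1))
  have hfilter : ∀ x ∈ (H.filter A hAs).support, x ∈ A ∧ x ∈ H.support := fun x hx =>
    (PMF.mem_support_filter_iff hAs).1 hx
  have hex : (H.filter A hAs).map lab = (Env.labeled (U := U) G' f).examples := by
    rw [Env.labeled, hG', PMF.map_comp, PMF.map, PMF.map]
    refine PMF.bind_congr_support _ fun x hx => ?_
    obtain ⟨h1, h2⟩ := hfilter x hx
    simp [hlabel x h2 h1]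
  have hexs : ∀ x ∈ H.support, x ∈ A → lab x ∈ (Env.labeled (U := U) G' f).examples.support := by
    intro x hx hxA
    rw [← hex, PMF.mem_support_map_iff]
    exact ⟨x, (PMF.mem_support_filter_iff hAs).2 ⟨hxA, hx⟩, rfl⟩
  set Bad := badDescriptions prim L G k t₁ γ' D D' i with hBad
  set g : List (Q × ℕ) → ℝ≥0∞ := fun l =>
    prob (learnOut prim L t₁ n' (i / k) γ' β' (tape (l.map lab))) Bad with hg
  have hF : ∀ l ∈ (iid H M).support, b₀ ≤ (l.filter (· ∈ A)).length →
      prob (learnOut prim L t₁ n' (i / k) γ' β' (tape (accepted i l))) Bad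
        = g ((l.filter (· ∈ A)).take b₀) := by
    intro l hl hlen
    have hacc' : accepted (U := U) i l = (l.filter (· ∈ A)).map lab := by
      rw [accepted]
      congr 2
      funext x
      simp [hmem]
    have hget : ∀ j < b₀, tape ((l.filter (· ∈ A)).map lab) j
        = tape (((l.filter (· ∈ A)).take b₀).map lab) j := by
      intro j hj
      rw [List.map_take]
      simp [tape, List.getD, hj]
    simp only [hg, hacc', learnOut]
    rw [show biasedCoin = (Env.labeled (U := U) G' f).coin from rfl,
      runTape_eq_of_examples (by rfl) hdraws (fun j hj => ?_) hget]
    have hj' : j < (l.filter (· ∈ A)).length := hj.trans_le hlen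
    have : tape ((l.filter (· ∈ A)).map lab) j = lab ((l.filter (· ∈ A))[j]) := by
      simp [tape, List.getD, hj']
    rw [this]
    have hj := List.getElem_mem hj'
    rw [List.mem_filter] at hj
    exact hexs _ ((mem_support_iid hl).2 _ hj.1) (by simpa using hj.2)
  have hgE : expect (iid (H.filter A hAs) b₀) g ≤ ENNReal.ofReal β' := by
    have h1 : expect (iid (H.filter A hAs) b₀) g
        = prob ((run prim (.labeled G' f) t₁ (learnerStart L n' (i / k) γ' β')).map Config.out)
          Bad := by
      rw [← iid_bind_runTape (by rfl) hdraws, ← hex, iid_map, PMF.bind_map, PMF.map_bind, prob_bind]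
      rfl
    rw [h1]
    refine le_trans (prob_mono_support fun d hd hdB => ?_) hacc.le
    obtain ⟨c, hc, rfl⟩ := (PMF.mem_support_map_iff _ _ _).1 hd
    obtain ⟨-, -, h, hh⟩ := hrun c hc
    refine ⟨h, hh, lt_of_lt_of_le hdB ?_⟩
    rw [hG', prob_map]
    refine (prob_far_le (η := η) hk {q | hypothesis prim L t₁ c.out q ≠ f q}).trans ?_
    rw [← hH]
    have h2 : prob H {x | accepts i x.2 = true ∧ x.1 ∈
          {q | hypothesis prim L t₁ c.out q ≠ f q}}
        = prob H A * prob (H.filter A hAs) (Prod.fst ⁻¹' {q | h q ≠ f q}) := by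
      rw [prob_eq_expect (H.filter A hAs), prob_mul_expect_filter, prob_eq_expect]
      congr 1
      funext x
      simp only [hh.hypothesis_eq]
      by_cases hx : x ∈ A <;> by_cases hx' : h x.1 = f x.1 <;>
        simp_all
    rw [h2]
    exact mul_le_of_le_one_left zero_le (prob_le_one _ _)
  -- enough accepted examples
  have hz : prob H A = ENNReal.ofReal (prob H A).toReal := (ENNReal.ofReal_toReal hA1).symm
  have hz1 : (prob H A).toReal ≤ 1 := by
    have := ENNReal.toReal_mono ENNReal.one_ne_top (prob_le_one H A)
    simpa using this
  have hz2 : γ / 2 ≤ (prob H A).toReal := by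
    rwa [← ENNReal.ofReal_le_iff_le_toReal hA1]
  have hcount := prob_iid_filter_lt H ENNReal.toReal_nonneg hz1 hz M b₀
  calc _ ≤ expect (iid H M) (fun l => ({l | (l.filter (· ∈ A)).length < b₀} : Set _).indicator 1 l
          + if b₀ ≤ (l.filter (· ∈ A)).length then g ((l.filter (· ∈ A)).take b₀) else 0) := by
        refine expect_mono_support fun l hl => ?_
        by_cases hlen : b₀ ≤ (l.filter (· ∈ A)).length
        · rw [if_pos hlen, hF l hl hlen]
          exact le_add_self
        · rw [if_neg hlen, add_zero]
          refine (prob_le_one _ _).trans (le_of_eq (Eq.symm ?_))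
          exact Set.indicator_of_mem (f := (1 : List (Q × ℕ) → ℝ≥0∞))
            (s := {l | (l.filter (· ∈ A)).length < b₀}) (not_le.1 hlen)
    _ ≤ _ := by
        rw [expect_add, ← prob_eq_expect]
        refine add_le_add (hcount.trans (ENNReal.ofReal_le_ofReal ?_))
          ((expect_iid_filter_le H hAs M b₀ g).trans hgE)
        refine mul_le_mul_of_nonneg_left ?_ (by positivity)
        refine (one_sub_pow_mono hz2 hz1 M).trans (le_of_eq ?_)
        rw [div_div]
        norm_num

end Threshold

/-! ### Accuracy of the synopsis -/

section Synopsis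

variable {X U Q Op : Type*} {prim : Primitives U Q Op}

lemma length_of_mem_support_collect {κ : ℕ → PMF X} {k : ℕ} {ds : List X}
    (h : ds ∈ (iterate (fun i ds => (κ i).map fun d => ds ++ [d]) k []).support) :
    ds.length = k ∧ ∀ d ∈ ds, ∃ i, d ∈ (κ i).support := by
  induction k generalizing ds with
  | zero =>
    simp only [iterate, PMF.support_pure, Set.mem_singleton_iff] at h
    subst h; simp
  | succ k ih =>
    rw [iterate, PMF.mem_support_bind_iff] at h
    obtain ⟨ds', h', h⟩ := h
    obtain ⟨d, hd, rfl⟩ := (PMF.mem_support_map_iff _ _ _).1 h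
    obtain ⟨h1, h2⟩ := ih h'
    refine ⟨by simp [h1], fun e he => ?_⟩
    rcases List.mem_append.1 he with he | he
    · exact h2 e he
    · rw [List.mem_singleton] at he
      exact ⟨k, he ▸ hd⟩

lemma prob_collect_le (κ : ℕ → PMF X) (B : ℕ → Set X) (k : ℕ) :
    prob (iterate (fun i ds => (κ i).map fun d => ds ++ [d]) k [])
      {ds | ∃ i d, ds[i]? = some d ∧ d ∈ B i} ≤ ∑ i ∈ Finset.range k, prob (κ i) (B i) := by
  induction k with
  | zero => simp [iterate, prob]
  | succ k ih =>
    rw [iterate, prob_bind, Finset.sum_range_succ]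
    refine le_trans ?_ (add_le_add_left ih _)
    rw [prob_eq_expect, ← expect_const (iterate (fun i ds => (κ i).map fun d => ds ++ [d]) k [])
      (prob (κ k) (B k)), ← expect_add]
    refine expect_mono_support fun ds hds => ?_
    have hlen := (length_of_mem_support_collect hds).1
    by_cases hb : ds ∈ {ds : List X | ∃ i d, ds[i]? = some d ∧ d ∈ B i}
    · rw [Set.indicator_of_mem hb]
      exact (prob_le_one _ _).trans le_self_add
    · refine le_trans ?_ le_add_self
      rw [prob_map]
      refine prob_mono fun d hd => ?_
      obtain ⟨i, e, h1, h2⟩ := hd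
      rcases lt_trichotomy i ds.length with hi | hi | hi
      · rw [List.getElem?_append_left hi] at h1
        exact absurd ⟨i, e, h1, h2⟩ hb
      · subst hi
        rw [List.getElem?_concat_length] at h1
        obtain rfl := Option.some.inj h1
        rwa [hlen] at h2
      · rw [List.getElem?_eq_none (by simp; omega)] at h1
        cases h1

lemma sum_threshold_indicators {k : ℕ} {f : ℝ} (hf : f ∈ Set.Icc (0 : ℝ) 1) :
    |∑ i ∈ Finset.range k, (if ((i + 1 : ℕ) : ℝ) ≤ k * f then (1 : ℝ) else 0) - k * f| ≤ 1 := by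
  have h0 : 0 ≤ k * f := mul_nonneg (by positivity) hf.1
  have hfl : ⌊k * f⌋₊ ≤ k := by
    apply Nat.floor_le_of_le
    nlinarith [hf.2, (Nat.cast_nonneg k : (0 : ℝ) ≤ k)]
  have : (Finset.range k).filter (fun i : ℕ => ((i + 1 : ℕ) : ℝ) ≤ k * f)
      = Finset.range ⌊k * f⌋₊ := by
    ext i
    rw [Finset.mem_filter, Finset.mem_range, Finset.mem_range, ← Nat.le_floor_iff h0]
    omega
  rw [Finset.sum_boole, this, Finset.card_range, abs_le]
  constructor <;> linarith [Nat.floor_le h0, Nat.lt_floor_add_one (k * f)]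

lemma abs_synopsisValue_sub_le {L : FunAlg Op} {k t : ℕ} (hk : 0 < k) {ds : List (List (Word U Q))}
    (hds : ds.length = k) {q : Q} {f f' : ℝ} (hf : f ∈ Set.Icc (0 : ℝ) 1)
    (hff : |f' - f| ≤ 1 / (8 * k))
    (h : ∀ i d, ds[i]? = some d → Far k (i + 1) f →
      hypothesis prim L t d q = decide (((i + 1 : ℕ) : ℝ) / k ≤ f')) :
    |synopsisValue prim L k t ds q - f| ≤ 2 / k := by
  classical
  have hk' : (0 : ℝ) < k := by exact_mod_cast hk
  set x : ℕ → ℝ := fun i => if hypothesis prim L t (ds.getD i []) q then 1 else 0 with hx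
  set y : ℕ → ℝ := fun i => if ((i + 1 : ℕ) : ℝ) ≤ k * f then 1 else 0 with hy
  have hS : synopsisValue prim L k t ds q = (∑ i ∈ Finset.range k, x i) / k := by
    rw [synopsisValue, ← Fin.sum_univ_fun_getElem, ← hds, Finset.sum_range]
    congr 1
    refine Finset.sum_congr rfl fun i _ => ?_
    simp [hx]
  have hxy : |∑ i ∈ Finset.range k, x i - ∑ i ∈ Finset.range k, y i| ≤ 1 := by
    rw [← Finset.sum_sub_distrib]
    calc _ ≤ ∑ i ∈ Finset.range k, |x i - y i| := Finset.abs_sum_le_sum_abs _ _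
      _ ≤ ∑ i ∈ Finset.range k, if ¬ Far k (i + 1) f then (1 : ℝ) else 0 := by
          refine Finset.sum_le_sum fun i hi => ?_
          by_cases hfar : Far k (i + 1) f
          · have hi' : i < ds.length := by rw [hds]; exact Finset.mem_range.1 hi
            have := h i (ds.getD i []) (by simp [hi']) hfar
            rw [if_neg (not_not.2 hfar)]
            have hiff : ((i + 1 : ℕ) : ℝ) / k ≤ f' ↔ ((i + 1 : ℕ) : ℝ) ≤ k * f := by
              rw [div_le_iff₀ hk']
              rw [far_iff hk] at hfar
              rw [le_div_iff₀ (by positivity)] at hff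
              have h8 : |8 * k * f' - 8 * k * f| ≤ 1 := by
                rw [← mul_sub, abs_mul, abs_of_pos (by positivity : (0 : ℝ) < 8 * k)]
                linarith
              rw [abs_le] at h8
              rcases lt_abs.1 hfar with h' | h'
              · constructor <;> intro _ <;> linarith [h8.1, h8.2]
              · constructor <;> intro _ <;> linarith [h8.1, h8.2]
            simp only [hx, hy, this, decide_eq_true_iff, hiff, sub_self, abs_zero, le_refl]
          · rw [if_pos hfar]
            simp only [hx, hy]
            split_ifs <;> norm_num
      _ ≤ 1 := by
          rw [Finset.sum_boole]
          have : ((Finset.range k).filter fun i => ¬ Far k (i + 1) f).card ≤ 1 := by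
            rw [Finset.card_le_one]
            intro a ha b hb
            rw [Finset.mem_filter] at ha hb
            by_contra hab
            rcases far_or_far hk (fun h => hab (Nat.succ_injective h) : a + 1 ≠ b + 1) f with h | h
            · exact ha.2 h
            · exact hb.2 h
          exact_mod_cast this
  have hyf := sum_threshold_indicators (k := k) hf
  have e : synopsisValue prim L k t ds q - f
      = ((∑ i ∈ Finset.range k, x i - ∑ i ∈ Finset.range k, y i)
        + (∑ i ∈ Finset.range k, y i - k * f)) / k := by
    rw [hS]; field_simp; ring
  rw [e, abs_div, abs_of_pos hk']
  gcongr
  refine (abs_add_le _ _).trans ?_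
  linarith

variable {G : PMF Q} {k : ℕ} {η : ℝ} {n n' : ℕ} {D : Fin n → U} {D' : Fin n' → U}

/-- The threshold `i / k` accepts a fair share of the noisy answers. -/
def Heavy (P : Q → U → Bool) (G : PMF Q) (k : ℕ) (η γ : ℝ) {n : ℕ} (D : Fin n → U) (i : ℕ) : Prop :=
  ENNReal.ofReal (γ / 2) ≤ prob (idealPair P G k η D) {x | accepts i x.2 = true}

lemma prob_synopsisValue_le {L : FunAlg Op} (hk : 0 < k) {t : ℕ} {γ γ' : ℝ}
    (hγ : γ ∈ Set.Ioo (0 : ℝ) 1) (hγ' : 0 ≤ γ')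
    (hD : ∀ q, |countingAnswer prim.pred D' q - countingAnswer prim.pred D q| ≤ 1 / (8 * k))
    {ds : List (List (Word U Q))} (hds : ds.length = k)
    (h : ∀ i d, ds[i]? = some d → Heavy prim.pred G k η γ D (i + 1) →
      d ∉ badDescriptions prim L G k t γ' D D' (i + 1)) :
    prob G {q | 2 / k < |synopsisValue prim L k t ds q - countingAnswer prim.pred D q|}
      ≤ ENNReal.ofReal (k * γ' + γ / 2) := by
  classical
  set E : ℕ → Set Q := fun i => {q | Far k (i + 1) (countingAnswer prim.pred D q) ∧
    (Heavy prim.pred G k η γ D (i + 1) → hypothesis prim L t (ds.getD i []) q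
      ≠ decide (((i + 1 : ℕ) : ℝ) / k ≤ countingAnswer prim.pred D' q))} with hE
  set light := (Finset.range k).filter fun i => ¬ Heavy prim.pred G k η γ D (i + 1) with hlight
  have hfar : ∀ i ∈ light, prob G {q | Far k (i + 1) (countingAnswer prim.pred D q)}
      < ENNReal.ofReal (γ / 2) := by
    intro i hi
    rw [hlight, Finset.mem_filter] at hi
    refine lt_of_le_of_lt ?_ (not_le.1 hi.2)
    have := prob_far_le (G := G) (i := i + 1) (η := η) (D := D) (P := prim.pred) hk Set.univ
    simpa using this
  have hcard : light.card ≤ 1 := by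
    rw [Finset.card_le_one]
    intro a ha b hb
    by_contra hab
    have h1 := ENNReal.add_lt_add (hfar a ha) (hfar b hb)
    rw [← ENNReal.ofReal_add (by linarith [hγ.1]) (by linarith [hγ.1])] at h1
    have h2 : prob G ({q | Far k (a + 1) (countingAnswer prim.pred D q)}
        ∪ {q | Far k (b + 1) (countingAnswer prim.pred D q)}) = 1 := by
      have : {q | Far k (a + 1) (countingAnswer prim.pred D q)}
        ∪ {q | Far k (b + 1) (countingAnswer prim.pred D q)} = Set.univ :=
        Set.eq_univ_of_forall fun q =>
          far_or_far hk (fun h => hab (Nat.succ_injective h) : a + 1 ≠ b + 1) _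
      rw [this, prob_eq_expect, ← expect_const G 1]
      simp only [Set.indicator_univ]
      rfl
    have h3 := h2 ▸ (prob_union_le G _ _).trans_lt h1
    rw [ENNReal.one_lt_ofReal] at h3
    linarith [hγ.2]
  have hsub : {q | 2 / k < |synopsisValue prim L k t ds q - countingAnswer prim.pred D q|}
      ⊆ ⋃ i ∈ Finset.range k, E i := by
    intro q hq
    by_contra hcon
    simp only [Set.mem_iUnion, not_exists, Finset.mem_range] at hcon
    refine absurd hq (not_lt.2 (abs_synopsisValue_sub_le hk hds (countingAnswer_mem_Icc _ _ _)
      (hD q) fun i d hi hfari => ?_))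
    by_contra hne
    have hik : i < k := by
      rw [← hds]
      exact (List.getElem?_eq_some_iff.1 hi).1
    refine hcon i hik ⟨hfari, fun _ => ?_⟩
    rwa [List.getD, hi]
  refine (prob_mono hsub).trans ((prob_biUnion_le _ _ _).trans ?_)
  rw [← Finset.sum_filter_add_sum_filter_not (Finset.range k)
    fun i => Heavy prim.pred G k η γ D (i + 1), ENNReal.ofReal_add (by positivity)
    (by linarith [hγ.1])]
  refine add_le_add ?_ ?_
  · calc _ ≤ ∑ i ∈ (Finset.range k).filter (fun i => Heavy prim.pred G k η γ D (i + 1)),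
          ENNReal.ofReal γ' := by
          refine Finset.sum_le_sum fun i hi => ?_
          rw [Finset.mem_filter, Finset.mem_range] at hi
          have hi' : i < ds.length := by rw [hds]; exact hi.1
          have := h i (ds.getD i []) (by simp [hi']) hi.2
          refine le_trans (prob_mono ?_) (not_lt.1 this)
          exact fun q hq => ⟨hq.1, hq.2 hi.2⟩
      _ ≤ ∑ i ∈ Finset.range k, ENNReal.ofReal γ' :=
          Finset.sum_le_sum_of_subset (Finset.filter_subset _ _)
      _ = _ := by
          rw [Finset.sum_const, Finset.card_range, nsmul_eq_mul, ENNReal.ofReal_mul (by positivity),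
            ENNReal.ofReal_natCast]
  · calc _ ≤ ∑ i ∈ light, ENNReal.ofReal (γ / 2) := by
          refine Finset.sum_le_sum fun i hi => ?_
          exact (prob_mono fun q hq => hq.1).trans (hfar i hi).le
      _ ≤ _ := by
          rw [Finset.sum_const, nsmul_eq_mul]
          refine mul_le_of_le_one_left zero_le ?_
          exact_mod_cast hcard

/-- The distribution of the released synopsis is concentrated on accurate ones. -/
lemma prob_inaccurate_le {L : FunAlg Op} {𝒢 : Set (PMF Q)} (hG : G ∈ 𝒢) {b t : ℕ → ℝ → ℝ → ℕ}
    {γ γ' β' : ℝ} (hγ : γ ∈ Set.Ioo (0 : ℝ) 1) (hγ' : γ' ∈ Set.Ioo (0 : ℝ) 1)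
    (hβ' : β' ∈ Set.Ioo (0 : ℝ) 1)
    (hL : LearnsThresholds prim L (smoothExtension (2 / γ) 𝒢) (itemPredicates prim.pred) b t)
    (hn' : 0 < n') (hk : 0 < k) (hη : 0 ≤ η)
    (hD : ∀ q, |countingAnswer prim.pred D' q - countingAnswer prim.pred D q| ≤ 1 / (8 * k)) (M : ℕ) :
    prob ((iid (noisyPair prim.pred G k η D) M).bind (learnAll prim L k (t n' γ' β') n' γ' β'))
      {ds | ENNReal.ofReal (k * γ' + γ / 2) < prob G {q | 2 / k <
        |synopsisValue prim L k (t n' γ' β') ds q - countingAnswer prim.pred D q|}}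
      ≤ M * ENNReal.ofReal ((16 * k + 1) * Real.exp (-(η / (16 * k))))
        + k * (ENNReal.ofReal (2 ^ min (b n' γ' β') (t n' γ' β') * (1 - γ / 4) ^ M)
          + ENNReal.ofReal β') := by
  classical
  rw [prob_bind]
  refine (expect_iid_noisyPair_le _ G hk hη D M fun l => prob_le_one _ _).trans ?_
  gcongr
  set B : ℕ → Set (List (Word U Q)) := fun i =>
    if Heavy prim.pred G k η γ D (i + 1) then
      badDescriptions prim L G k (t n' γ' β') γ' D D' (i + 1) else ∅ with hB
  have step : ∀ l : List (Q × ℕ), prob (learnAll prim L k (t n' γ' β') n' γ' β' l)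
      {ds | ENNReal.ofReal (k * γ' + γ / 2) < prob G {q | 2 / k <
        |synopsisValue prim L k (t n' γ' β') ds q - countingAnswer prim.pred D q|}}
      ≤ ∑ i ∈ Finset.range k, prob (learnOut prim L (t n' γ' β') n' (((i + 1 : ℕ) : ℝ) / k) γ' β'
          (tape (accepted (i + 1) l))) (B i) := by
    intro l
    have hlaw : learnAll prim L k (t n' γ' β') n' γ' β' l
        = iterate (fun i ds => (learnOut prim L (t n' γ' β') n' (((i + 1 : ℕ) : ℝ) / k) γ' β'
          (tape (accepted (i + 1) l))).map fun d => ds ++ [d]) k [] := by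
      simp [learnAll]
    rw [hlaw]
    refine le_trans (prob_mono_support ?_) (prob_collect_le (fun i => learnOut prim L (t n' γ' β')
      n' (((i + 1 : ℕ) : ℝ) / k) γ' β' (tape (accepted (i + 1) l))) B k)
    intro ds hds hbad
    by_contra hcon
    have hgood : ∀ i d, ds[i]? = some d → Heavy prim.pred G k η γ D (i + 1) →
        d ∉ badDescriptions prim L G k (t n' γ' β') γ' D D' (i + 1) := by
      intro i d hid hheavy hmem
      refine hcon ⟨i, d, hid, ?_⟩
      simp only [hB]
      rwa [if_pos hheavy]
    have := prob_synopsisValue_le hk hγ hγ'.1.le hD (length_of_mem_support_collect hds).1 hgood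
    exact (lt_of_lt_of_le hbad this).false
  refine (expect_mono step).trans ?_
  rw [expect_sum]
  calc _ ≤ ∑ _i ∈ Finset.range k, (ENNReal.ofReal (2 ^ min (b n' γ' β') (t n' γ' β')
          * (1 - γ / 4) ^ M) + ENNReal.ofReal β') := by
        refine Finset.sum_le_sum fun i hi => ?_
        by_cases hheavy : Heavy prim.pred G k η γ D (i + 1)
        · simp only [hB, if_pos hheavy]
          exact expect_learnOut_le hG hγ hγ' hβ' hL hn' hk (Finset.mem_range.1 hi) hD hheavy M
        · simp only [hB, if_neg hheavy]
          simp [prob_eq_expect, expect]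
    _ = _ := by rw [Finset.sum_const, Finset.card_range, nsmul_eq_mul]

end Synopsis

/-! ### The choice of the parameters -/

section Parameters

variable {U Q Op : Type*} {prim : Primitives U Q Op}

lemma grid_bounds {α : ℝ} (hα : α ∈ Set.Ioo (0 : ℝ) 1) :
    0 < ⌈2 / α⌉₊ ∧ 2 / α ≤ (⌈2 / α⌉₊ : ℝ) ∧ (⌈2 / α⌉₊ : ℝ) ≤ 3 / α := by
  have h0 : 0 < 2 / α := div_pos two_pos hα.1
  refine ⟨Nat.ceil_pos.2 h0, Nat.le_ceil _, (Nat.ceil_lt_add_one h0.le).le.trans ?_⟩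
  have : 1 ≤ 1 / α := by rw [le_div_iff₀ hα.1]; linarith [hα.2]
  have e : 3 / α = 2 / α + 1 / α := by ring
  linarith

lemma one_le_log_inv {x : ℝ} (hx : 0 < x) (hx' : x ≤ 1 / 24) : 1 ≤ Real.log (1 / x) := by
  rw [Real.le_log_iff_exp_le (by positivity), le_div_iff₀ hx]
  nlinarith [Real.exp_one_lt_d9]

lemma chernoff_le {β γ : ℝ} {b M : ℕ} (hb : 1 ≤ b) (hβ : 0 < β) (hβ' : β ≤ 1 / 24)
    (hγ : γ ∈ Set.Ioo (0 : ℝ) 1) (hM : 8 * b * Real.log (1 / β) / γ ≤ M) :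
    2 ^ b * (1 - γ / 4) ^ M ≤ β := by
  set l := Real.log (1 / β) with hl
  have hl1 : 1 ≤ l := one_le_log_inv hβ hβ'
  have hb' : (1 : ℝ) ≤ b := by exact_mod_cast hb
  have h2 : (2 : ℝ) ≤ Real.exp 1 := by linarith [Real.add_one_le_exp (1 : ℝ)]
  rw [div_le_iff₀ hγ.1] at hM
  calc (2 : ℝ) ^ b * (1 - γ / 4) ^ M ≤ Real.exp 1 ^ b * Real.exp (-(γ / 4)) ^ M := by
        have h0 : 0 ≤ 1 - γ / 4 := by linarith [hγ.2]
        gcongr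
        linarith [Real.add_one_le_exp (-(γ / 4))]
    _ = Real.exp (b - M * γ / 4) := by
        rw [← Real.exp_nat_mul, ← Real.exp_nat_mul, ← Real.exp_add]
        ring_nf
    _ ≤ Real.exp (-l) := by
        rw [Real.exp_le_exp]
        nlinarith
    _ = β := by rw [hl, Real.log_div one_ne_zero hβ.ne', Real.log_one, zero_sub, neg_neg,
        Real.exp_log hβ]

lemma noise_le {α β γ ε : ℝ} (hα : 0 < α) (hα' : α < 1 / 2) (hβ : β ∈ Set.Ioo (0 : ℝ) 1)
    (hγ : γ ∈ Set.Ioo (0 : ℝ) 1) (hε : 0 < ε) {b b₀ n k M : ℕ} (hb : 1 ≤ b) (hb₀ : b₀ ≤ b)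
    (hk : 0 < k) (hk' : (k : ℝ) ≤ 3 / α)
    (hM : M = ⌈8 * b₀ * Real.log (1 / (β * α / 24)) / γ⌉₊) (hM0 : 0 < M)
    (hn : 16000 * b * Real.log (b / (α * γ * β)) * Real.log (1 / (β * α / 24)) / (ε * α * γ) ≤ n) :
    M * ((16 * k + 1) * Real.exp (-((ε * n / (2 * M)) / (16 * k)))) ≤ β / 4 := by
  obtain ⟨hβ0, hβ1⟩ := hβ
  obtain ⟨hγ0, hγ1⟩ := hγ
  have hb1 : (1 : ℝ) ≤ b := by exact_mod_cast hb
  have hb0' : (b₀ : ℝ) ≤ b := by exact_mod_cast hb₀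
  have hk0 : (0 : ℝ) < k := by exact_mod_cast hk
  have hM0' : (0 : ℝ) < M := by exact_mod_cast hM0
  have hβα : 0 < β * α := mul_pos hβ0 hα
  have hβα1 : β * α ≤ 1 := by nlinarith
  set l := Real.log (1 / (β * α / 24)) with hl
  have hl1 : 1 ≤ l := one_le_log_inv (by positivity) (by linarith)
  have hl2 : l ≤ 24 / (β * α) := by
    have h := Real.log_le_sub_one_of_pos (by positivity : 0 < 1 / (β * α / 24))
    have e : 1 / (β * α / 24) = 24 / (β * α) := by field_simp
    rw [← hl, e] at h
    linarith
  set X := (b : ℝ) / (α * γ * β) with hX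
  have hαγβ : 0 < α * γ * β := by positivity
  have hX2 : 2 ≤ X := by
    rw [hX, le_div_iff₀ hαγβ]
    have h1 : γ * β ≤ 1 := by nlinarith
    nlinarith
  have hX0 : 0 < X := by linarith
  set lX := Real.log X with hlX
  have hlX0 : 0 < lX := Real.log_pos (by linarith)
  -- the number of samples
  have hMle : (M : ℝ) ≤ 9 * b * l / γ := by
    rw [hM]
    refine (Nat.ceil_lt_add_one (by positivity)).le.trans ?_
    rw [le_div_iff₀ hγ0, add_mul, div_mul_cancel₀ _ hγ0.ne']
    nlinarith [mul_le_mul_of_nonneg_right hb0' (by linarith : 0 ≤ l), mul_le_mul hb1 hl1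
      zero_le_one (by linarith)]
  have hk1 : 16 * (k : ℝ) + 1 ≤ 49 / α := by
    rw [le_div_iff₀ hα] at hk' ⊢
    nlinarith
  -- the noise rate
  have hrate : 18 * lX ≤ (ε * n / (2 * M)) / (16 * k) := by
    rw [div_div, le_div_iff₀ (by positivity)]
    rw [div_le_iff₀ (by positivity)] at hn
    have h1 : M * γ ≤ 9 * b * l := by rwa [le_div_iff₀ hγ0] at hMle
    have h2 : k * α ≤ 3 := by rwa [le_div_iff₀ hα] at hk'
    have h3 : (M * γ) * (k * α) ≤ 9 * b * l * 3 :=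
      mul_le_mul h1 h2 (by positivity) (by positivity)
    have h4 : 18 * lX * (2 * M * (16 * k)) * (α * γ) ≤ ε * n * (α * γ) := by
      calc _ = 576 * lX * ((M * γ) * (k * α)) := by ring
        _ ≤ 576 * lX * (9 * b * l * 3) := by gcongr
        _ = 15552 * (b * lX * l) := by ring
        _ ≤ 16000 * (b * lX * l) := by
            gcongr
            norm_num
        _ = 16000 * b * lX * l := by ring
        _ ≤ _ := hn.trans (le_of_eq (by ring))
    exact le_of_mul_le_mul_right h4 (by positivity)
  have hexp : Real.exp (-((ε * n / (2 * M)) / (16 * k))) ≤ (X ^ 18)⁻¹ := by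
    rw [Real.exp_neg]
    gcongr
    calc X ^ 18 = Real.exp (18 * lX) := by
          rw [show (18 : ℝ) * lX = ((18 : ℕ) : ℝ) * lX by norm_num, Real.exp_nat_mul,
            Real.exp_log hX0]
      _ ≤ _ := Real.exp_le_exp.2 hrate
  have hsize : M * (16 * k + 1) ≤ 10584 * X ^ 2 * β := by
    calc (M : ℝ) * (16 * k + 1) ≤ (9 * b * (24 / (β * α)) / γ) * (49 / α) := by
          gcongr
          exact hMle.trans (by gcongr)
      _ = 10584 * (b * 1 * 1) / (α ^ 2 * γ * β) := by field_simp; ring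
      _ ≤ 10584 * (b * b * (1 / γ)) / (α ^ 2 * γ * β) := by
          gcongr
          rw [le_div_iff₀ hγ0]
          linarith
      _ = 10584 * X ^ 2 * β := by rw [hX]; field_simp
  have h16 : (42336 : ℝ) ≤ X ^ 16 :=
    calc (42336 : ℝ) ≤ 2 ^ 16 := by norm_num
      _ ≤ X ^ 16 := by gcongr
  calc _ = (M * (16 * k + 1)) * Real.exp (-((ε * n / (2 * M)) / (16 * k))) := by ring
    _ ≤ (10584 * X ^ 2 * β) * (X ^ 18)⁻¹ := by gcongr
    _ = 10584 * β / X ^ 16 := by field_simp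
    _ ≤ β / 4 := by
        rw [div_le_div_iff₀ (by positivity) (by norm_num)]
        nlinarith

lemma subsample_size {α : ℝ} (hα : α ∈ Set.Ioo (0 : ℝ) 1) {N n' k : ℕ} (hN : 2 ≤ N)
    (hn' : n' = ⌈7000 * Real.log N / α ^ 2⌉₊) (hk : 0 < k) (hk' : (k : ℝ) ≤ 3 / α) :
    0 < n' ∧ 2 * N * Real.exp (-(n' * (1 / (8 * k)) ^ 2 / 4)) < 1 := by
  obtain ⟨hα0, hα1⟩ := hα
  have hN' : (2 : ℝ) ≤ N := by exact_mod_cast hN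
  have hk0 : (0 : ℝ) < k := by exact_mod_cast hk
  have hlog : 0 < Real.log N := Real.log_pos (by linarith)
  have hn1 : 7000 * Real.log N / α ^ 2 ≤ n' := hn' ▸ Nat.le_ceil _
  refine ⟨hn' ▸ Nat.ceil_pos.2 (by positivity), ?_⟩
  have h3 : 3 * Real.log N ≤ n' * (1 / (8 * k)) ^ 2 / 4 := by
    rw [div_le_iff₀ (by positivity)] at hn1
    rw [le_div_iff₀ hα0] at hk'
    have hkα : (k * α) ^ 2 ≤ 9 := by nlinarith [mul_pos hk0 hα0]
    have e : (n' : ℝ) * (1 / (8 * k)) ^ 2 / 4 = n' / (256 * k ^ 2) := by field_simp; ring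
    rw [e, le_div_iff₀ (by positivity)]
    have : 3 * Real.log N * (256 * k ^ 2) * α ^ 2 ≤ n' * α ^ 2 := by
      calc _ = 768 * Real.log N * (k * α) ^ 2 := by ring
        _ ≤ 768 * Real.log N * 9 := by gcongr
        _ ≤ 7000 * Real.log N := by linarith
        _ ≤ _ := hn1
    exact le_of_mul_le_mul_right this (by positivity)
  have hexp : Real.exp (-(n' * (1 / (8 * k)) ^ 2 / 4)) ≤ ((N : ℝ) ^ 3)⁻¹ := by
    rw [Real.exp_neg]
    gcongr
    calc (N : ℝ) ^ 3 = Real.exp (3 * Real.log N) := by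
          rw [show (3 : ℝ) * Real.log N = ((3 : ℕ) : ℝ) * Real.log N by norm_num, Real.exp_nat_mul,
            Real.exp_log (by linarith)]
      _ ≤ _ := Real.exp_le_exp.2 h3
  calc _ ≤ 2 * N * ((N : ℝ) ^ 3)⁻¹ := by gcongr
    _ = 2 / (N : ℝ) ^ 2 := by field_simp
    _ < 1 := by rw [div_lt_one (by positivity)]; nlinarith

/-- The running time of the release program. -/
def releaseTime (n t k M : ℕ) : ℕ := 2000 * (n + t + k + M + 1) ^ 2

lemma le_releaseTime (n t k M : ℕ) :
    k * 11 + M * 11 + M * (n * 17 + (16 * k + 1) * 50 + 70) + k * (M * 40 + t * 50 + 110) + 150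
      ≤ releaseTime n t k M ∧ k * (t * 47 + 70) + 60 ≤ releaseTime n t k M ∧
      20 ≤ releaseTime n t k M := by
  unfold releaseTime
  have e : (n + t + k + M + 1) ^ 2 = n * n + t * t + k * k + M * M + 1 + 2 * (n * t + n * k + n * M
      + n + t * k + t * M + t + k * M + k + M) := by ring
  rw [e]
  refine ⟨?_, ?_, by omega⟩
  · calc _ = k * 121 + M * 131 + 17 * (n * M) + 840 * (k * M) + 50 * (t * k) + 150 := by ring
      _ ≤ _ := by omega
  · calc _ = 47 * (t * k) + 70 * k + 60 := by ring
      _ ≤ _ := by omega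

lemma releaseTime_le {α β γ : ℝ} (hα : α ∈ Set.Ioo (0 : ℝ) 1) (hβ : β ∈ Set.Ioo (0 : ℝ) 1)
    (hγ : γ ∈ Set.Ioo (0 : ℝ) 1) (n t b : ℕ) {K : ℕ} (hK : K = 3000000) :
    (releaseTime n t ⌈2 / α⌉₊ (sampleCount b t α β γ) : ℝ)
      ≤ K * (1 + t + n + 1 / α + Real.log (1 / β) + 1 / γ) ^ K := by
  obtain ⟨-, -, hk⟩ := grid_bounds hα
  set k := ⌈2 / α⌉₊
  set M := sampleCount b t α β γ with hM
  obtain ⟨hα0, hα1⟩ := hα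
  obtain ⟨hβ0, hβ1⟩ := hβ
  obtain ⟨hγ0, hγ1⟩ := hγ
  set Y := 1 + (t : ℝ) + n + 1 / α + Real.log (1 / β) + 1 / γ with hY
  have ht : (0 : ℝ) ≤ t := Nat.cast_nonneg _
  have hn : (0 : ℝ) ≤ n := Nat.cast_nonneg _
  have h1α : 0 < 1 / α := by positivity
  have h1γ : 0 < 1 / γ := by positivity
  have hlβ : 0 ≤ Real.log (1 / β) := Real.log_nonneg (by rw [le_div_iff₀ hβ0]; linarith)
  have hY1 : 1 ≤ Y := by linarith
  have hlog : Real.log (1 / (β * α / 24)) ≤ 4 * Y := by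
    have e : 1 / (β * α / 24) = 24 * (1 / β) * (1 / α) := by field_simp
    rw [e, Real.log_mul (by positivity) (by positivity), Real.log_mul (by norm_num) (by positivity)]
    have h24 : Real.log 24 ≤ 4 := by
      rw [Real.log_le_iff_le_exp (by norm_num)]
      have h2 : (2.7 : ℝ) ≤ Real.exp 1 := by linarith [Real.exp_one_gt_d9]
      calc (24 : ℝ) ≤ 2.7 ^ 4 := by norm_num
        _ ≤ Real.exp 1 ^ 4 := by gcongr
        _ = Real.exp 4 := by rw [← Real.exp_nat_mul]; norm_num
    have := Real.log_le_sub_one_of_pos h1α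
    linarith
  have hlog0 : 0 ≤ Real.log (1 / (β * α / 24)) := by
    refine zero_le_one.trans (one_le_log_inv (by positivity) ?_)
    nlinarith
  have hY3 : Y ≤ Y ^ 3 := by
    calc Y = Y ^ 1 := (pow_one Y).symm
      _ ≤ Y ^ 3 := pow_le_pow_right₀ hY1 (by norm_num)
  have hMle : (M : ℝ) ≤ 33 * Y ^ 3 := by
    have hbt : ((min b t : ℕ) : ℝ) ≤ Y := by
      have : ((min b t : ℕ) : ℝ) ≤ t := by exact_mod_cast min_le_right _ _
      linarith
    rw [hM, sampleCount]
    refine (Nat.ceil_lt_add_one (by positivity)).le.trans ?_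
    calc _ ≤ 8 * Y * (4 * Y) * (1 / γ) + 1 := by rw [div_eq_mul_one_div _ γ]; gcongr
      _ ≤ 8 * Y * (4 * Y) * Y + Y ^ 3 := by
          gcongr
          · linarith
          · linarith
      _ = 33 * Y ^ 3 := by ring
  have hkle : (k : ℝ) ≤ 3 * Y ^ 3 := by
    have e : 3 / α = 3 * (1 / α) := by ring
    rw [e] at hk
    linarith
  have hZ : (n + t + k + M + 1 : ℝ) ≤ 37 * Y ^ 3 := by linarith
  calc (releaseTime n t k M : ℝ) = 2000 * (n + t + k + M + 1 : ℝ) ^ 2 := by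
        rw [releaseTime]; push_cast; ring
    _ ≤ 2000 * (37 * Y ^ 3) ^ 2 := by gcongr
    _ = 2738000 * Y ^ 6 := by ring
    _ ≤ K * Y ^ K := by
        have h1 : (2738000 : ℝ) ≤ K := by
          have : 2738000 ≤ K := by omega
          exact_mod_cast this
        have h2 : 6 ≤ K := by omega
        gcongr

end Parameters

/-! ### The release algorithm -/

section Release

variable {U Q Op : Type*} {prim : Primitives U Q Op}

lemma synopsisValue_mem_Icc {L : FunAlg Op} {k t : ℕ} {ds : List (List (Word U Q))}
    (hds : ds.length = k) (q : Q) : synopsisValue prim L k t ds q ∈ Set.Icc (0 : ℝ) 1 := by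
  rw [synopsisValue, ← hds]
  constructor
  · refine div_nonneg (List.sum_nonneg fun x hx => ?_) (Nat.cast_nonneg _)
    obtain ⟨d, -, rfl⟩ := List.mem_map.1 hx
    split_ifs <;> norm_num
  · refine div_le_one_of_le₀ ?_ (Nat.cast_nonneg _)
    refine (List.sum_le_card_nsmul _ 1 fun x hx => ?_).trans ?_
    · obtain ⟨d, -, rfl⟩ := List.mem_map.1 hx
      split_ifs <;> norm_num
    · simp

lemma mem_support_learnAll {L : FunAlg Op} {k t n : ℕ} {γ β : ℝ} {l : List (Q × ℕ)}
    {ds : List (List (Word U Q))} (h : ds ∈ (learnAll prim L k t n γ β l).support) :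
    ds.length = k ∧ ∀ d ∈ ds, d.length ≤ t := by
  obtain ⟨h1, h2⟩ := length_of_mem_support_collect
    (κ := fun i => learnOut prim L t n ((i + 1) / k) γ β (tape (accepted (i + 1) l))) h
  exact ⟨h1, fun d hd => (h2 d hd).elim fun i hi => learnOut_length hi⟩

lemma Represents.unique {e : Program Op} {T : ℕ} {d : List (Word U Q)} {h h' : Q → Word U Q}
    (H : Represents prim e T d h) (H' : Represents prim e T d h') : h = h' := by
  funext q
  obtain ⟨c, hc⟩ := (run prim .deterministic T (start e [.qry q, .num d.length] d)).support_nonempty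
  have := (H q c hc).2.symm.trans (H' q c hc).2
  simpa using this

lemma prob_empty {R : Type*} (p : PMF R) : prob p ∅ = 0 := by simp [prob]

/-- For coarse accuracy the constant synopsis `1 / 2` is enough. -/
lemma release_of_ge {L : FunAlg Op} {𝒢 : Set (PMF Q)} {n n' b t T : ℕ} {ε α β γ : ℝ} (hε : 0 ≤ ε)
    (hα : 0 < α) (hα' : 1 / 2 ≤ α) (hβ : 0 < β) (hT : 20 ≤ T) {params : List ℝ}
    (hparams : params = [(n : ℝ), ε, α, β, γ, (n' : ℝ), (b : ℝ), (t : ℝ)]) :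
    ReleasesInTime prim (releaseAlg L) params 𝒢 n T ∧
    (∀ G ∈ 𝒢, DifferentiallyPrivate ε
      (fun D : Fin n → U => synopsis prim (releaseAlg L) params T G D)) ∧
    AccurateRelease prim (releaseAlg L) params 𝒢 n T α β γ := by
  have htri : ∀ (G : PMF Q) (D : Fin n → U),
      Reaches prim (.sampling G) (fun _ c => c.code = [] ∧ c.out = [])
        (releaseStart (releaseAlg L) params D) 20 (.pure ()) := fun G D =>
    releaseMain_triple_of_ge (L := L) hα hα' (by subst hparams; simp [listCells]) [] 0
  have hsyn : ∀ (G : PMF Q) (D : Fin n → U),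
      synopsis prim (releaseAlg L) params T G D = .pure [] := fun G D => by
    rw [synopsis, (htri G D).run_map (fun _ _ _ h => h.1) (fun _ => []) Config.out
      (fun _ _ h => h.2) hT, PMF.pure_map]
  refine ⟨fun G _ D c hc => ?_, fun G _ D D' _ S => ?_, fun G _ D => ?_⟩
  · obtain ⟨-, -, h1, h2⟩ := (htri G D).run_support (fun _ _ _ h => h.1) hT c hc
    refine ⟨h1, fun _ => 1 / 2, fun _ => by norm_num, ?_⟩
    rw [h2]
    exact represents_half hT
  · simp only [hsyn]
    refine le_mul_of_one_le_left zero_le ?_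
    rw [ENNReal.one_le_ofReal]
    exact Real.one_le_exp hε
  · rw [hsyn]
    refine lt_of_eq_of_lt ?_ (ENNReal.ofReal_pos.2 hβ)
    rw [prob_eq_expect, expect_pure, Set.indicator_of_notMem]
    rintro ⟨S, hS, hlt⟩
    have hS' : ∀ q, S q = 1 / 2 := fun q => by
      have := congrFun (hS.unique (represents_half hT)) q
      simpa using this
    have hempty : {q | α < |S q - countingAnswer prim.pred D q|} = ∅ := by
      refine Set.eq_empty_of_forall_notMem fun q hq => absurd hq (not_lt.2 (le_trans ?_ hα'))
      have := countingAnswer_mem_Icc prim.pred D q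
      rw [hS', abs_le]
      constructor <;> linarith [this.1, this.2]
    rw [hempty, prob_empty] at hlt
    exact absurd hlt not_lt_zero

/-- The law of the released description. -/
lemma release_reaches (L : FunAlg Op) {n n' b t k M : ℕ} {ε α β γ : ℝ} (hα : 0 < α)
    (hα' : α < 1 / 2) (hk : k = ⌈2 / α⌉₊) (hM : M = sampleCount b t α β γ) {params : List ℝ}
    (hparams : params = [(n : ℝ), ε, α, β, γ, (n' : ℝ), (b : ℝ), (t : ℝ)]) (G : PMF Q)
    (D : Fin n → U) :
    Reaches prim (.sampling G) (fun ds c => c.code = [] ∧ c.out = [.num k, .num t] ++ encodeAll ds)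
      (releaseStart (releaseAlg L) params D) (releaseTime n t k M)
      ((iid (noisyPair prim.pred G k (ε * n / (2 * M)) D) M).bind
        (learnAll prim L k t n' (γ * α / 8) (β * α / 24))) := by
  have := releaseMain_triple (prim := prim) (env := .sampling G) (L := L) (G := G) (n' := n') (b := b)
    (ε := ε) (o := [])
    (m := (releaseStart (releaseAlg L) params D).mem) rfl rfl hα hα' D hk hM
    (by subst hparams; simp [releaseStart, start, listCells])
    (by subst hparams; simp [releaseStart, start, listCells])
    (by subst hparams; simp [releaseStart, start, listCells])
    (by subst hparams; simp [releaseStart, start, listCells])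
    (by subst hparams; simp [releaseStart, start, listCells])
    (by subst hparams; simp [releaseStart, start, listCells])
    (by subst hparams; simp [releaseStart, start, listCells])
    (by subst hparams; simp [releaseStart, start, listCells])
    (fun i => by simp [releaseStart, start, listCells])
  exact (this.mono (le_releaseTime n t k M).1) [] 0

lemma learner_time_pos {L : FunAlg Op} {𝒢 : Set (PMF Q)} {F : Set (Q → Bool)}
    {b t : ℕ → ℝ → ℝ → ℕ} (hL : LearnsThresholds prim L 𝒢 F b t) {n : ℕ} (hn : 0 < n) {γ β θ : ℝ}
    (hγ : γ ∈ Set.Ioo (0 : ℝ) 1) (hβ : β ∈ Set.Ioo (0 : ℝ) 1) (hθ : θ ∈ Set.Icc (0 : ℝ) 1)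
    {f : Q → Bool} (hf : f ∈ nThresholds F n θ) {G : PMF Q} (hG : G ∈ 𝒢) : 0 < t n γ β := by
  by_contra h
  obtain h0 : t n γ β = 0 := by omega
  have := ((hL n hn γ hγ β hβ θ hθ f hf G hG).1 (learnerStart L n θ γ β) (by
    rw [h0]; simp [run])).1
  simp [learnerStart, start] at this

lemma release_of_lt [Fintype Q] {L : FunAlg Op} {𝒢 : Set (PMF Q)} {b t : ℕ → ℝ → ℝ → ℕ}
    {n n' k M : ℕ} {ε α β γ β' γ' : ℝ} (hQ : 2 ≤ Fintype.card Q) (hε : 0 < ε) (hα : 0 < α)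
    (hα' : α < 1 / 2) (hβ : β ∈ Set.Ioo (0 : ℝ) 1) (hγ : γ ∈ Set.Ioo (0 : ℝ) 1)
    (hn' : n' = ⌈7000 * Real.log (Fintype.card Q) / α ^ 2⌉₊) (hβ' : β' = β * α / 24)
    (hγ' : γ' = γ * α / 8)
    (hL : LearnsThresholds prim L (smoothExtension (2 / γ) 𝒢) (itemPredicates prim.pred) b t)
    (hb : 1 ≤ b n' γ' β')
    (hn : 16000 * b n' γ' β' * Real.log (b n' γ' β' / (α * γ * β)) * Real.log (1 / β') / (ε * α * γ)
      ≤ n) (hk : k = ⌈2 / α⌉₊) (hM : M = sampleCount (b n' γ' β') (t n' γ' β') α β γ)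
    {params : List ℝ} (hparams : params = [(n : ℝ), ε, α, β, γ, (n' : ℝ), (b n' γ' β' : ℝ),
      (t n' γ' β' : ℝ)]) :
    ReleasesInTime prim (releaseAlg L) params 𝒢 n (releaseTime n (t n' γ' β') k M) ∧
    (∀ G ∈ 𝒢, DifferentiallyPrivate ε (fun D : Fin n → U =>
      synopsis prim (releaseAlg L) params (releaseTime n (t n' γ' β') k M) G D)) ∧
    AccurateRelease prim (releaseAlg L) params 𝒢 n (releaseTime n (t n' γ' β') k M) α β γ := by
  have hα1 : α ∈ Set.Ioo (0 : ℝ) 1 := ⟨hα, by linarith⟩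
  obtain ⟨hk0, hk2, hk3⟩ := grid_bounds hα1
  rw [← hk] at hk0 hk2 hk3
  set t₁ := t n' γ' β' with ht₁
  obtain ⟨T, hT⟩ : ∃ T, T = releaseTime n t₁ k M := ⟨_, rfl⟩
  rw [← hT]
  have hreach : ∀ (G : PMF Q) (D : Fin n → U), _ := fun G D =>
    release_reaches (prim := prim) L hα hα' hk hM hparams G D
  rw [← hT, ← hβ', ← hγ'] at hreach
  have hrep : ∀ (G : PMF Q) (D : Fin n → U), ∀ ds ∈ ((iid (noisyPair prim.pred G k
      (ε * n / (2 * M)) D) M).bind (learnAll prim L k t₁ n' γ' β')).support, ds.length = k ∧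
      Represents prim (releaseAlg L).eval T ([.num k, .num t₁] ++ encodeAll ds)
        fun q => .num (synopsisValue prim L k t₁ ds q) := by
    intro G D ds hds
    obtain ⟨l, -, hl⟩ := (PMF.mem_support_bind_iff _ _ _).1 hds
    obtain ⟨h1, h2⟩ := mem_support_learnAll hl
    exact ⟨h1, represents_synopsisValue h1 h2 (hT ▸ (le_releaseTime n t₁ k M).2.1)⟩
  have hsyn : ∀ (G : PMF Q) (D : Fin n → U), synopsis prim (releaseAlg L) params T G D
      = ((iid (noisyPair prim.pred G k (ε * n / (2 * M)) D) M).bind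
        (learnAll prim L k t₁ n' γ' β')).map fun ds => [.num k, .num t₁] ++ encodeAll ds :=
    fun G D => (hreach G D).run_map (fun _ _ _ h => h.1) _ Config.out (fun _ _ h => h.2) le_rfl
  refine ⟨fun G _ D c hc => ?_, fun G _ D D' hDD S => ?_, fun G hG D => ?_⟩
  · obtain ⟨ds, hds, h1, h2⟩ := (hreach G D).run_support (fun _ _ _ h => h.1) le_rfl c hc
    obtain ⟨h3, h4⟩ := hrep G D ds hds
    exact ⟨h1, _, synopsisValue_mem_Icc h3, h2 ▸ h4⟩
  · simp only [hsyn, prob_map]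
    exact prob_bind_le_mul (iid_noisyPair_le prim.pred G k M hε.le hDD) _ _
  · have hβ'1 : 0 < β' ∧ β' ≤ 1 / 24 := by
      have h0 := mul_pos hβ.1 hα
      have h1 : β * α ≤ 1 := by nlinarith [hβ.1, hβ.2]
      rw [hβ']
      constructor <;> linarith
    have hγ'1 : 0 < γ' ∧ γ' < 1 := by
      have h0 := mul_pos hγ.1 hα
      have h1 : γ * α ≤ 1 := by nlinarith [hγ.1, hγ.2]
      rw [hγ']
      constructor <;> linarith
    obtain ⟨hn'0, hsub⟩ := subsample_size hα1 hQ hn' hk0 hk3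
    have hk0' : (0 : ℝ) < k := by exact_mod_cast hk0
    have hαγβ : 0 < α * γ * β := mul_pos (mul_pos hα hγ.1) hβ.1
    have hb1 : (1 : ℝ) ≤ b n' γ' β' := by exact_mod_cast hb
    have hn0 : 0 < n := by
      have h1 : 0 < Real.log (b n' γ' β' / (α * γ * β)) := by
        apply Real.log_pos
        rw [lt_div_iff₀ hαγβ]
        have : γ * β ≤ 1 := by nlinarith [hγ.1, hγ.2, hβ.1, hβ.2]
        nlinarith
      have h2 : 1 ≤ Real.log (1 / β') := one_le_log_inv hβ'1.1 hβ'1.2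
      have h3 : 0 < ε * α * γ := mul_pos (mul_pos hε hα) hγ.1
      have h4 : (0 : ℝ) < n := lt_of_lt_of_le (by positivity) hn
      exact_mod_cast h4
    obtain ⟨D', hD'⟩ := exists_subsample (n' := n') prim.pred hn0 D
      (δ := 1 / (8 * k)) (by positivity) (by
        rw [div_le_one (by positivity)]
        have : (1 : ℝ) ≤ k := by exact_mod_cast hk0
        linarith) hsub
    have ht0 : 0 < t₁ := by
      refine learner_time_pos hL hn'0 hγ'1 ⟨hβ'1.1, by linarith [hβ'1.2]⟩
        (θ := 0) (by norm_num) (f := fun q => decide (0 ≤ countingAnswer prim.pred D' q))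
        ⟨fun j q => prim.pred q (D' j), fun j => ⟨D' j, rfl⟩, fun q => by simp [countingAnswer]⟩
        (G := G) ⟨G, hG, fun q => le_mul_of_one_le_left zero_le ?_⟩
      rw [ENNReal.one_le_ofReal, le_div_iff₀ hγ.1]
      linarith [hγ.2]
    have hb₀ : 1 ≤ min (b n' γ' β') t₁ := le_min hb ht0
    have hM' : 8 * (min (b n' γ' β') t₁ : ℕ) * Real.log (1 / β') / γ ≤ M := by
      rw [hM, sampleCount, hβ']
      exact Nat.le_ceil _
    have hM0 : 0 < M := by
      have h2 : 1 ≤ Real.log (1 / β') := one_le_log_inv hβ'1.1 hβ'1.2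
      have h3 : (1 : ℝ) ≤ (min (b n' γ' β') t₁ : ℕ) := by exact_mod_cast hb₀
      have h4 : (0 : ℝ) < M := lt_of_lt_of_le (div_pos (by positivity) hγ.1) hM'
      exact_mod_cast h4
    have hcher := chernoff_le hb₀ hβ'1.1 hβ'1.2 hγ hM'
    have hnoise := noise_le hα hα' hβ hγ hε hb (min_le_left _ t₁) hk0 hk3 hM hM0
      (by rw [← hβ']; exact hn)
    have hmain := prob_inaccurate_le (η := ε * n / (2 * M)) (D := D) hG hγ hγ'1
      ⟨hβ'1.1, by linarith [hβ'1.2]⟩ hL hn'0 hk0 (by positivity) hD' M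
    rw [← ht₁] at hmain
    rw [hsyn, prob_map]
    have hkα : k * α ≤ 3 := by rwa [le_div_iff₀ hα] at hk3
    refine lt_of_le_of_lt (prob_mono_support fun ds hds hbad => ?_) (hmain.trans_lt ?_)
    · obtain ⟨S, hS, hlt⟩ := hbad
      have hS' : ∀ q, S q = synopsisValue prim L k t₁ ds q := fun q => by
        have := congrFun (hS.unique (hrep G D ds hds).2) q
        simpa using this
      simp only [hS'] at hlt
      refine lt_of_le_of_lt (ENNReal.ofReal_le_ofReal ?_) (hlt.trans_le (prob_mono fun q hq => ?_))
      · rw [hγ']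
        nlinarith [hγ.1, mul_le_mul_of_nonneg_left hkα hγ.1.le]
      · refine lt_of_le_of_lt ?_ (show α < _ from hq)
        rw [div_le_iff₀ hk0']
        rw [div_le_iff₀ hα] at hk2
        linarith
    · rw [← ENNReal.ofReal_natCast, ← ENNReal.ofReal_natCast k, ← ENNReal.ofReal_mul (by positivity),
        ← ENNReal.ofReal_add (mul_nonneg (by positivity) (pow_nonneg (by linarith [hγ.2]) _))
          hβ'1.1.le, ← ENNReal.ofReal_mul (by positivity),
        ← ENNReal.ofReal_add (by positivity) (mul_nonneg (by positivity) (add_nonneg (mul_nonneg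
          (by positivity) (pow_nonneg (by linarith [hγ.2]) _)) hβ'1.1.le))]
      rw [ENNReal.ofReal_lt_ofReal_iff hβ.1]
      have h1 : (k : ℝ) * (2 ^ min (b n' γ' β') t₁ * (1 - γ / 4) ^ M + β') ≤ k * (β' + β') := by
        gcongr
      have h2 : k * (β' + β') ≤ β / 4 := by
        rw [hβ']
        nlinarith [mul_le_mul_of_nonneg_left hkα hβ.1.le]
      linarith [hβ.1]

end Release

end DataRelease

end

theorem theorem4p1 :
    ∃ (C c₁ c₂ c₃ : ℝ) (K : ℕ), 0 < C ∧ 0 < c₁ ∧ 0 < c₂ ∧ 0 < c₃ ∧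
    -- the release algorithm `A` is obtained from the program of the learner `L` alone
    ∀ {Op : Type*} (L : DataRelease.FunAlg Op), ∃ A : DataRelease.FunAlg Op,
    ∀ {U Q : Type*} [Fintype Q] (prim : DataRelease.Primitives U Q Op) (𝒢 : Set (PMF Q))
      (b t : ℕ → ℝ → ℝ → ℕ) (n n' : ℕ) (ε α β γ β' γ' : ℝ),
      2 ≤ Fintype.card Q → 0 < ε →
      α ∈ Set.Ioo (0 : ℝ) 1 → β ∈ Set.Ioo (0 : ℝ) 1 → γ ∈ Set.Ioo (0 : ℝ) 1 →
      n' = ⌈c₁ * Real.log (Fintype.card Q) / α ^ 2⌉₊ → β' = c₂ * (β * α) → γ' = c₃ * (γ * α) →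
      DataRelease.LearnsThresholds prim L (DataRelease.smoothExtension (2 / γ) 𝒢)
        (DataRelease.itemPredicates prim.pred) b t →
      1 ≤ b n' γ' β' →
      C * b n' γ' β' * Real.log (b n' γ' β' / (α * γ * β)) * Real.log (1 / β') / (ε * α * γ) ≤ n →
      -- `A` is given `n`, `ε`, `α`, `β`, `γ`, the value of `n'` and the learner's bounds there
      ∀ params : List ℝ, params = [(n : ℝ), ε, α, β, γ, (n' : ℝ), (b n' γ' β' : ℝ), (t n' γ' β' : ℝ)] →
      ∃ T : ℕ,
        (T : ℝ) ≤ K * (1 + t n' γ' β' + n + 1 / α + Real.log (1 / β) + 1 / γ) ^ K ∧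
        DataRelease.ReleasesInTime prim A params 𝒢 n T ∧
        (∀ G ∈ 𝒢, DataRelease.DifferentiallyPrivate ε
          (fun D : Fin n → U => DataRelease.synopsis prim A params T G D)) ∧
        DataRelease.AccurateRelease prim A params 𝒢 n T α β γ := by 
  obtain ⟨K, hK⟩ : ∃ K : ℕ, K = 3000000 := ⟨_, rfl⟩
  refine ⟨16000, 7000, 1 / 24, 1 / 8, K, by norm_num, by norm_num, by norm_num, by norm_num,
    fun L => ⟨DataRelease.releaseAlg L, ?_⟩⟩
  intro U Q _ prim 𝒢 b t n n' ε α β γ β' γ' hQ hε hα hβ hγ hn' hβ' hγ' hL hb hn params hparams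
  refine ⟨DataRelease.releaseTime n (t n' γ' β') ⌈2 / α⌉₊
    (DataRelease.sampleCount (b n' γ' β') (t n' γ' β') α β γ),
    DataRelease.releaseTime_le hα hβ hγ _ _ _ hK, ?_⟩
  rcases lt_or_ge α (1 / 2) with hα' | hα'
  · exact DataRelease.release_of_lt hQ hε hα.1 hα' hβ hγ hn' (by rw [hβ']; ring)
      (by rw [hγ']; ring) hL hb hn rfl rfl hparams
  · exact DataRelease.release_of_ge hε.le hα.1 hα' hβ.1 (DataRelease.le_releaseTime _ _ _ _).2.2
      hparams
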